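/- Let $A\in\mathbb{Z}^{m\times m}$ be a non-degenerate symmetric matrix of signature $(r,s)$, $r+s=m$. Let $S\in\mathbb{R}^{m\times m}$ be a matrix whose columns are eigenvectors of $A$, normalized so that $S^{\mathsf T}AS=\operatorname{diag}(I_r,-I_s)$, and put $A^+=(S^{-1})^{\mathsf T}\operatorname{diag}(I_r,\mathrm O)S^{-1}$, $A^-=(S^{-1})^{\mathsf T}\operatorname{diag}(\mathrm O,-I_s)S^{-1}$, $M=A^+-A^-$, and, for an $m\times n$ matrix $U$, $U^+=S\operatorname{diag}(I_r,\mathrm O)S^{-1}U$ and $U^-=S\operatorname{diag}(\mathrm O,I_s)S^{-1}U$. Let $\alpha,\beta\in\mathbb{N}_0$, and let $P_\alpha,P_\beta:\mathbb{C}^{m\times n}\to\mathbb{C}$ be polynomials with $P_\alpha(UN)=(\det N)^\alpha P_\alpha(U)$ and $P_\beta(UN)=(\det N)^\beta P_\beta(U)$ for all $U\in\mathbb{C}^{m\times n}$, $N\in\mathbb{C}^{n\times n}$. Put $P(U)=P_\alpha(U^+)P_\beta(U^-)$, $\operatorname{tr}\boldsymbol\Delta_M=\sum_{\nu=1}^n\sum_{\mu,\rho=1}^m\frac{\partial}{\partial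 U_{\mu\nu}}(M^{-1})_{\mu\rho}\frac{\partial}{\partial U_{\rho\nu}}$ and $$g(U)=\sum_{k\ge 0}\frac{(-1/(8\pi))^k}{k!}\bigl((\operatorname{tr}\boldsymbol\Delta_M)^kP\bigr)(U)\cdot\exp\bigl(2\pi\operatorname{tr}(U^{\mathsf T}A^-U)\bigr)\qquad(U\in\mathbb{R}^{m\times n}).$$ Let $\lambda=\alpha-\beta-s$ and $\operatorname{e}(z)=\exp(2\pi iz)$. For $H,K\in\mathbb{R}^{m\times n}$ and $Z=X+iY$ in the Siegel upper half-space $\mathbb{H}_n$ (the complex symmetric $n\times n$ matrices with positive definite imaginary part $Y$), let $Y^{1/2}$ be the positive definite square root of $Y$ and $$\theta_{H,K}(Z)=(\det Y)^{-\lambda/2}\sum_{U\in H+\mathbb{Z}^{m\times n}}g(UY^{1/2})\operatorname{e}\bigl(\operatorname{tr}(U^{\mathsf T}AUZ)/2+\operatorname{tr}(K^{\mathsf T}AU)\bigr).$$ This series converges absolutely, the group $A^{-1}\mathbb{Z}^{m\times n}\bmod\mathbb{Z}^{m\times n}$ is finite, and for all $H,K\in\mathbb{R}^{m\times n}$ and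 $Z\in\mathbb{H}_n$ $$\theta_{H,K}(-Z^{-1})=i^{-mn/2}(-1)^{(s/2+\beta)n+\beta n}\,|\det A|^{-n/2}\,(\det Z)^{(r-s)/2+\alpha-\beta}\,\operatorname{e}\bigl(\operatorname{tr}(H^{\mathsf T}AK)\bigr)\sum_{J\in A^{-1}\mathbb{Z}^{m\times n}\bmod\mathbb{Z}^{m\times n}}\theta_{J+K,-H}(Z).$$ Here $i^x$ and $(-1)^x$ are principal powers, and $(\det Z)^\kappa$ denotes the product of the principal powers $\zeta^\kappa$ over the eigenvalues $\zeta$ of $Z$ with algebraic multiplicity (all of them have positive imaginary part); this is the continuous branch of $(\det Z)^\kappa$ on $\mathbb{H}_n$ with value $i^{n\kappa}(\det Y)^\kappa$ at $Z=iY$. -/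

import Mathlib

open scoped MatrixOrder

noncomputable section

namespace SiegelTheta

/-- `e(z) = exp(2 π i z)`. -/
def e (z : ℂ) : ℂ := Complex.exp (2 * Real.pi * Complex.I * z)

/-- An integer matrix as a real matrix. -/
def toReal {m n : ℕ} (A : Matrix (Fin m) (Fin n) ℤ) : Matrix (Fin m) (Fin n) ℝ :=
  A.map fun x => (x : ℝ)

/-- A real matrix as a complex matrix. -/
def toComplex {m n : ℕ} (A : Matrix (Fin m) (Fin n) ℝ) : Matrix (Fin m) (Fin n) ℂ :=
  A.map fun x => (x : ℂ)

/-- The imaginary part `Y` of `Z = X + iY`. -/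
def imPart {n : ℕ} (Z : Matrix (Fin n) (Fin n) ℂ) : Matrix (Fin n) (Fin n) ℝ :=
  Z.map Complex.im

/-- The Siegel upper half-space of genus `n`. -/
def upperHalfSpace (n : ℕ) : Set (Matrix (Fin n) (Fin n) ℂ) :=
  {Z | Z.IsSymm ∧ (imPart Z).PosDef}

/-- `det Z ^ κ` for `Z` in the Siegel upper half-space: the product of the principal powers
`ζ ^ κ` over the eigenvalues `ζ` of `Z`, with algebraic multiplicity (they all have positive
imaginary part). This is the continuous branch of `(det Z) ^ κ` on the half-space with value
`i ^ (n κ) * (det Y) ^ κ` at `Z = iY`; it is the principal power if `n = 1`, and the ordinary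
power if `κ` is an integer. -/
def detPow {n : ℕ} (Z : Matrix (Fin n) (Fin n) ℂ) (κ : ℂ) : ℂ :=
  (Z.charpoly.roots.map fun ζ => ζ ^ κ).prod

/-! ### Decomposition of a non-degenerate symmetric matrix of signature `(r, s)` -/

/-- `diag(I_r, O)` of size `m`. -/
def posBlock (m r : ℕ) : Matrix (Fin m) (Fin m) ℝ :=
  Matrix.diagonal fun i => if (i : ℕ) < r then 1 else 0

/-- `diag(O, I_{m - r})` of size `m`. -/
def negBlock (m r : ℕ) : Matrix (Fin m) (Fin m) ℝ :=
  Matrix.diagonal fun i => if (i : ℕ) < r then 0 else 1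

/-- `A` has signature `(r, s)`, and the columns of `S` are eigenvectors of `A`, normalized such
that `Sᵀ A S = diag(I_r, -I_s)`. In particular the first `r` columns belong to positive
eigenvalues and the last `s` to negative ones. -/
structure IsNormalizedEigenbasis {m : ℕ} (A : Matrix (Fin m) (Fin m) ℤ) (r s : ℕ)
    (S : Matrix (Fin m) (Fin m) ℝ) : Prop where
  card : r + s = m
  eigenvector : ∀ j, ∃ μ : ℝ, (toReal A).mulVec (S.col j) = μ • S.col j
  normalized : S.transpose * toReal A * S = posBlock m r - negBlock m r

/-- The negative semi-definite part `A⁻ = (S⁻¹)ᵀ diag(O, -I_s) S⁻¹` of `A`. -/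
def negPart {m : ℕ} (r : ℕ) (S : Matrix (Fin m) (Fin m) ℝ) : Matrix (Fin m) (Fin m) ℝ :=
  (S⁻¹).transpose * (-negBlock m r) * S⁻¹

/-- The positive semi-definite part `A⁺ = (S⁻¹)ᵀ diag(I_r, O) S⁻¹` of `A`. -/
def posPart {m : ℕ} (r : ℕ) (S : Matrix (Fin m) (Fin m) ℝ) : Matrix (Fin m) (Fin m) ℝ :=
  (S⁻¹).transpose * posBlock m r * S⁻¹

/-- The positive definite majorant `M = A⁺ - A⁻`. -/
def majorant {m : ℕ} (r : ℕ) (S : Matrix (Fin m) (Fin m) ℝ) : Matrix (Fin m) (Fin m) ℝ :=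
  posPart r S - negPart r S

/-- The matrix of the projection `u ↦ u⁺` onto the span of the first `r` columns of `S` along the
span of the others. -/
def posProj {m : ℕ} (r : ℕ) (S : Matrix (Fin m) (Fin m) ℝ) : Matrix (Fin m) (Fin m) ℝ :=
  S * posBlock m r * S⁻¹

/-- The matrix of the complementary projection `u ↦ u⁻`. -/
def negProj {m : ℕ} (r : ℕ) (S : Matrix (Fin m) (Fin m) ℝ) : Matrix (Fin m) (Fin m) ℝ :=
  S * negBlock m r * S⁻¹

/-! ### Polynomials on `m × n` matrices -/

/-- Complex polynomials in the entries of an `m × n` matrix. -/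
abbrev MatPoly (m n : ℕ) := MvPolynomial (Fin m × Fin n) ℂ

/-- The value `P(U)`. -/
def evalAt {m n : ℕ} (P : MatPoly m n) (U : Matrix (Fin m) (Fin n) ℂ) : ℂ :=
  MvPolynomial.eval (fun p => U p.1 p.2) P

/-- `P(U N) = (det N) ^ α P(U)` for all complex matrices `U` and `N`. -/
def IsDetHomogeneous {m n : ℕ} (α : ℕ) (P : MatPoly m n) : Prop :=
  ∀ (U : Matrix (Fin m) (Fin n) ℂ) (N : Matrix (Fin n) (Fin n) ℂ),
    evalAt P (U * N) = N.det ^ α * evalAt P U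

/-- The polynomial `U ↦ P(T U)`. -/
def compLeft {m n : ℕ} (T : Matrix (Fin m) (Fin m) ℝ) (P : MatPoly m n) : MatPoly m n :=
  MvPolynomial.bind₁
    (fun p => ∑ k, MvPolynomial.C ((T p.1 k : ℝ) : ℂ) * MvPolynomial.X (k, p.2)) P

theorem evalAt_compLeft {m n : ℕ} (T : Matrix (Fin m) (Fin m) ℝ) (P : MatPoly m n)
    (U : Matrix (Fin m) (Fin n) ℂ) :
    evalAt (compLeft T P) U = evalAt P (toComplex T * U) := by
  unfold evalAt compLeft
  rw [← MvPolynomial.coe_aeval_eq_eval, ← MvPolynomial.coe_aeval_eq_eval, RingHom.coe_coe,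
    RingHom.coe_coe, MvPolynomial.aeval_bind₁]
  congr 2
  funext p
  simp [Matrix.mul_apply, toComplex]

/-- The operator `tr Δ_M = ∑_ν ∑_{μ, ρ} ∂/∂U_{μν} (M⁻¹)_{μρ} ∂/∂U_{ρν}` on polynomials. -/
def laplacian {m n : ℕ} (M : Matrix (Fin m) (Fin m) ℝ) (P : MatPoly m n) : MatPoly m n :=
  ∑ ν : Fin n, ∑ μ : Fin m, ∑ ρ : Fin m,
    MvPolynomial.C ((M⁻¹ μ ρ : ℝ) : ℂ) *
      MvPolynomial.pderiv (μ, ν) (MvPolynomial.pderiv (ρ, ν) P)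

/-- `exp(c tr Δ_M)(P) = ∑_k c ^ k / k! (tr Δ_M) ^ k (P)`. The terms with `k > deg P` vanish, see
`laplacian_iterate_eq_zero`, and are left out. -/
def expLaplacian {m n : ℕ} (c : ℂ) (M : Matrix (Fin m) (Fin m) ℝ) (P : MatPoly m n) :
    MatPoly m n :=
  ∑ k ∈ Finset.range (P.totalDegree + 1),
    MvPolynomial.C (c ^ k / (k.factorial : ℂ)) * (laplacian M)^[k] P

theorem laplacian_iterate_eq_zero {m n : ℕ} (M : Matrix (Fin m) (Fin m) ℝ) (P : MatPoly m n)
    (k : ℕ) (hk : P.totalDegree < k) : (laplacian M)^[k] P = 0 := by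
  have key : ∀ (k : ℕ) (Q : MatPoly m n), (∀ t, k ≤ Finsupp.degree t → Q.coeff t = 0) →
      (laplacian M)^[k] Q = 0 := by
    intro k
    induction k with
    | zero =>
      intro Q hQ
      ext t
      simpa using hQ t (Nat.zero_le _)
    | succ k ih =>
      intro Q hQ
      rw [Function.iterate_succ_apply]
      refine ih _ fun t ht => ?_
      simp only [laplacian, MvPolynomial.coeff_sum]
      refine Finset.sum_eq_zero fun ν _ => Finset.sum_eq_zero fun μ _ =>
        Finset.sum_eq_zero fun ρ _ => ?_
      rw [MvPolynomial.coeff_C_mul, MvPolynomial.coeff_pderiv, MvPolynomial.coeff_pderiv,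
        hQ _ (by simp only [map_add, Finsupp.degree_single]; omega)]
      simp
  refine key k P fun t ht => MvPolynomial.coeff_eq_zero_of_totalDegree_lt ?_
  have : t.degree = ∑ i ∈ t.support, t i := rfl
  omega

/-! ### Theta series -/

/-- The function `g(U) = exp(-tr Δ_M / 8π)(P_α(U⁺) P_β(U⁻)) * exp(2π tr(Uᵀ A⁻ U))`. -/
def coeffFun {m n : ℕ} (r : ℕ) (S : Matrix (Fin m) (Fin m) ℝ) (Pα Pβ : MatPoly m n)
    (U : Matrix (Fin m) (Fin n) ℝ) : ℂ :=
  evalAt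
      (expLaplacian (-1 / (8 * Real.pi)) (majorant r S)
        (compLeft (posProj r S) Pα * compLeft (negProj r S) Pβ))
      (toComplex U) *
    (Real.exp (2 * Real.pi * (U.transpose * negPart r S * U).trace) : ℂ)

/-- The summand `f(U Y^{1/2}) e(tr(Uᵀ A U Z) / 2 + tr(Kᵀ A U))` of the theta series. -/
def thetaTerm {m n : ℕ} (A : Matrix (Fin m) (Fin m) ℤ) (f : Matrix (Fin m) (Fin n) ℝ → ℂ)
    (K : Matrix (Fin m) (Fin n) ℝ) (Z : Matrix (Fin n) (Fin n) ℂ)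
    (U : Matrix (Fin m) (Fin n) ℝ) : ℂ :=
  f (U * CFC.sqrt (imPart Z)) *
    e ((toComplex (U.transpose * toReal A * U) * Z).trace / 2 +
      ((K.transpose * toReal A * U).trace : ℂ))

/-- The theta series `θ_{H,K}(Z) = det Y^{-λ/2} ∑_{U ∈ H + ℤ^{m×n}} (thetaTerm at U)`. -/
def theta {m n : ℕ} (A : Matrix (Fin m) (Fin m) ℤ) (l : ℤ) (f : Matrix (Fin m) (Fin n) ℝ → ℂ)
    (H K : Matrix (Fin m) (Fin n) ℝ) (Z : Matrix (Fin n) (Fin n) ℂ) : ℂ :=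
  (((imPart Z).det ^ (-(l : ℝ) / 2) : ℝ) : ℂ) *
    ∑' R : Matrix (Fin m) (Fin n) ℤ, thetaTerm A f K Z (H + toReal R)

/-- The lattice `ℤ^{m×n}` in `ℝ^{m×n}`. -/
def intLattice (m n : ℕ) : AddSubgroup (Matrix (Fin m) (Fin n) ℝ) where
  carrier := Set.range toReal
  zero_mem' := ⟨0, by ext; simp [toReal]⟩
  add_mem' := by
    rintro _ _ ⟨a, rfl⟩ ⟨b, rfl⟩
    exact ⟨a + b, by ext; simp [toReal]⟩
  neg_mem' := by
    rintro _ ⟨a, rfl⟩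
    exact ⟨-a, by ext; simp [toReal]⟩

/-- The group `A⁻¹ ℤ^{m×n}` in `ℝ^{m×n}`. -/
def dualLattice {m : ℕ} (A : Matrix (Fin m) (Fin m) ℤ) (n : ℕ) :
    AddSubgroup (Matrix (Fin m) (Fin n) ℝ) where
  carrier := Set.range fun R : Matrix (Fin m) (Fin n) ℤ => (toReal A)⁻¹ * toReal R
  zero_mem' := ⟨0, by ext; simp [toReal, Matrix.mul_apply]⟩
  add_mem' := by
    rintro _ _ ⟨a, rfl⟩ ⟨b, rfl⟩
    refine ⟨a + b, ?_⟩
    simp only [← Matrix.mul_add]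
    congr 1
    ext; simp [toReal]
  neg_mem' := by
    rintro _ ⟨a, rfl⟩
    refine ⟨-a, ?_⟩
    simp only [← Matrix.mul_neg]
    congr 1
    ext; simp [toReal]

/-- The group `A⁻¹ ℤ^{m×n} mod ℤ^{m×n}`. -/
abbrev DiscriminantGroup {m : ℕ} (A : Matrix (Fin m) (Fin m) ℤ) (n : ℕ) :=
  dualLattice A n ⧸ (intLattice m n).addSubgroupOf (dualLattice A n)

/-- A representative in `ℝ^{m×n}` of a class in `A⁻¹ ℤ^{m×n} mod ℤ^{m×n}`; which one is taken does
not matter in a theta series, see `theta_add_of_mem_intLattice`. -/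
def DiscriminantGroup.rep {m n : ℕ} {A : Matrix (Fin m) (Fin m) ℤ} (J : DiscriminantGroup A n) :
    Matrix (Fin m) (Fin n) ℝ :=
  (Quotient.out J : dualLattice A n)

theorem theta_add_of_mem_intLattice {m n : ℕ} (A : Matrix (Fin m) (Fin m) ℤ) (l : ℤ)
    (f : Matrix (Fin m) (Fin n) ℝ → ℂ) (H K T : Matrix (Fin m) (Fin n) ℝ)
    (Z : Matrix (Fin n) (Fin n) ℂ) (hT : T ∈ intLattice m n) :
    theta A l f (T + H) K Z = theta A l f H K Z := by
  obtain ⟨T, rfl⟩ := hT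
  unfold theta
  congr 1
  rw [← (Equiv.addLeft T).tsum_eq fun R => thetaTerm A f K Z (H + toReal R)]
  refine tsum_congr fun R => ?_
  congr 1
  ext i j
  simp [toReal]
  ring

end SiegelTheta

end

/-! Simultaneous diagonalization of `X` and `Y` gives `Z = B diag(d) Bᵀ` with `B` real, `B Bᵀ = Y`
and `Im d_j = 1` (`exists_isDiagonalization`). In the coordinates `V = S⁻¹ U B` the summands
separate. Indeed `B⁻¹ Y^{1/2}` is orthogonal and `S Sᵀ = M⁻¹`, so `tr Δ_M` becomes the standard
Laplacian. The real exponential in `g` changes the Gaussian parameter `-d_j` in the negative rows to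
`-conj d_j`, which lies in the upper half-plane (`thetaTerm_eq`). Each summand is thus a constant
times a character times the heat flow of a polynomial times a product of decaying Gaussians; this
already gives absolute convergence.

The analytic heart is in one variable: the Fourier transform of `exp(c D²)(v^k) exp(πi z v²)` is of
the same kind, with parameter `-1/z`, evaluation point `w/z` and heat time `c + i/(4πz)`
(`fourier_heatPow_gauss`). For `c = -1/(8π)` and `Im z = 1` the new time is `c (|z|/z)²`. Hence
rescaling `w` by `|z|` restores the old time, at the price of scaling the variables of the
polynomial by `|d_j|/d_j` in positive and `|d_j|/conj d_j` in negative rows. These scalings depend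
only on the column once the sign of the row is fixed, so the determinant homogeneity of `P_α` and
`P_β` turns them into a scalar (`fourierPi_heatGauss_eigenPoly`). The new parameters are those of
the diagonalization of `-Z⁻¹` (`IsDiagonalization.neg_inv`).

The lattices `A⁻¹ℤ^{m×n}` and `ℤ^{m×n}` are dual for the form `tr(Uᵀ A V)`, so Poisson summation
relates the sum over `K + A⁻¹ℤ^{m×n}` at `Z` to the sum over `H + ℤ^{m×n}` at `-Z⁻¹`
(`tsum_thetaTerm_dual`). Splitting the former by classes produces the sum over the discriminant
group (`finsum_tsum_rep_add`).

What remains is the constant. Poisson summation yields `∏ (-i d_j)^{-1/2}`, whereas `detPow` is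
defined by the eigenvalues of `Z`. Both are identified through the Gaussian integral of `exp(πi vᵀ Z
v)`: it is computed by the diagonalization on one hand, and by continuation from `Z = i` on the
other (`gaussInt_eq_prod_roots`). The rest is bookkeeping of powers (`multiplier_identity`). -/

noncomputable section
namespace SiegelTheta

/-! ### Poisson summation on `ℝ^ι` -/

section Poisson

open MeasureTheory

variable {ι : Type*} [Fintype ι]

/-- Quadratic decay in every coordinate. -/
def HasSqDecay (f : (ι → ℝ) → ℂ) : Prop :=
  ∃ C, ∀ x, ‖f x‖ ≤ C * ∏ i, (1 + x i ^ 2)⁻¹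

/-- The Fourier transform on `ℝ^ι`. -/
def fourierPi (f : (ι → ℝ) → ℂ) (w : ι → ℝ) : ℂ :=
  ∫ v, f v * e (-((∑ i, v i * w i : ℝ) : ℂ))

theorem e_add (x y : ℂ) : e (x + y) = e x * e y := by
  simp only [e, mul_add, Complex.exp_add]

theorem e_intCast (k : ℤ) : e k = 1 := by
  rw [e, Complex.exp_eq_one_iff]
  exact ⟨k, by ring⟩

theorem norm_e_ofReal (x : ℝ) : ‖e (x : ℂ)‖ = 1 := by
  have : 2 * (Real.pi : ℂ) * Complex.I * x = ((2 * Real.pi * x : ℝ) : ℂ) * Complex.I := by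
    push_cast; ring
  rw [e, this, Complex.norm_exp_ofReal_mul_I]

theorem continuous_e : Continuous e := by
  unfold e; fun_prop

theorem summable_inv_one_add_sq : Summable fun n : ℤ => (1 + (n : ℝ) ^ 2)⁻¹ := by
  -- The shift by `1/2` keeps the comparison series free of a singular term at `n = 0`.
  have h := (Real.summable_one_div_int_add_rpow (1 / 2) 2).2 (by norm_num)
  refine Summable.of_nonneg_of_le (fun n => by positivity) (fun n => ?_) (h.mul_left 2)
  have hne : ((n : ℝ) + 1 / 2) ≠ 0 := by
    intro h0
    have h1 : ((2 * n + 1 : ℤ) : ℝ) = 0 := by push_cast; linarith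
    have h2 : (2 * n + 1 : ℤ) = 0 := by exact_mod_cast h1
    omega
  have h1 : |(n : ℝ) + 1 / 2| ^ (2 : ℝ) = ((n : ℝ) + 1 / 2) ^ 2 := by
    rw [Real.rpow_two, sq_abs]
  rw [h1, ← div_eq_mul_one_div, inv_eq_one_div, div_le_div_iff₀ (by positivity) (by positivity)]
  nlinarith [sq_nonneg ((n : ℝ) - 1 / 2)]

/-- Any finite set of indices lies in a box, where the sum of products factors into a product of
one-dimensional partial sums. -/
theorem summable_pi_prod {g : ℤ → ℝ} (hg : ∀ n, 0 ≤ g n) (hs : Summable g) :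
    Summable fun n : ι → ℤ => ∏ i, g (n i) := by
  classical
  refine summable_of_sum_le (c := ∏ _i : ι, ∑' n, g n)
    (fun n => Finset.prod_nonneg fun i _ => hg _) fun u => ?_
  obtain ⟨t, ht⟩ : ∃ t : ι → Finset ℤ, ∀ n ∈ u, ∀ i, n i ∈ t i :=
    ⟨fun i => u.image fun n => n i, fun n hn i => Finset.mem_image.2 ⟨n, hn, rfl⟩⟩
  have h1 : ∑ n ∈ u, ∏ i, g (n i) ≤ ∑ n ∈ Fintype.piFinset t, ∏ i, g (n i) :=
    Finset.sum_le_sum_of_subset_of_nonneg (fun n hn => Fintype.mem_piFinset.2 (ht n hn))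
      fun n _ _ => Finset.prod_nonneg fun i _ => hg _
  rw [← Finset.prod_univ_sum t fun _ k => g k] at h1
  exact h1.trans (Finset.prod_le_prod (fun i _ => Finset.sum_nonneg fun k _ => hg _)
    fun i _ => hs.sum_le_tsum _ fun k _ => hg _)

/-- A form of Peetre's inequality: translation by a bounded amount costs only a constant factor in
the decay. -/
theorem inv_one_add_sq_add_le (x y : ℝ) :
    (1 + (x + y) ^ 2)⁻¹ ≤ 2 * (1 + x ^ 2) * (1 + y ^ 2)⁻¹ := by
  rw [← div_eq_mul_inv, inv_eq_one_div, div_le_div_iff₀ (by positivity) (by positivity)]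
  nlinarith [sq_nonneg (y + 2 * x), sq_nonneg (x * (x + y)), sq_nonneg x]

namespace HasSqDecay

variable {f : (ι → ℝ) → ℂ}

theorem exists_nonneg (hf : HasSqDecay f) :
    ∃ C, 0 ≤ C ∧ ∀ x, ‖f x‖ ≤ C * ∏ i, (1 + x i ^ 2)⁻¹ := by
  obtain ⟨C, hC⟩ := hf
  refine ⟨|C|, abs_nonneg _, fun x => (hC x).trans ?_⟩
  exact mul_le_mul_of_nonneg_right (le_abs_self C)
    (Finset.prod_nonneg fun i _ => by positivity)

/-- A summable majorant that is uniform for `x` in a bounded set; it serves the Weierstrass test for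
the periodization and the interchange of sum and integral over the unit cube. -/
theorem exists_translate_bound (hf : HasSqDecay f) (M : ℝ) :
    ∃ C, 0 ≤ C ∧ ∀ x : ι → ℝ, (∀ i, |x i| ≤ M) → ∀ n : ι → ℤ,
      ‖f fun i => x i + n i‖ ≤ C * ∏ i, (1 + (n i : ℝ) ^ 2)⁻¹ := by
  obtain ⟨C, hC0, hC⟩ := hf.exists_nonneg
  refine ⟨C * ∏ _i : ι, (2 * (1 + M ^ 2)), by positivity, fun x hx n => (hC _).trans ?_⟩
  rw [mul_assoc, ← Finset.prod_mul_distrib]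
  refine mul_le_mul_of_nonneg_left (Finset.prod_le_prod (fun i _ => by positivity)
    fun i _ => (inv_one_add_sq_add_le _ _).trans ?_) hC0
  have : x i ^ 2 ≤ M ^ 2 := sq_le_sq' (by linarith [(abs_le.1 (hx i)).1]) (abs_le.1 (hx i)).2
  gcongr

theorem summable_translate (hf : HasSqDecay f) (x : ι → ℝ) :
    Summable fun n : ι → ℤ => f fun i => x i + n i := by
  obtain ⟨C, -, hC⟩ := hf.exists_translate_bound ‖x‖
  exact Summable.of_norm_bounded
    ((summable_pi_prod (fun n => by positivity) summable_inv_one_add_sq).mul_left C)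
    fun n => hC x (fun i => norm_le_pi_norm x i) n

theorem integrable (hf : HasSqDecay f) (hc : Continuous f) : Integrable f := by
  obtain ⟨C, hC⟩ := hf
  refine Integrable.mono' (g := fun x => C * ∏ i, (1 + x i ^ 2)⁻¹) ?_
    hc.aestronglyMeasurable (Filter.Eventually.of_forall hC)
  refine Integrable.const_mul ?_ C
  exact Integrable.fintype_prod (f := fun (_ : ι) (y : ℝ) => (1 + y ^ 2)⁻¹)
    fun i => integrable_inv_one_add_sq

theorem continuous_tsum_translate (hf : HasSqDecay f) (hc : Continuous f) :
    Continuous fun x : ι → ℝ => ∑' n : ι → ℤ, f fun i => x i + n i := by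
  rw [continuous_iff_continuousAt]
  intro x
  obtain ⟨C, -, hC⟩ := hf.exists_translate_bound (‖x‖ + 1)
  have hcont : ContinuousOn (fun x : ι → ℝ => ∑' n : ι → ℤ, f fun i => x i + n i)
      (Metric.ball 0 (‖x‖ + 1)) := by
    refine continuousOn_tsum (fun n => ?_)
      ((summable_pi_prod (fun n => by positivity) summable_inv_one_add_sq).mul_left C)
      fun n y hy => hC y (fun i => (norm_le_pi_norm y i).trans ?_) n
    · exact (hc.comp (by fun_prop)).continuousOn
    · simpa using (Metric.mem_ball.1 hy).le
  exact hcont.continuousAt (Metric.isOpen_ball.mem_nhds (by simp))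

end HasSqDecay

theorem norm_mul_e_neg (z : ℂ) (x : ℝ) : ‖z * e (-(x : ℂ))‖ = ‖z‖ := by
  rw [norm_mul, ← Complex.ofReal_neg, norm_e_ofReal, mul_one]

theorem mFourier_apply_coe (n : ι → ℤ) (x : ι → ℝ) :
    UnitAddTorus.mFourier n (fun i => (x i : UnitAddCircle)) =
      e ((∑ i, x i * n i : ℝ) : ℂ) := by
  simp only [UnitAddTorus.mFourier, ContinuousMap.coe_mk, fourier_coe_apply, e,
    ← Complex.exp_sum]
  congr 1
  push_cast
  rw [Finset.mul_sum]
  exact Finset.sum_congr rfl fun i _ => by ring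

/-- The integral over `ℝ^ι` as a sum of integrals over unit cubes. -/
theorem hasSum_integral_cubes {f : (ι → ℝ) → ℂ} (hf : Integrable f) :
    HasSum (fun n : ι → ℤ => ∫ x in {x : ι → ℝ | ∀ i, x i ∈ Set.Ioc (0 : ℝ) (0 + 1)},
      f fun i => x i + n i) (∫ x, f x) := by
  let s : (ι → ℤ) → Set (ι → ℝ) := fun n => {x | ∀ i, x i ∈ Set.Ioc (n i : ℝ) (n i + 1)}
  have hs : ∀ n, MeasurableSet (s n) := fun n => by
    have : s n = Set.univ.pi fun i => Set.Ioc (n i : ℝ) (n i + 1) := by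
      ext x; simp [s]
    rw [this]
    exact MeasurableSet.univ_pi fun i => measurableSet_Ioc
  -- The cubes are open on the left and closed on the right, so the index of the cube containing `x`
  -- is `⌈x i⌉ - 1`, not the floor.
  have hmem : ∀ (n : ι → ℤ) x, x ∈ s n → n = fun i => ⌈x i⌉ - 1 := by
    intro n x hx
    funext i
    have h1 : ⌈x i⌉ = n i + 1 := Int.ceil_eq_iff.2 ⟨by simpa using (hx i).1, by simpa using (hx i).2⟩
    omega
  have hd : Pairwise (Function.onFun Disjoint s) := by
    intro n k hnk
    refine Set.disjoint_left.2 fun x hx hx' => hnk ?_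
    rw [hmem n x hx, hmem k x hx']
  have hU : ⋃ n, s n = Set.univ := by
    refine Set.eq_univ_of_forall fun x => Set.mem_iUnion.2 ⟨fun i => ⌈x i⌉ - 1, fun i => ?_⟩
    have := Int.ceil_lt_add_one (x i)
    have := Int.le_ceil (x i)
    simp only [Set.mem_Ioc]
    push_cast
    constructor <;> linarith
  have key := hasSum_integral_iUnion (μ := volume) hs hd (f := f) (by rw [hU]; exact hf.integrableOn)
  rw [hU, setIntegral_univ] at key
  suffices hsum : ∀ n : ι → ℤ, ∫ x in {x : ι → ℝ | ∀ i, x i ∈ Set.Ioc (0 : ℝ) (0 + 1)},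
      f (fun i => x i + n i) = ∫ x in s n, f x by
    simp_rw [hsum]
    exact key
  intro n
  have hm := (measurePreserving_add_right (volume : Measure (ι → ℝ))
    (fun i => (n i : ℝ))).setIntegral_preimage_emb
      (MeasurableEquiv.addRight (fun i => (n i : ℝ))).measurableEmbedding f (s n)
  rw [← hm]
  congr 1
  congr 1
  ext x
  simp only [Set.mem_ofPred_eq, Set.mem_preimage, s, Pi.add_apply, Set.mem_Ioc]
  refine forall_congr' fun i => ?_
  constructor <;> rintro ⟨h1, h2⟩ <;> constructor <;> linarith

/-- **Poisson summation** on `ℝ^ι`. -/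
theorem tsum_eq_tsum_fourierPi {f : (ι → ℝ) → ℂ} (hc : Continuous f) (hf : HasSqDecay f)
    (hF : Summable fun n : ι → ℤ => fourierPi f fun i => n i) :
    ∑' n : ι → ℤ, f (fun i => n i) = ∑' n : ι → ℤ, fourierPi f fun i => n i := by
  -- The periodization of `f`. It descends to a continuous function on the torus, whose Fourier
  -- series is then evaluated at `0`.
  let G : (ι → ℝ) → ℂ := fun x => ∑' n : ι → ℤ, f fun i => x i + n i
  have hG : Continuous G := hf.continuous_tsum_translate hc
  have hper : ∀ x y : ι → ℝ, (∀ i, (x i : UnitAddCircle) = y i) → G x = G y := by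
    intro x y hxy
    have : ∀ i, ∃ k : ℤ, y i = x i + k := fun i => by
      have h := (hxy i).symm
      rw [← sub_eq_zero, ← AddCircle.coe_sub, AddCircle.coe_eq_zero_iff] at h
      obtain ⟨k, hk⟩ := h
      exact ⟨k, by rw [zsmul_eq_mul, mul_one] at hk; linarith⟩
    choose k hk using this
    change (∑' n : ι → ℤ, f fun i => x i + n i) = ∑' n : ι → ℤ, f fun i => y i + n i
    rw [← (Equiv.addLeft k).tsum_eq]
    refine tsum_congr fun n => congrArg f (funext fun i => ?_)
    simp [hk]
    ring
  let q : (ι → ℝ) → UnitAddTorus ι := fun x i => (x i : UnitAddCircle)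
  have hq : IsOpenQuotientMap q :=
    IsOpenQuotientMap.piMap fun _ => QuotientAddGroup.isOpenQuotientMap_mk
  let Gt : UnitAddTorus ι → ℂ := fun t => G (Function.surjInv hq.surjective t)
  have hGt : ∀ x, Gt (q x) = G x := fun x =>
    hper _ _ fun i => congrFun (Function.surjInv_eq hq.surjective (q x)) i
  have hcont : Continuous Gt := by
    rw [hq.isQuotientMap.continuous_iff]
    exact hG.congr fun x => (hGt x).symm
  let Gc : C(UnitAddTorus ι, ℂ) := ⟨Gt, hcont⟩
  have hint : Integrable f := hf.integrable hc
  -- Unfolding: the sum over translates is exchanged with the integral over the unit cube, and the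
  -- cubes reassemble to `ℝ^ι` because characters with integral frequency are invariant under
  -- integral translations.
  have hcoeff : ∀ n, UnitAddTorus.mFourierCoeff Gc n = fourierPi f fun i => n i := by
    intro n
    rw [UnitAddTorus.mFourierCoeff_eq_integral Gc n 0]
    have h1 : Integrable fun v : ι → ℝ => f v * e (-((∑ i, v i * (n i : ℝ) : ℝ) : ℂ)) := by
      refine hint.mono ?_ (Filter.Eventually.of_forall fun v => (norm_mul_e_neg _ _).le)
      exact (hc.mul (continuous_e.comp (by fun_prop))).aestronglyMeasurable
    rw [fourierPi, ← (hasSum_integral_cubes h1).tsum_eq]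
    obtain ⟨C, hC0, hC⟩ := hf.exists_translate_bound 1
    have hfin : volume {x : ι → ℝ | ∀ i, x i ∈ Set.Ioc (0 : ℝ) (0 + 1)} = 1 := by
      have : {x : ι → ℝ | ∀ i, x i ∈ Set.Ioc (0 : ℝ) (0 + 1)} =
          Set.univ.pi fun i => Set.Ioc (0 : ℝ) (0 + 1) := by ext x; simp
      rw [this, volume_pi_pi]
      simp
    have hms : MeasurableSet {x : ι → ℝ | ∀ i, x i ∈ Set.Ioc (0 : ℝ) (0 + 1)} := by
      have : {x : ι → ℝ | ∀ i, x i ∈ Set.Ioc (0 : ℝ) (0 + 1)} =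
          Set.univ.pi fun i => Set.Ioc (0 : ℝ) (0 + 1) := by ext x; simp
      rw [this]
      exact MeasurableSet.univ_pi fun i => measurableSet_Ioc
    have hsumm : Summable fun k : ι → ℤ => C * ∏ i, (1 + (k i : ℝ) ^ 2)⁻¹ :=
      (summable_pi_prod (fun n => by positivity) summable_inv_one_add_sq).mul_left C
    have hb : ∀ k : ι → ℤ, ∀ x ∈ {x : ι → ℝ | ∀ i, x i ∈ Set.Ioc (0 : ℝ) (0 + 1)},
        ‖f (fun i => x i + k i) * e (-((∑ i, (x i + k i) * (n i : ℝ) : ℝ) : ℂ))‖ ≤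
          C * ∏ i, (1 + (k i : ℝ) ^ 2)⁻¹ := by
      intro k x hx
      rw [norm_mul_e_neg]
      refine hC x (fun i => ?_) k
      have := hx i
      simp only [zero_add, Set.mem_Ioc] at this
      rw [abs_le]
      constructor <;> linarith
    rw [integral_tsum_of_summable_integral_norm]
    · refine setIntegral_congr_fun hms fun x _ => ?_
      change UnitAddTorus.mFourier (-n) (fun i => (x i : UnitAddCircle)) • Gt (q x) = _
      rw [hGt, mFourier_apply_coe, smul_eq_mul, ← tsum_mul_left]
      refine tsum_congr fun k => ?_
      rw [mul_comm]
      congr 1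
      have : -((∑ i, (x i + k i) * (n i : ℝ) : ℝ) : ℂ) =
          ((∑ i, x i * ((-n) i : ℤ) : ℝ) : ℂ) + ((-∑ i, k i * n i : ℤ) : ℂ) := by
        push_cast
        simp only [add_mul, Finset.sum_add_distrib, Pi.neg_apply, Int.cast_neg, mul_neg,
          Finset.sum_neg_distrib, neg_add]
      rw [this, e_add, e_intCast, mul_one]
    · intro k
      have hcc : Continuous fun x : ι → ℝ =>
          f (fun i => x i + k i) * e (-((∑ i, (x i + k i) * (n i : ℝ) : ℝ) : ℂ)) :=
        (hc.comp (by fun_prop)).mul (continuous_e.comp (by fun_prop))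
      refine Measure.integrableOn_of_bounded (M := C * ∏ i, (1 + (k i : ℝ) ^ 2)⁻¹)
        (by rw [hfin]; simp) hcc.aestronglyMeasurable ?_
      exact (ae_restrict_iff' hms).2 (Filter.Eventually.of_forall (hb k))
    · refine Summable.of_nonneg_of_le (fun k => integral_nonneg fun x => norm_nonneg _)
        (fun k => ?_) hsumm
      have := norm_setIntegral_le_of_norm_le_const (μ := volume)
        (f := fun x : ι → ℝ =>
          ‖f (fun i => x i + k i) * e (-((∑ i, (x i + k i) * (n i : ℝ) : ℝ) : ℂ))‖)
        (s := {x : ι → ℝ | ∀ i, x i ∈ Set.Ioc (0 : ℝ) (0 + 1)})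
        (C := C * ∏ i, (1 + (k i : ℝ) ^ 2)⁻¹) (by rw [hfin]; simp)
        fun x hx => by simpa using hb k x hx
      simp only [Measure.real, hfin] at this
      simpa using (le_abs_self _).trans this
  have hs : Summable (UnitAddTorus.mFourierCoeff Gc) := by
    rw [funext hcoeff]; exact hF
  have h0 := (UnitAddTorus.hasSum_mFourier_series_apply_of_summable hs (q 0)).tsum_eq
  have h1 : Gc (q 0) = ∑' n : ι → ℤ, f (fun i => n i) := by
    change Gt (q 0) = _
    rw [hGt]
    exact tsum_congr fun n => congrArg f (funext fun i => by simp)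
  rw [h1] at h0
  rw [← h0]
  refine tsum_congr fun n => ?_
  rw [hcoeff, mFourier_apply_coe]
  simp [e]

end Poisson

/-! ### Rapid decay and Poisson summation under affine substitutions -/

section PoissonAffine

open MeasureTheory

variable {ι : Type*} [Fintype ι]

/-- Decay faster than every power of the norm. -/
def HasRapidDecay (f : (ι → ℝ) → ℂ) : Prop :=
  ∀ N : ℕ, ∃ C, ∀ x, (1 + ‖x‖) ^ N * ‖f x‖ ≤ C

namespace HasRapidDecay

variable {f g : (ι → ℝ) → ℂ}

theorem hasSqDecay (hf : HasRapidDecay f) : HasSqDecay f := by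
  -- Each of the `card ι` factors `1 + x i ^ 2` is at most `(1 + ‖x‖) ^ 2`.
  obtain ⟨C, hC⟩ := hf (2 * Fintype.card ι)
  refine ⟨C, fun x => ?_⟩
  have h1 : ∏ i, (1 + x i ^ 2) ≤ (1 + ‖x‖) ^ (2 * Fintype.card ι) := by
    rw [pow_mul, ← Finset.card_univ, ← Finset.prod_const]
    refine Finset.prod_le_prod (fun i _ => by positivity) fun i _ => ?_
    have h2 : x i ^ 2 ≤ ‖x‖ ^ 2 := by
      rw [← sq_abs]
      exact pow_le_pow_left₀ (abs_nonneg _) (norm_le_pi_norm x i) 2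
    nlinarith [norm_nonneg x]
  have hpos : 0 < ∏ i, (1 + x i ^ 2) := Finset.prod_pos fun i _ => by positivity
  rw [Finset.prod_inv_distrib, ← div_eq_mul_inv, le_div_iff₀ hpos, mul_comm]
  exact (mul_le_mul_of_nonneg_right h1 (norm_nonneg _)).trans (hC x)

theorem comp_of_le (hf : HasRapidDecay f) {φ : (ι → ℝ) → ι → ℝ} {c : ℝ}
    (hφ : ∀ x, 1 + ‖x‖ ≤ c * (1 + ‖φ x‖)) (b : ℝ) (hg : ∀ x, ‖g x‖ ≤ b * ‖f (φ x)‖) :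
    HasRapidDecay g := by
  intro N
  obtain ⟨C, hC⟩ := hf N
  refine ⟨c ^ N * (|b| * C), fun x => ?_⟩
  have hc : 0 ≤ c * (1 + ‖φ x‖) := le_trans (by positivity) (hφ x)
  have hc' : 0 ≤ c := nonneg_of_mul_nonneg_left hc (by positivity)
  have h1 : (1 + ‖x‖) ^ N ≤ (c * (1 + ‖φ x‖)) ^ N := pow_le_pow_left₀ (by positivity) (hφ x) N
  have h2 : ‖g x‖ ≤ |b| * ‖f (φ x)‖ :=
    (hg x).trans (mul_le_mul_of_nonneg_right (le_abs_self b) (norm_nonneg _))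
  have h3 : c ^ N * (|b| * ((1 + ‖φ x‖) ^ N * ‖f (φ x)‖)) ≤ c ^ N * (|b| * C) :=
    mul_le_mul_of_nonneg_left (mul_le_mul_of_nonneg_left (hC _) (abs_nonneg b)) (by positivity)
  refine (mul_le_mul h1 h2 (norm_nonneg _) (by positivity)).trans (le_of_eq_of_le ?_ h3)
  rw [mul_pow]
  ring

end HasRapidDecay

variable [DecidableEq ι]

/-- Solve for `x` as `T⁻¹(Tx + k) - T⁻¹k` and use the operator norm of `T⁻¹`. This is what makes
rapid decay stable under invertible affine substitutions. -/
theorem exists_one_add_norm_le_affine {T : Matrix ι ι ℝ} (hT : T.det ≠ 0) (k : ι → ℝ) :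
    ∃ c : ℝ, ∀ x : ι → ℝ, 1 + ‖x‖ ≤ c * (1 + ‖T.mulVec x + k‖) := by
  let L : (ι → ℝ) →L[ℝ] ι → ℝ := (Matrix.toLin' T⁻¹).toContinuousLinearMap
  have hL : ∀ y, L y = T⁻¹.mulVec y := fun y => rfl
  refine ⟨1 + ‖L‖ + ‖L‖ * ‖k‖, fun x => ?_⟩
  have hx : x = L (T.mulVec x + k) - L k := by
    rw [← map_sub, add_sub_cancel_right, hL, Matrix.mulVec_mulVec,
      Matrix.nonsing_inv_mul _ hT.isUnit, Matrix.one_mulVec]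
  have h1 : ‖x‖ ≤ ‖L‖ * ‖T.mulVec x + k‖ + ‖L‖ * ‖k‖ := by
    conv_lhs => rw [hx]
    exact (norm_sub_le _ _).trans (add_le_add (L.le_opNorm _) (L.le_opNorm _))
  have h2 : 0 ≤ ‖L‖ * ‖k‖ * ‖T.mulVec x + k‖ := by positivity
  have h3 := norm_nonneg (T.mulVec x + k)
  have h4 := norm_nonneg L
  nlinarith

theorem integral_comp_affine {T : Matrix ι ι ℝ} (hT : T.det ≠ 0) (k : ι → ℝ)
    (g : (ι → ℝ) → ℂ) :
    ∫ x, g (T.mulVec x + k) = (|T.det|⁻¹ : ℝ) * ∫ y, g y := by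
  have h1 : ∫ y, g y = ∫ y, g (y + k) := (integral_add_right_eq_self g k).symm
  have hemb : MeasurableEmbedding (Matrix.toLin' T) := by
    exact (Matrix.toLin'OfInv (Matrix.nonsing_inv_mul T hT.isUnit)
      (Matrix.mul_nonsing_inv T hT.isUnit)).toContinuousLinearEquiv.toHomeomorph.measurableEmbedding
  have h2 := hemb.integral_map (μ := volume) fun y => g (y + k)
  rw [Real.map_matrix_volume_pi_eq_smul_volume_pi hT, integral_smul_measure,
    ENNReal.toReal_ofReal (abs_nonneg _), abs_inv] at h2
  rw [h1, ← Complex.real_smul, h2]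
  rfl

/-- Substitute `y = Tx + k`: the total frequency `w + h` is carried to its image under the inverse
transpose, and the shift `k` leaves a character. -/
theorem fourierPi_affine {T : Matrix ι ι ℝ} (hT : T.det ≠ 0) (k h w : ι → ℝ)
    (F : (ι → ℝ) → ℂ) :
    fourierPi (fun x => F (T.mulVec x + k) * e (-((∑ i, x i * h i : ℝ) : ℂ))) w =
      (|T.det|⁻¹ : ℝ) * (fourierPi F ((T⁻¹).transpose.mulVec (w + h)) *
        e ((∑ i, k i * (T⁻¹).transpose.mulVec (w + h) i : ℝ) : ℂ)) := by
  set u := (T⁻¹).transpose.mulVec (w + h) with hu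
  have key := integral_comp_affine hT k fun y =>
    F y * e (-((∑ i, y i * u i : ℝ) : ℂ)) * e ((∑ i, k i * u i : ℝ) : ℂ)
  rw [fourierPi, fourierPi, ← integral_mul_const, ← key]
  congr 1
  funext x
  rw [mul_assoc, mul_assoc, ← e_add, ← e_add]
  congr 2
  have h1 : ∑ i, (T.mulVec x) i * u i = ∑ i, x i * (w i + h i) := by
    change dotProduct (T.mulVec x) u = dotProduct x (w + h)
    rw [hu, Matrix.dotProduct_mulVec, Matrix.vecMul_transpose, Matrix.mulVec_mulVec,
      Matrix.nonsing_inv_mul _ hT.isUnit, Matrix.one_mulVec]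
  have h2 : ∑ i, (T.mulVec x + k) i * u i = ∑ i, x i * h i + ∑ i, x i * w i + ∑ i, k i * u i := by
    simp only [Pi.add_apply, add_mul, Finset.sum_add_distrib]
    rw [h1]
    simp only [mul_add, Finset.sum_add_distrib]
    ring
  rw [h2]
  push_cast
  ring

/-- **Poisson summation** on `ℝ^ι` for affine transforms of a function. -/
theorem tsum_affine_eq_tsum_fourierPi {F : (ι → ℝ) → ℂ} (hc : Continuous F)
    (hF : HasRapidDecay F) (hF' : HasRapidDecay (fourierPi F)) {T : Matrix ι ι ℝ}
    (hT : T.det ≠ 0) (k h : ι → ℝ) :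
    ∑' n : ι → ℤ, F (T.mulVec (fun i => n i) + k) * e (-((∑ i, n i * h i : ℝ) : ℂ)) =
      (|T.det|⁻¹ : ℝ) * ∑' n : ι → ℤ, fourierPi F ((T⁻¹).transpose.mulVec fun i => n i + h i) *
        e ((∑ i, k i * (T⁻¹).transpose.mulVec (fun i => n i + h i) i : ℝ) : ℂ) := by
  have hT' : (T⁻¹).transpose.det ≠ 0 := by
    rw [Matrix.det_transpose, Matrix.det_nonsing_inv, Ring.inverse_eq_inv']
    exact inv_ne_zero hT
  obtain ⟨c, hcT⟩ := exists_one_add_norm_le_affine hT k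
  obtain ⟨c', hcT'⟩ := exists_one_add_norm_le_affine hT' ((T⁻¹).transpose.mulVec h)
  have hdecay : HasRapidDecay fun x : ι → ℝ =>
      F (T.mulVec x + k) * e (-((∑ i, x i * h i : ℝ) : ℂ)) :=
    hF.comp_of_le hcT 1 fun x => by rw [norm_mul_e_neg, one_mul]
  have hcont : Continuous fun x : ι → ℝ =>
      F (T.mulVec x + k) * e (-((∑ i, x i * h i : ℝ) : ℂ)) := by
    refine (hc.comp ?_).mul (continuous_e.comp (by fun_prop))
    exact (Continuous.matrix_mulVec continuous_const continuous_id).add continuous_const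
  have hdecay' : HasRapidDecay (fourierPi fun x : ι → ℝ =>
      F (T.mulVec x + k) * e (-((∑ i, x i * h i : ℝ) : ℂ))) := by
    refine hF'.comp_of_le hcT' |T.det|⁻¹ fun w => ?_
    rw [fourierPi_affine hT, norm_mul, norm_mul, norm_e_ofReal, mul_one, Complex.norm_real,
      Matrix.mulVec_add, Real.norm_of_nonneg (by positivity)]
  have hs := hdecay'.hasSqDecay.summable_translate 0
  simp only [Pi.zero_apply, zero_add] at hs
  rw [tsum_eq_tsum_fourierPi hcont hdecay.hasSqDecay hs, ← tsum_mul_left]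
  exact tsum_congr fun n => fourierPi_affine hT k h _ F

end PoissonAffine

/-! ### The heat flow on monomials and its Fourier transform -/

section Hermite

open MeasureTheory

/-- The value at `x` of `exp(c d²/dx²)` applied to the `k`-th power. -/
def heatPow (c x : ℂ) : ℕ → ℂ
  | 0 => 1
  | 1 => x
  | k + 2 => x * heatPow c x (k + 1) + 2 * c * (k + 1) * heatPow c x k

/-- The derivative of `heatPow` in `x`. -/
def heatPowDeriv (c x : ℂ) : ℕ → ℂ
  | 0 => 0
  | k + 1 => (k + 1) * heatPow c x k

/-- This is the commutation rule `exp(cD²) x = (x + 2cD) exp(cD²)` applied to a power. -/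
theorem heatPow_succ (c x : ℂ) (k : ℕ) :
    heatPow c x (k + 1) = x * heatPow c x k + 2 * c * heatPowDeriv c x k := by
  cases k with
  | zero => simp [heatPow, heatPowDeriv]
  | succ k => simp only [heatPow, heatPowDeriv]; ring

theorem hasDerivAt_heatPow (c : ℂ) (k : ℕ) (x : ℂ) :
    HasDerivAt (fun x => heatPow c x k) (heatPowDeriv c x k) x := by
  induction k using Nat.strong_induction_on with
  | _ k ih =>
    match k with
    | 0 => simpa [heatPow, heatPowDeriv] using hasDerivAt_const x (1 : ℂ)
    | 1 => simpa [heatPow, heatPowDeriv] using hasDerivAt_id' x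
    | k + 2 =>
      have h1 := ih (k + 1) (by omega)
      have h2 := ih k (by omega)
      have := ((hasDerivAt_id x).mul h1).add (h2.const_mul (2 * c * (k + 1)))
      refine this.congr_deriv ?_
      simp only [heatPowDeriv, id_eq, heatPow_succ c x k]
      push_cast
      ring

theorem heatPow_scale (c t x : ℂ) (k : ℕ) :
    heatPow (t ^ 2 * c) (t * x) k = t ^ k * heatPow c x k := by
  induction k using Nat.strong_induction_on with
  | _ k ih =>
    match k with
    | 0 => simp [heatPow]
    | 1 => simp [heatPow]
    | k + 2 =>
      rw [heatPow, heatPow, ih (k + 1) (by omega), ih k (by omega)]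
      ring

theorem continuous_heatPow (c : ℂ) (k : ℕ) : Continuous fun x => heatPow c x k :=
  continuous_iff_continuousAt.2 fun x => (hasDerivAt_heatPow c k x).continuousAt

/-- The Gaussian `exp(π i z v²)`. -/
def gauss (z : ℂ) (v : ℝ) : ℂ := Complex.exp (Real.pi * Complex.I * z * v ^ 2)

theorem continuous_gauss (z : ℂ) : Continuous (gauss z) := by unfold gauss; fun_prop

theorem norm_gauss (z : ℂ) (v : ℝ) : ‖gauss z v‖ = Real.exp (-(Real.pi * z.im) * v ^ 2) := by
  rw [gauss, Complex.norm_exp]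
  congr 1
  have : (Real.pi : ℂ) * Complex.I * z * v ^ 2 = ((Real.pi * v ^ 2 : ℝ) : ℂ) * (Complex.I * z) := by
    push_cast; ring
  rw [this, Complex.re_ofReal_mul, Complex.I_mul_re]
  ring

theorem exists_norm_heatPow_le (c : ℂ) (k : ℕ) :
    ∃ A, 0 ≤ A ∧ ∀ v : ℝ, ‖heatPow c v k‖ ≤ A * (1 + |v|) ^ k := by
  induction k using Nat.strong_induction_on with
  | _ k ih =>
    match k with
    | 0 => exact ⟨1, zero_le_one, fun v => by simp [heatPow]⟩
    | 1 => exact ⟨1, zero_le_one, fun v => by simp [heatPow]⟩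
    | k + 2 =>
      obtain ⟨A, hA, hA'⟩ := ih (k + 1) (by omega)
      obtain ⟨B, hB, hB'⟩ := ih k (by omega)
      refine ⟨A + ‖2 * c * (k + 1)‖ * B, by positivity, fun v => ?_⟩
      rw [heatPow]
      have h1 : 1 ≤ 1 + |v| := by linarith [abs_nonneg v]
      have h2 : |v| ≤ 1 + |v| := by linarith
      refine (norm_add_le _ _).trans ?_
      rw [norm_mul, norm_mul (2 * c * (k + 1)), Complex.norm_real, Real.norm_eq_abs, add_mul]
      refine add_le_add ?_ ?_
      · calc |v| * ‖heatPow c v (k + 1)‖ ≤ (1 + |v|) * (A * (1 + |v|) ^ (k + 1)) :=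
              mul_le_mul h2 (hA' v) (norm_nonneg _) (by positivity)
          _ = A * (1 + |v|) ^ (k + 2) := by ring
      · rw [mul_assoc ‖2 * c * (k + 1)‖]
        refine mul_le_mul_of_nonneg_left ((hB' v).trans ?_) (norm_nonneg (2 * c * (k + 1)))
        exact mul_le_mul_of_nonneg_left (pow_le_pow_right₀ h1 (by omega)) hB

theorem exists_pow_mul_norm_gauss_le {z : ℂ} (hz : 0 < z.im) (N : ℕ) :
    ∃ C, 0 ≤ C ∧ ∀ v : ℝ, (1 + |v|) ^ N * ‖gauss z v‖ ≤ C := by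
  set a := Real.pi * z.im with ha
  have ha0 : 0 < a := mul_pos Real.pi_pos hz
  -- Since `(1 + |v|)^N ≤ exp(N|v|)`, the constant is the maximum of `exp(N|v| - a v²)`, by
  -- completing the square.
  refine ⟨Real.exp (N ^ 2 / (4 * a)), (Real.exp_pos _).le, fun v => ?_⟩
  have h1 : (1 + |v|) ^ N ≤ Real.exp (N * |v|) := by
    rw [Real.exp_nat_mul]
    exact pow_le_pow_left₀ (by positivity) (by linarith [Real.add_one_le_exp |v|]) N
  rw [norm_gauss]
  refine (mul_le_mul_of_nonneg_right h1 (Real.exp_pos _).le).trans ?_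
  rw [← Real.exp_add, Real.exp_le_exp, le_div_iff₀ (by positivity), ← sq_abs v]
  nlinarith [sq_nonneg (2 * a * |v| - N)]

theorem exists_pow_mul_norm_heatPow_gauss_le {z : ℂ} (hz : 0 < z.im) (c : ℂ) (k N : ℕ) :
    ∃ C, 0 ≤ C ∧ ∀ v : ℝ, (1 + |v|) ^ N * ‖heatPow c v k * gauss z v‖ ≤ C := by
  obtain ⟨A, hA, hA'⟩ := exists_norm_heatPow_le c k
  obtain ⟨C, hC, hC'⟩ := exists_pow_mul_norm_gauss_le hz (N + k)
  refine ⟨A * C, by positivity, fun v => ?_⟩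
  calc (1 + |v|) ^ N * ‖heatPow c v k * gauss z v‖
      ≤ (1 + |v|) ^ N * ((A * (1 + |v|) ^ k) * ‖gauss z v‖) := by
        rw [norm_mul]
        exact mul_le_mul_of_nonneg_left (mul_le_mul_of_nonneg_right (hA' v) (norm_nonneg _))
          (by positivity)
    _ = A * ((1 + |v|) ^ (N + k) * ‖gauss z v‖) := by ring
    _ ≤ A * C := mul_le_mul_of_nonneg_left (hC' v) hA

theorem integrable_pow_mul_heatPow_gauss {z : ℂ} (hz : 0 < z.im) (c : ℂ) (j k : ℕ) :
    Integrable fun v : ℝ => (v : ℂ) ^ j * (heatPow c v k * gauss z v) := by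
  -- The factor `v ^ j` uses up `j` powers; the two others give the integrable bound `(1 + v²)⁻¹`.
  obtain ⟨C, hC, hC'⟩ := exists_pow_mul_norm_heatPow_gauss_le hz c k (j + 2)
  refine Integrable.mono' (g := fun v : ℝ => C * (1 + v ^ 2)⁻¹)
    (integrable_inv_one_add_sq.const_mul C) ?_ (Filter.Eventually.of_forall fun v => ?_)
  · exact Continuous.aestronglyMeasurable ((Complex.continuous_ofReal.pow j).mul
      (((continuous_heatPow c k).comp Complex.continuous_ofReal).mul (continuous_gauss z)))
  · rw [← div_eq_mul_inv, le_div_iff₀ (by positivity)]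
    refine le_trans ?_ (hC' v)
    rw [norm_mul, norm_pow, Complex.norm_real, Real.norm_eq_abs, mul_right_comm]
    refine mul_le_mul_of_nonneg_right ?_ (norm_nonneg _)
    rw [pow_add]
    refine mul_le_mul (pow_le_pow_left₀ (abs_nonneg _) (by linarith) j) ?_ (by positivity)
      (by positivity)
    rw [← sq_abs]
    nlinarith [abs_nonneg v]

-- Multiplication by `v` becomes `(i/2π) d/dw` under the Fourier transform. Differentiating the
-- transformed Gaussian yields the multiplier `w/z`, and differentiating the polynomial yields `2b`
-- times its derivative with `b = i/(4πz)`. By `heatPow_succ` this is the recursion of the heat flow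
-- with time `c + b`, and the classical Gaussian starts the induction.
open FourierTransform in
theorem fourier_heatPow_gauss {z : ℂ} (hz : 0 < z.im) (c : ℂ) (k : ℕ) :
    (𝓕 fun v : ℝ => heatPow c v k * gauss z v) = fun w : ℝ =>
      heatPow (c + Complex.I / (4 * Real.pi * z)) (w / z) k *
        ((-Complex.I * z) ^ (-(1 / 2) : ℂ) * gauss (-z⁻¹) w) := by
  have hz0 : z ≠ 0 := by rintro rfl; simp at hz
  have hpi : (Real.pi : ℂ) ≠ 0 := Complex.ofReal_ne_zero.2 Real.pi_ne_zero
  set b := Complex.I / (4 * Real.pi * z) with hb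
  have hgauss : ∀ w : ℝ, HasDerivAt (fun w : ℝ => gauss (-z⁻¹) w)
      (gauss (-z⁻¹) w * (-2 * Real.pi * Complex.I * (w / z))) w := by
    intro w
    have h1 : HasDerivAt (fun w : ℝ => (w : ℂ)) 1 w := Complex.ofRealCLM.hasDerivAt
    have h2 := ((h1.fun_pow 2).const_mul (Real.pi * Complex.I * (-z⁻¹))).cexp
    refine h2.congr_deriv ?_
    simp only [gauss]
    field_simp
    push_cast
    ring
  -- The derivative of the transform is computed twice: under the integral sign, and from the
  -- formula already known for `k`.
  have step : ∀ k, ((𝓕 fun v : ℝ => heatPow c v k * gauss z v) = fun w : ℝ =>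
      heatPow (c + b) (w / z) k * ((-Complex.I * z) ^ (-(1 / 2) : ℂ) * gauss (-z⁻¹) w)) →
      ∀ w : ℝ, 𝓕 (fun v : ℝ => (v : ℂ) * (heatPow c v k * gauss z v)) w =
        ((w / z) * heatPow (c + b) (w / z) k + 2 * b * heatPowDeriv (c + b) (w / z) k) *
          ((-Complex.I * z) ^ (-(1 / 2) : ℂ) * gauss (-z⁻¹) w) := by
    intro k hk w
    have i0 : Integrable fun v : ℝ => heatPow c v k * gauss z v := by
      simpa using integrable_pow_mul_heatPow_gauss hz c 0 k
    have i1 : Integrable fun v : ℝ => v • (heatPow c v k * gauss z v) := by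
      simpa using integrable_pow_mul_heatPow_gauss hz c 1 k
    have d1 := Real.hasDerivAt_fourier i0 i1 w
    rw [hk] at d1
    have h1 : HasDerivAt (fun w : ℝ => (w : ℂ) / z) (1 / z) w :=
      (Complex.ofRealCLM.hasDerivAt (x := w)).div_const z
    have h2 : HasDerivAt (fun w : ℝ => heatPow (c + b) (w / z) k)
        (heatPowDeriv (c + b) (w / z) k * (1 / z)) w :=
      HasDerivAt.comp (h₂ := fun x => heatPow (c + b) x k) w (hasDerivAt_heatPow (c + b) k (w / z)) h1
    have d2 := h2.mul ((hgauss w).const_mul ((-Complex.I * z) ^ (-(1 / 2) : ℂ)))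
    have huniq := d1.unique d2
    have hsm : (fun x : ℝ => (-2 * (Real.pi : ℂ) * Complex.I * x) • (heatPow c x k * gauss z x)) =
        (-2 * Real.pi * Complex.I : ℂ) • fun v : ℝ => (v : ℂ) * (heatPow c v k * gauss z v) := by
      funext v
      simp only [smul_eq_mul, Pi.smul_apply]
      ring
    rw [hsm] at huniq
    have hlin : 𝓕 ((-2 * Real.pi * Complex.I : ℂ) • fun v : ℝ =>
        (v : ℂ) * (heatPow c v k * gauss z v)) w = (-2 * Real.pi * Complex.I : ℂ) *
        𝓕 (fun v : ℝ => (v : ℂ) * (heatPow c v k * gauss z v)) w := by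
      rw [Real.fourier_eq, Real.fourier_eq, ← integral_const_mul]
      congr 1
      funext v
      rw [Pi.smul_apply, smul_comm, smul_eq_mul]
    rw [hlin] at huniq
    have hI : (-2 * Real.pi * Complex.I : ℂ) ≠ 0 := by
      simp [hpi]
    apply mul_left_cancel₀ hI
    rw [huniq, hb]
    field_simp
    ring_nf
    simp only [Complex.I_sq]
    ring
  have i0 : ∀ j, Integrable fun v : ℝ => heatPow c v j * gauss z v := fun j => by
    simpa using integrable_pow_mul_heatPow_gauss hz c 0 j
  induction k using Nat.strong_induction_on with
  | _ k ih =>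
    match k with
    | 0 =>
      have hre : 0 < (-Complex.I * z).re := by simpa using hz
      have h := fourier_gaussian_pi hre
      have h1 : (fun v : ℝ => heatPow c v 0 * gauss z v) =
          fun x : ℝ => Complex.exp (-Real.pi * (-Complex.I * z) * x ^ 2) := by
        funext v
        rw [heatPow, one_mul, gauss]
        congr 1
        ring
      rw [h1, h]
      funext w
      rw [heatPow, one_mul, gauss, Complex.cpow_neg, one_div]
      congr 2
      field_simp
      ring_nf
      simp only [Complex.I_sq]
      ring
    | 1 =>
      have h1 : (fun v : ℝ => heatPow c v 1 * gauss z v) =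
          fun v : ℝ => (v : ℂ) * (heatPow c v 0 * gauss z v) := by
        funext v; simp [heatPow]
      rw [h1]
      funext w
      rw [step 0 (ih 0 (by omega)) w]
      simp [heatPow, heatPowDeriv]
    | k + 2 =>
      have h1 : (fun v : ℝ => heatPow c v (k + 2) * gauss z v) =
          (fun v : ℝ => (v : ℂ) * (heatPow c v (k + 1) * gauss z v)) +
            (2 * c * (k + 1)) • fun v : ℝ => heatPow c v k * gauss z v := by
        funext v
        simp only [heatPow, Pi.add_apply, Pi.smul_apply, smul_eq_mul]
        ring
      have i1 : Integrable fun v : ℝ => (v : ℂ) * (heatPow c v (k + 1) * gauss z v) := by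
        simpa using integrable_pow_mul_heatPow_gauss hz c 1 (k + 1)
      rw [h1]
      funext w
      have hadd : 𝓕 ((fun v : ℝ => (v : ℂ) * (heatPow c v (k + 1) * gauss z v)) +
            (2 * c * (k + 1)) • fun v : ℝ => heatPow c v k * gauss z v) w =
          𝓕 (fun v : ℝ => (v : ℂ) * (heatPow c v (k + 1) * gauss z v)) w +
            (2 * c * (k + 1)) * 𝓕 (fun v : ℝ => heatPow c v k * gauss z v) w := by
        rw [Real.fourier_eq, Real.fourier_eq, Real.fourier_eq, ← integral_const_mul,
          ← integral_add]
        · congr 1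
          funext v
          rw [Pi.add_apply, smul_add, Pi.smul_apply, smul_comm, smul_eq_mul (2 * c * (k + 1))]
        · exact (Real.fourierIntegral_convergent_iff w).2 i1
        · exact ((Real.fourierIntegral_convergent_iff w).2 (i0 k)).const_mul _
      rw [hadd, step (k + 1) (ih (k + 1) (by omega)) w, ih k (by omega), heatPow]
      simp only [heatPowDeriv]
      ring

theorem integral_heatPow_gauss {z : ℂ} (hz : 0 < z.im) (c : ℂ) (k : ℕ) (w : ℝ) :
    ∫ v : ℝ, heatPow c v k * gauss z v * e (-((v * w : ℝ) : ℂ)) =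
      heatPow (c + Complex.I / (4 * Real.pi * z)) (w / z) k *
        ((-Complex.I * z) ^ (-(1 / 2) : ℂ) * gauss (-z⁻¹) w) := by
  have h := congrFun (fourier_heatPow_gauss hz c k) w
  rw [Real.fourier_real_eq_integral_exp_smul] at h
  rw [← h]
  congr 1
  funext v
  rw [smul_eq_mul, mul_comm]
  congr 1
  rw [e]
  congr 1
  push_cast
  ring

end Hermite

/-! ### The heat flow on polynomials -/

section Heat

open MvPolynomial

/-- The commutator of two derivations is a derivation, and this one kills every variable. -/
theorem pderiv_pderiv_comm {σ : Type*} (i j : σ) (Q : MvPolynomial σ ℂ) :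
    pderiv i (pderiv j Q) = pderiv j (pderiv i Q) := by
  classical
  have h : ⁅pderiv (R := ℂ) i, pderiv (R := ℂ) j⁆ = 0 := by
    refine derivation_ext fun k => ?_
    rw [Derivation.commutator_apply]
    simp only [pderiv_X, Pi.single_apply]
    split_ifs <;> simp
  have := congrArg (fun D => D Q) h
  simpa [Derivation.commutator_apply, sub_eq_zero] using this

variable {ι : Type*} [Fintype ι]

/-- The value at `x` of `exp(∑ i, c i * ∂_i²)` applied to a polynomial. -/
def heat (c x : ι → ℂ) : MvPolynomial ι ℂ →ₗ[ℂ] ℂ :=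
  (basisMonomials ι ℂ).constr ℂ fun k => ∏ i, heatPow (c i) (x i) (k i)

theorem heat_monomial (c x : ι → ℂ) (k : ι →₀ ℕ) (a : ℂ) :
    heat c x (monomial k a) = a * ∏ i, heatPow (c i) (x i) (k i) := by
  have h1 : monomial k a = a • monomial k (1 : ℂ) := by
    rw [smul_monomial, smul_eq_mul, mul_one]
  have h2 : heat c x (monomial k (1 : ℂ)) = ∏ i, heatPow (c i) (x i) (k i) := by
    have h := congrFun (coe_basisMonomials ι ℂ) k
    rw [heat, ← h, Module.Basis.constr_basis]
  rw [h1, map_smul, h2, smul_eq_mul]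

theorem heat_eq_sum (c x : ι → ℂ) (Q : MvPolynomial ι ℂ) :
    heat c x Q = ∑ k ∈ Q.support, Q.coeff k * ∏ i, heatPow (c i) (x i) (k i) := by
  conv_lhs => rw [Q.as_sum]
  rw [map_sum]
  exact Finset.sum_congr rfl fun k _ => heat_monomial c x k _

theorem heat_one (c x : ι → ℂ) : heat c x 1 = 1 := by
  have := heat_monomial c x 0 1
  simpa [heatPow] using this

/-- The rule of `heatPow_succ` in the coordinate `a`, the other factors being untouched. It is the
recursion by which the heat flow is later matched with the exponential series. -/
theorem heat_X_mul (c x : ι → ℂ) (a : ι) (Q : MvPolynomial ι ℂ) :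
    heat c x (X a * Q) = x a * heat c x Q + 2 * c a * heat c x (pderiv a Q) := by
  classical
  induction Q using MvPolynomial.induction_on' with
  | monomial k r =>
    rw [X, monomial_mul, pderiv_monomial, heat_monomial, heat_monomial, heat_monomial,
      ← Finset.mul_prod_erase _ _ (Finset.mem_univ a), ← Finset.mul_prod_erase _ _
      (Finset.mem_univ a), ← Finset.mul_prod_erase _ _ (Finset.mem_univ a)]
    have h1 : ∏ i ∈ Finset.univ.erase a, heatPow (c i) (x i) ((Finsupp.single a 1 + k : ι →₀ ℕ) i) =
        ∏ i ∈ Finset.univ.erase a, heatPow (c i) (x i) (k i) :=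
      Finset.prod_congr rfl fun i hi => by
        simp [Finsupp.single_eq_of_ne (Finset.ne_of_mem_erase hi)]
    have h2 : ∏ i ∈ Finset.univ.erase a, heatPow (c i) (x i) ((k - Finsupp.single a 1 : ι →₀ ℕ) i) =
        ∏ i ∈ Finset.univ.erase a, heatPow (c i) (x i) (k i) :=
      Finset.prod_congr rfl fun i hi => by
        simp [Finsupp.single_eq_of_ne (Finset.ne_of_mem_erase hi)]
    have h3 : (Finsupp.single a 1 + k : ι →₀ ℕ) a = k a + 1 := by simp [add_comm]
    have h4 : heatPowDeriv (c a) (x a) (k a) =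
        k a * heatPow (c a) (x a) ((k - Finsupp.single a 1 : ι →₀ ℕ) a) := by
      rw [Finsupp.tsub_apply, Finsupp.single_eq_same]
      cases k a with
      | zero => simp [heatPowDeriv]
      | succ j => simp [heatPowDeriv]
    rw [h1, h2, h3, heatPow_succ, h4]
    ring
  | add p q hp hq =>
    rw [mul_add, map_add, map_add, map_add, map_add, hp, hq]
    ring

theorem heat_scale (c x t : ι → ℂ) (Q : MvPolynomial ι ℂ) :
    heat (fun i => t i ^ 2 * c i) (fun i => t i * x i) Q =
      heat c x (bind₁ (fun i => C (t i) * X i) Q) := by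
  induction Q using MvPolynomial.induction_on' with
  | monomial k r =>
    have h : bind₁ (fun i => C (t i) * X i) (monomial k r) =
        monomial k (r * ∏ i, t i ^ k i) := by
      have h1 := Finsupp.prod_fintype k (fun i j => (C (t i) * X i : MvPolynomial ι ℂ) ^ j)
        fun i => pow_zero _
      have h2 := Finsupp.prod_fintype k (fun i j => (X i : MvPolynomial ι ℂ) ^ j)
        fun i => pow_zero _
      rw [bind₁_monomial, monomial_eq (s := k), h2]
      rw [Finsupp.prod] at h1
      rw [h1]
      simp only [mul_pow, Finset.prod_mul_distrib, map_mul, map_prod, map_pow]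
      ring
    rw [h, heat_monomial, heat_monomial]
    simp only [heatPow_scale, Finset.prod_mul_distrib]
    ring
  | add p q hp hq => rw [map_add, map_add, map_add, hp, hq]

/-- The Laplacian `∑ i, ∂_i²`. -/
def stdLaplacian : MvPolynomial ι ℂ →ₗ[ℂ] MvPolynomial ι ℂ :=
  ∑ i, (pderiv i).toLinearMap ∘ₗ (pderiv i).toLinearMap

theorem stdLaplacian_apply (Q : MvPolynomial ι ℂ) :
    stdLaplacian Q = ∑ i, pderiv i (pderiv i Q) := by
  simp [stdLaplacian]

theorem pderiv_stdLaplacian_pow (a : ι) (k : ℕ) (Q : MvPolynomial ι ℂ) :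
    pderiv a ((stdLaplacian ^ k) Q) = (stdLaplacian ^ k) (pderiv a Q) := by
  induction k with
  | zero => rfl
  | succ k ih =>
    rw [pow_succ', Module.End.mul_apply, Module.End.mul_apply, ← ih, stdLaplacian_apply,
      stdLaplacian_apply, map_sum]
    refine Finset.sum_congr rfl fun i _ => ?_
    rw [pderiv_pderiv_comm a i, pderiv_pderiv_comm a i]

theorem stdLaplacian_X_mul (a : ι) (Q : MvPolynomial ι ℂ) :
    stdLaplacian (X a * Q) = X a * stdLaplacian Q + 2 * pderiv a Q := by
  classical
  rw [stdLaplacian_apply, stdLaplacian_apply]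
  have h : ∀ i, pderiv i (pderiv i (X a * Q)) =
      X a * pderiv i (pderiv i Q) + if i = a then 2 * pderiv i Q else 0 := by
    intro i
    by_cases hi : i = a
    · subst hi
      simp only [pderiv_mul, pderiv_X_self, map_add, one_mul, if_true]
      ring
    · simp only [pderiv_mul, pderiv_X_of_ne (Ne.symm hi), zero_mul, zero_add, if_neg hi,
        add_zero]
  simp only [h, Finset.sum_add_distrib, Finset.mul_sum, Finset.sum_ite_eq', Finset.mem_univ,
    if_true]

/-- The commutator of `Δ` with `X a` is `2 ∂_a`, which commutes with `Δ`; hence that of `Δ^(k+1)` is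
`2(k+1) Δ^k ∂_a`. -/
theorem stdLaplacian_pow_succ_X_mul (a : ι) (k : ℕ) (Q : MvPolynomial ι ℂ) :
    (stdLaplacian ^ (k + 1)) (X a * Q) = X a * (stdLaplacian ^ (k + 1)) Q +
      C (2 * (k + 1) : ℂ) * (stdLaplacian ^ k) (pderiv a Q) := by
  induction k with
  | zero =>
    simp only [zero_add, pow_one, pow_zero, Module.End.one_apply, mul_one,
      stdLaplacian_X_mul, CharP.cast_eq_zero, zero_add, map_ofNat]
  | succ k ih =>
    have hC : ∀ (r : ℂ) (P : MvPolynomial ι ℂ), stdLaplacian (C r * P) = C r * stdLaplacian P := by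
      intro r P
      rw [← smul_eq_C_mul, map_smul, smul_eq_C_mul]
    rw [pow_succ', Module.End.mul_apply, ih, map_add, stdLaplacian_X_mul, hC,
      pderiv_stdLaplacian_pow, Module.End.mul_apply,
      pow_succ' stdLaplacian k, Module.End.mul_apply, Module.End.mul_apply]
    push_cast
    simp only [map_mul, map_add, map_natCast, map_one, map_ofNat]
    ring

/-- The exponential series of the Laplacian, cut off after `K` terms. -/
def expStdLaplacian (c : ℂ) (K : ℕ) : MvPolynomial ι ℂ →ₗ[ℂ] MvPolynomial ι ℂ :=
  ∑ k ∈ Finset.range K, (c ^ k / (k.factorial : ℂ)) • stdLaplacian ^ k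

theorem expStdLaplacian_apply (c : ℂ) (K : ℕ) (Q : MvPolynomial ι ℂ) :
    expStdLaplacian c K Q =
      ∑ k ∈ Finset.range K, C (c ^ k / (k.factorial : ℂ)) * (stdLaplacian ^ k) Q := by
  simp [expStdLaplacian, LinearMap.sum_apply, smul_eq_C_mul]

/-- The commutator term lowers the power of `Δ` by one, so the truncated series on the derivative is
one term shorter. The factor `k + 1` cancels against the factorial. -/
theorem expStdLaplacian_X_mul (c : ℂ) (K : ℕ) (a : ι) (Q : MvPolynomial ι ℂ) :
    expStdLaplacian c (K + 1) (X a * Q) = X a * expStdLaplacian c (K + 1) Q +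
      C (2 * c) * expStdLaplacian c K (pderiv a Q) := by
  rw [expStdLaplacian_apply, expStdLaplacian_apply, expStdLaplacian_apply, Finset.sum_range_succ',
    Finset.sum_range_succ' _ K, mul_add, Finset.mul_sum, Finset.mul_sum, add_right_comm,
    ← Finset.sum_add_distrib]
  congr 1
  · refine Finset.sum_congr rfl fun k _ => ?_
    rw [stdLaplacian_pow_succ_X_mul]
    have h : c ^ (k + 1) / ((k + 1).factorial : ℂ) * (2 * (k + 1)) =
        2 * c * (c ^ k / (k.factorial : ℂ)) := by
      have : ((k : ℂ) + 1) ≠ 0 := Nat.cast_add_one_ne_zero k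
      have h' : (k.factorial : ℂ) ≠ 0 := Nat.cast_ne_zero.2 k.factorial_ne_zero
      rw [Nat.factorial_succ]
      push_cast
      field_simp
      ring
    rw [mul_add, ← mul_assoc (C (2 * c)), ← C_mul, ← h, C_mul (a := c ^ (k + 1) / _)]
    ring
  · simp only [pow_zero, Module.End.one_apply]
    ring

/-- Both sides obey the same recursion under multiplication by a variable, so induction on the
degree of a monomial suffices. The loss of one term of the series is harmless because the derivative
also loses one degree. -/
theorem eval_expStdLaplacian (c : ℂ) (x : ι → ℂ) (Q : MvPolynomial ι ℂ) (K : ℕ)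
    (hK : Q.totalDegree < K) : eval x (expStdLaplacian c K Q) = heat (fun _ => c) x Q := by
  classical
  have hmon : ∀ (d : ℕ) (k : ι →₀ ℕ), k.degree = d → ∀ K, d < K → ∀ r : ℂ,
      eval x (expStdLaplacian c K (monomial k r)) = heat (fun _ => c) x (monomial k r) := by
    intro d
    induction d using Nat.strong_induction_on with
    | _ d ih =>
      intro k hk K hK r
      by_cases hk0 : k = 0
      · subst hk0
        obtain ⟨K, rfl⟩ := Nat.exists_eq_succ_of_ne_zero (by omega : K ≠ 0)
        rw [expStdLaplacian_apply, Finset.sum_range_succ', Finset.sum_eq_zero, heat_monomial]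
        · simp [heatPow]
        · intro j _
          have h0 : stdLaplacian (monomial (0 : ι →₀ ℕ) r) = 0 := by
            simp [stdLaplacian_apply]
          rw [pow_succ stdLaplacian, Module.End.mul_apply, h0, map_zero, mul_zero]
      · obtain ⟨a, ha⟩ := Finsupp.ne_iff.1 hk0
        rw [Finsupp.zero_apply] at ha
        have hsplit : Finsupp.single a 1 + (k - Finsupp.single a 1) = k :=
          add_tsub_cancel_of_le (Finsupp.single_le_iff.2 (Nat.one_le_iff_ne_zero.2 ha))
        set k' := k - Finsupp.single a 1 with hk'
        have hdeg : 1 + k'.degree = d := by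
          rw [← hk, ← hsplit, map_add, Finsupp.degree_single]
        have hX : monomial k r = X a * monomial k' r := by
          rw [X, monomial_mul, one_mul, hsplit]
        obtain ⟨K, rfl⟩ := Nat.exists_eq_succ_of_ne_zero (by omega : K ≠ 0)
        rw [hX, Nat.succ_eq_add_one, expStdLaplacian_X_mul, heat_X_mul, map_add, map_mul, map_mul,
          eval_X, eval_C, ih k'.degree (by omega) k' rfl (K + 1) (by omega) r]
        congr 2
        rw [pderiv_monomial]
        by_cases h0 : k' a = 0
        · simp [h0]
        · have hsplit' : Finsupp.single a 1 + (k' - Finsupp.single a 1) = k' :=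
            add_tsub_cancel_of_le (Finsupp.single_le_iff.2 (Nat.one_le_iff_ne_zero.2 h0))
          have hdeg' : 1 + (k' - Finsupp.single a 1).degree = k'.degree := by
            conv_rhs => rw [← hsplit']
            rw [map_add, Finsupp.degree_single]
          exact ih _ (by omega) _ rfl K (by omega) _
  conv_lhs => rw [Q.as_sum]
  conv_rhs => rw [Q.as_sum]
  rw [map_sum, map_sum, map_sum]
  refine Finset.sum_congr rfl fun k hk => hmon _ k rfl K (lt_of_le_of_lt ?_ hK) _
  exact le_totalDegree hk

end Heat

/-! ### Linear substitutions and the Laplacian -/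

section Substitution

open MvPolynomial

variable {σ τ : Type*} [Fintype τ]

/-- Substitution of the linear forms with coefficient matrix `T`. -/
def linSubst (T : Matrix σ τ ℂ) : MvPolynomial σ ℂ →ₐ[ℂ] MvPolynomial τ ℂ :=
  bind₁ fun a => ∑ b, C (T a b) * X b

theorem eval_linSubst (T : Matrix σ τ ℂ) (P : MvPolynomial σ ℂ) (x : τ → ℂ) :
    eval x (linSubst T P) = eval (T.mulVec x) P := by
  rw [linSubst, ← coe_aeval_eq_eval, ← coe_aeval_eq_eval, RingHom.coe_coe, RingHom.coe_coe,
    aeval_bind₁]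
  congr 2
  funext a
  simp [Matrix.mulVec, dotProduct]

variable [Fintype σ]

theorem pderiv_linSubst (T : Matrix σ τ ℂ) (P : MvPolynomial σ ℂ) (b : τ) :
    pderiv b (linSubst T P) = ∑ a, C (T a b) * linSubst T (pderiv a P) := by
  classical
  induction P using MvPolynomial.induction_on with
  | C r => simp [linSubst]
  | add p q hp hq =>
    simp only [map_add, hp, hq, mul_add, Finset.sum_add_distrib]
  | mul_X p a hp =>
    have h1 : pderiv b (linSubst T (X a)) = C (T a b) := by
      simp [linSubst, pderiv_X, Pi.single_apply]
    rw [map_mul, pderiv_mul, hp, h1]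
    have h2 : ∀ a', C (T a' b) * linSubst T (pderiv a' (p * X a)) =
        C (T a' b) * linSubst T (pderiv a' p) * linSubst T (X a) +
          if a' = a then linSubst T p * C (T a b) else 0 := by
      intro a'
      rw [pderiv_mul, map_add, map_mul, map_mul]
      by_cases h : a' = a
      · subst h
        rw [pderiv_X_self, map_one, if_pos rfl]
        ring
      · rw [pderiv_X_of_ne (Ne.symm h), map_zero, if_neg h]
        ring
    simp only [h2, Finset.sum_add_distrib, Finset.sum_ite_eq', Finset.mem_univ, if_true,
      Finset.sum_mul]

/-- The chain rule applied twice; the coefficients collect to the Gram matrix `T Tᵀ`. -/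
theorem stdLaplacian_linSubst (T : Matrix σ τ ℂ) (P : MvPolynomial σ ℂ) :
    stdLaplacian (linSubst T P) =
      ∑ a, ∑ a', C ((T * T.transpose) a a') * linSubst T (pderiv a (pderiv a' P)) := by
  rw [stdLaplacian_apply]
  simp only [pderiv_linSubst, map_sum, pderiv_C_mul, Finset.mul_sum, Matrix.mul_apply,
    Matrix.transpose_apply, Finset.sum_mul]
  rw [Finset.sum_comm]
  simp only [Finset.sum_comm (s := (Finset.univ : Finset τ))]
  rw [Finset.sum_comm]
  refine Finset.sum_congr rfl fun a _ => Finset.sum_congr rfl fun a' _ =>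
    Finset.sum_congr rfl fun b _ => ?_
  rw [C_mul]
  ring

variable {m n : ℕ}

/-- If `T Tᵀ = M⁻¹ ⊗ I`, then `exp(c tr Δ_M)` becomes the standard heat flow after the substitution
of `T`. -/
theorem eval_expLaplacian {M : Matrix (Fin m) (Fin m) ℝ} {T : Matrix (Fin m × Fin n) τ ℂ}
    (hT : ∀ p q, (T * T.transpose) p q = if p.2 = q.2 then ((M⁻¹ p.1 q.1 : ℝ) : ℂ) else 0)
    (c : ℂ) (P : MatPoly m n) (x : τ → ℂ) :
    eval (T.mulVec x) (expLaplacian c M P) = heat (fun _ => c) x (linSubst T P) := by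
  have hlap : ∀ Q : MatPoly m n, linSubst T (laplacian M Q) = stdLaplacian (linSubst T Q) := by
    intro Q
    rw [stdLaplacian_linSubst, laplacian]
    simp only [map_sum, map_mul, hT, Fintype.sum_prod_type]
    have hC : ∀ r : ℂ, linSubst T (C r) = C r := fun r => by simp [linSubst]
    simp only [hC]
    rw [Finset.sum_comm]
    refine Finset.sum_congr rfl fun μ _ => Finset.sum_congr rfl fun ν _ =>
      Finset.sum_congr rfl fun ρ _ => ?_
    rw [Finset.sum_eq_single ν]
    · rw [if_pos rfl]
    · intro ν' _ h
      rw [if_neg (Ne.symm h), map_zero, zero_mul]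
    · simp
  have hiter : ∀ k, linSubst T ((laplacian M)^[k] P) = (stdLaplacian ^ k) (linSubst T P) := by
    intro k
    induction k with
    | zero => rfl
    | succ k ih =>
      rw [Function.iterate_succ_apply', hlap, ih, pow_succ', Module.End.mul_apply]
  -- The cutoff is raised beyond both total degrees: the additional terms vanish by
  -- `laplacian_iterate_eq_zero`, and `eval_expStdLaplacian` needs it to exceed the degree of the
  -- substituted polynomial.
  have hsum : linSubst T (expLaplacian c M P) =
      expStdLaplacian c (P.totalDegree + 1 + (linSubst T P).totalDegree + 1) (linSubst T P) := by
    rw [expLaplacian, expStdLaplacian_apply, map_sum, add_assoc (P.totalDegree + 1),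
      Finset.sum_range_add _ (P.totalDegree + 1)]
    refine Eq.trans ?_ (left_eq_add.2 (Finset.sum_eq_zero ?_))
    · refine Finset.sum_congr rfl fun k _ => ?_
      rw [map_mul, hiter]
      simp [linSubst]
    · intro k _
      rw [← hiter, laplacian_iterate_eq_zero M P _ (by omega), map_zero, mul_zero]
  rw [← eval_linSubst, hsum, eval_expStdLaplacian]
  omega

end Substitution

/-! ### Heat flow times Gaussian in several variables -/

section HeatGauss

open MeasureTheory MvPolynomial

variable {ι : Type*} [Fintype ι]

/-- A polynomial under the heat flow, times a Gaussian. -/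
def heatGauss (c z : ι → ℂ) (Q : MvPolynomial ι ℂ) (x : ι → ℝ) : ℂ :=
  heat c (fun i => x i) Q * ∏ i, gauss (z i) (x i)

theorem heatGauss_eq_sum (c z : ι → ℂ) (Q : MvPolynomial ι ℂ) (x : ι → ℝ) :
    heatGauss c z Q x =
      ∑ k ∈ Q.support, Q.coeff k * ∏ i, (heatPow (c i) (x i) (k i) * gauss (z i) (x i)) := by
  rw [heatGauss, heat_eq_sum, Finset.sum_mul]
  exact Finset.sum_congr rfl fun k _ => by rw [Finset.prod_mul_distrib, mul_assoc]

theorem continuous_heatGauss (c z : ι → ℂ) (Q : MvPolynomial ι ℂ) :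
    Continuous (heatGauss c z Q) := by
  rw [funext (heatGauss_eq_sum c z Q)]
  refine continuous_finsetSum _ fun k _ => continuous_const.mul
    (continuous_finsetProd _ fun i _ => ?_)
  exact ((continuous_heatPow (c i) (k i)).comp
    (Complex.continuous_ofReal.comp (continuous_apply i))).mul
      ((continuous_gauss (z i)).comp (continuous_apply i))

theorem one_add_norm_le_prod (x : ι → ℝ) : 1 + ‖x‖ ≤ ∏ i, (1 + |x i|) := by
  classical
  have h1 : ∀ s : Finset ι, 1 ≤ ∏ i ∈ s, (1 + |x i|) := fun s =>
    (Finset.prod_const_one (ι := ι) (s := s)).symm.le.trans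
      (Finset.prod_le_prod (fun i _ => zero_le_one) fun i _ => by linarith [abs_nonneg (x i)])
  suffices ‖x‖ ≤ ∏ i, (1 + |x i|) - 1 by linarith
  refine (pi_norm_le_iff_of_nonneg (by linarith [h1 Finset.univ])).2 fun i => ?_
  rw [← Finset.mul_prod_erase _ _ (Finset.mem_univ i), Real.norm_eq_abs]
  nlinarith [h1 (Finset.univ.erase i), abs_nonneg (x i)]

theorem hasRapidDecay_heatGauss (c : ι → ℂ) {z : ι → ℂ} (hz : ∀ i, 0 < (z i).im)
    (Q : MvPolynomial ι ℂ) : HasRapidDecay (heatGauss c z Q) := by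
  intro N
  have h : ∀ (k : ι →₀ ℕ) (i : ι), ∃ C, 0 ≤ C ∧
      ∀ v : ℝ, (1 + |v|) ^ N * ‖heatPow (c i) v (k i) * gauss (z i) v‖ ≤ C := fun k i =>
    exists_pow_mul_norm_heatPow_gauss_le (hz i) (c i) (k i) N
  choose C hC0 hC using h
  refine ⟨∑ k ∈ Q.support, ‖Q.coeff k‖ * ∏ i, C k i, fun x => ?_⟩
  rw [heatGauss_eq_sum]
  refine (mul_le_mul_of_nonneg_left (norm_sum_le _ _) (by positivity)).trans ?_
  rw [Finset.mul_sum]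
  refine Finset.sum_le_sum fun k _ => ?_
  rw [norm_mul, mul_left_comm]
  refine mul_le_mul_of_nonneg_left ?_ (norm_nonneg _)
  rw [norm_prod]
  calc (1 + ‖x‖) ^ N * ∏ i, ‖heatPow (c i) (x i) (k i) * gauss (z i) (x i)‖
      ≤ (∏ i, (1 + |x i|)) ^ N * ∏ i, ‖heatPow (c i) (x i) (k i) * gauss (z i) (x i)‖ := by
        refine mul_le_mul_of_nonneg_right ?_ (Finset.prod_nonneg fun i _ => norm_nonneg _)
        exact pow_le_pow_left₀ (by positivity) (one_add_norm_le_prod x) N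
    _ = ∏ i, ((1 + |x i|) ^ N * ‖heatPow (c i) (x i) (k i) * gauss (z i) (x i)‖) := by
        rw [Finset.prod_mul_distrib, Finset.prod_pow]
    _ ≤ ∏ i, C k i :=
        Finset.prod_le_prod (fun i _ => by positivity) fun i _ => hC k i (x i)

theorem fourierPi_heatGauss (c : ι → ℂ) {z : ι → ℂ} (hz : ∀ i, 0 < (z i).im)
    (Q : MvPolynomial ι ℂ) (w : ι → ℝ) :
    fourierPi (heatGauss c z Q) w = (∏ i, (-Complex.I * z i) ^ (-(1 / 2) : ℂ)) *
      (heat (fun i => c i + Complex.I / (4 * Real.pi * z i)) (fun i => w i / z i) Q *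
        ∏ i, gauss (-(z i)⁻¹) (w i)) := by
  have he : ∀ v : ι → ℝ, e (-((∑ i, v i * w i : ℝ) : ℂ)) = ∏ i, e (-((v i * w i : ℝ) : ℂ)) := by
    intro v
    simp only [e, ← Complex.exp_sum, ← Finset.mul_sum]
    push_cast
    rw [Finset.sum_neg_distrib]
  have hprod : ∀ (k : ι →₀ ℕ) (v : ι → ℝ),
      Q.coeff k * (∏ i, (heatPow (c i) (v i) (k i) * gauss (z i) (v i))) *
        e (-((∑ i, v i * w i : ℝ) : ℂ)) = Q.coeff k *
        ∏ i, (heatPow (c i) (v i) (k i) * gauss (z i) (v i) * e (-((v i * w i : ℝ) : ℂ))) := by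
    intro k v
    rw [he, Finset.prod_mul_distrib (f := fun i => heatPow (c i) (v i) (k i) * gauss (z i) (v i)),
      mul_assoc]
  rw [fourierPi]
  simp only [heatGauss_eq_sum, Finset.sum_mul, hprod]
  rw [integral_finsetSum]
  · rw [heat_eq_sum, Finset.sum_mul, Finset.mul_sum]
    refine Finset.sum_congr rfl fun k _ => ?_
    rw [integral_const_mul, integral_fintype_prod_volume_eq_prod
      (fun (i : ι) (v : ℝ) => heatPow (c i) v (k i) * gauss (z i) v * e (-((v * w i : ℝ) : ℂ)))]
    simp only [integral_heatPow_gauss (hz _), Finset.prod_mul_distrib]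
    ring
  · intro k _
    refine Integrable.const_mul ?_ _
    refine Integrable.fintype_prod
      (f := fun (i : ι) (v : ℝ) => heatPow (c i) v (k i) * gauss (z i) v *
        e (-((v * w i : ℝ) : ℂ))) fun i => ?_
    have h0 := integrable_pow_mul_heatPow_gauss (hz i) (c i) 0 (k i)
    simp only [pow_zero, one_mul] at h0
    refine h0.mono ?_ (Filter.Eventually.of_forall fun v => (norm_mul_e_neg _ _).le)
    exact ((((continuous_heatPow (c i) (k i)).comp Complex.continuous_ofReal).mul
      (continuous_gauss (z i))).mul (continuous_e.comp (by fun_prop))).aestronglyMeasurable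

/-- The Gaussian integral in diagonal form. -/
theorem integral_prod_gauss {z : ι → ℂ} (hz : ∀ i, 0 < (z i).im) :
    ∫ v : ι → ℝ, ∏ i, gauss (z i) (v i) = ∏ i, (-Complex.I * z i) ^ (-(1 / 2) : ℂ) := by
  -- The transform at frequency `0`, with constant polynomial and heat time `0`.
  have h := fourierPi_heatGauss 0 hz 1 0
  simpa [fourierPi, heatGauss, heat_one, e, gauss] using h

end HeatGauss

/-! ### Simultaneous diagonalization in the Siegel upper half-space -/

section Diagonalization

open Matrix

theorem toComplex_mul {a b c : ℕ} (P : Matrix (Fin a) (Fin b) ℝ) (Q : Matrix (Fin b) (Fin c) ℝ) :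
    toComplex (P * Q) = toComplex P * toComplex Q :=
  Matrix.map_mul (f := Complex.ofRealHom)

theorem toComplex_transpose {a b : ℕ} (P : Matrix (Fin a) (Fin b) ℝ) :
    toComplex P.transpose = (toComplex P).transpose := rfl

theorem toComplex_one (a : ℕ) : toComplex (1 : Matrix (Fin a) (Fin a) ℝ) = 1 :=
  Matrix.map_one _ Complex.ofReal_zero Complex.ofReal_one

theorem toComplex_diagonal {a : ℕ} (f : Fin a → ℝ) :
    toComplex (diagonal f) = diagonal fun i => (f i : ℂ) :=
  Matrix.diagonal_map Complex.ofReal_zero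

theorem det_toComplex {a : ℕ} (P : Matrix (Fin a) (Fin a) ℝ) :
    (toComplex P).det = (P.det : ℂ) :=
  (RingHom.map_det Complex.ofRealHom P).symm

theorem toComplex_inv_mul {a : ℕ} {P : Matrix (Fin a) (Fin a) ℝ} (hP : P.det ≠ 0) :
    toComplex P⁻¹ * toComplex P = 1 := by
  rw [← toComplex_mul, nonsing_inv_mul _ hP.isUnit, toComplex_one]

theorem toComplex_mul_inv {a : ℕ} {P : Matrix (Fin a) (Fin a) ℝ} (hP : P.det ≠ 0) :
    toComplex P * toComplex P⁻¹ = 1 := by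
  rw [← toComplex_mul, mul_nonsing_inv _ hP.isUnit, toComplex_one]

variable {n : ℕ}

/-- `Z = B diag(d) Bᵀ` with an invertible real matrix `B` and with `Im d = 1`. -/
structure IsDiagonalization (Z : Matrix (Fin n) (Fin n) ℂ) (B : Matrix (Fin n) (Fin n) ℝ)
    (d : Fin n → ℂ) : Prop where
  det_ne_zero : B.det ≠ 0
  im_eq_one : ∀ j, (d j).im = 1
  eq : Z = toComplex B * diagonal d * (toComplex B).transpose

theorem sqrt_mul_sqrt {Y : Matrix (Fin n) (Fin n) ℝ} (hY : Y.PosDef) :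
    CFC.sqrt Y * CFC.sqrt Y = Y :=
  CFC.sqrt_mul_sqrt_self Y hY.posSemidef.nonneg

theorem transpose_sqrt (Y : Matrix (Fin n) (Fin n) ℝ) : (CFC.sqrt Y).transpose = CFC.sqrt Y := by
  have h := (Matrix.nonneg_iff_posSemidef.1 (CFC.sqrt_nonneg Y)).isHermitian
  rwa [IsHermitian, conjTranspose_eq_transpose_of_trivial] at h

theorem det_sqrt_ne_zero {Y : Matrix (Fin n) (Fin n) ℝ} (hY : Y.PosDef) :
    (CFC.sqrt Y).det ≠ 0 := by
  intro h
  have := congrArg Matrix.det (sqrt_mul_sqrt hY)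
  rw [det_mul, h, zero_mul] at this
  exact hY.det_pos.ne this

theorem det_sqrt_nonneg (Y : Matrix (Fin n) (Fin n) ℝ) : 0 ≤ (CFC.sqrt Y).det :=
  (Matrix.nonneg_iff_posSemidef.1 (CFC.sqrt_nonneg Y)).det_nonneg

/-- The real symmetric matrix `Y^{-1/2} X Y^{-1/2}` equals `Q diag(x) Qᵀ` with `Q` orthogonal. Then
`B = Y^{1/2} Q` diagonalizes `X` and `Y` simultaneously, with `d = x + i`. -/
theorem exists_isDiagonalization {Z : Matrix (Fin n) (Fin n) ℂ} (hZ : Z ∈ upperHalfSpace n) :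
    ∃ B d, IsDiagonalization Z B d := by
  obtain ⟨hsymm, hY⟩ := hZ
  set Y := imPart Z with hYdef
  set X : Matrix (Fin n) (Fin n) ℝ := Z.map Complex.re with hX
  set R := CFC.sqrt Y with hR
  have hRdet : R.det ≠ 0 := det_sqrt_ne_zero hY
  have hRR : R * R = Y := sqrt_mul_sqrt hY
  have hRt : R.transpose = R := transpose_sqrt Y
  have hXt : X.transpose = X := by
    rw [hX, ← Matrix.transpose_map, hsymm.eq]
  have hW : (R⁻¹ * X * R⁻¹).IsHermitian := by
    rw [IsHermitian, conjTranspose_eq_transpose_of_trivial, transpose_mul, transpose_mul,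
      transpose_nonsing_inv, hRt, hXt, Matrix.mul_assoc]
  have hspec := hW.spectral_theorem
  rw [Unitary.conjStarAlgAut_apply, star_eq_conjTranspose,
    conjTranspose_eq_transpose_of_trivial] at hspec
  set Q : Matrix (Fin n) (Fin n) ℝ := (hW.eigenvectorUnitary : Matrix (Fin n) (Fin n) ℝ) with hQ
  have hQQ : Q * Q.transpose = 1 := by
    have := (Unitary.mem_iff.1 hW.eigenvectorUnitary.2).2
    rwa [star_eq_conjTranspose, conjTranspose_eq_transpose_of_trivial] at this
  have hQdet : Q.det ≠ 0 := by
    intro h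
    have := congrArg Matrix.det hQQ
    rw [det_mul, h, zero_mul, det_one] at this
    exact zero_ne_one this
  set ev : Fin n → ℝ := RCLike.ofReal ∘ hW.eigenvalues with hev
  have hXeq : X = (R * Q) * diagonal ev * (R * Q).transpose := by
    rw [transpose_mul, hRt]
    calc X = R * (R⁻¹ * X * R⁻¹) * R := by
          rw [Matrix.mul_assoc R⁻¹, mul_nonsing_inv_cancel_left _ _ hRdet.isUnit,
            nonsing_inv_mul_cancel_right _ _ hRdet.isUnit]
      _ = _ := by rw [hspec]; simp only [Matrix.mul_assoc]
  have hYeq : Y = (R * Q) * (R * Q).transpose := by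
    rw [transpose_mul, hRt, Matrix.mul_assoc, ← Matrix.mul_assoc Q, hQQ, Matrix.one_mul, hRR]
  have hZeq : Z = toComplex X + Complex.I • toComplex Y := by
    ext a b
    simp only [toComplex, hX, hYdef, imPart, Matrix.add_apply, Matrix.smul_apply, map_apply,
      smul_eq_mul]
    rw [mul_comm, Complex.re_add_im]
  refine ⟨R * Q, fun j => ev j + Complex.I, by rw [det_mul]; exact mul_ne_zero hRdet hQdet,
    fun j => by simp, ?_⟩
  rw [hZeq, hXeq, hYeq]
  have hd : (diagonal fun j => (ev j : ℂ) + Complex.I) =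
      toComplex (diagonal ev) + Complex.I • (1 : Matrix (Fin n) (Fin n) ℂ) := by
    rw [toComplex_diagonal, smul_one_eq_diagonal, diagonal_add]
  rw [hd]
  simp only [toComplex_mul, toComplex_transpose, Matrix.mul_add, Matrix.add_mul,
    Matrix.mul_smul, Matrix.smul_mul, Matrix.mul_one]

namespace IsDiagonalization

variable {Z : Matrix (Fin n) (Fin n) ℂ} {B : Matrix (Fin n) (Fin n) ℝ} {d : Fin n → ℂ}

theorem apply_eq (h : IsDiagonalization Z B d) (a b : Fin n) :
    Z a b = ∑ j, (B a j : ℂ) * d j * B b j := by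
  rw [h.eq, Matrix.mul_apply]
  simp [mul_diagonal, toComplex]

theorem ne_zero (h : IsDiagonalization Z B d) (j : Fin n) : d j ≠ 0 := by
  intro h0
  have := h.im_eq_one j
  simp [h0] at this

theorem imPart_eq (h : IsDiagonalization Z B d) : imPart Z = B * B.transpose := by
  ext a b
  rw [imPart, map_apply, h.apply_eq, Matrix.mul_apply, Complex.im_sum]
  refine Finset.sum_congr rfl fun j _ => ?_
  simp [Complex.mul_im, h.im_eq_one j]

theorem det_eq (h : IsDiagonalization Z B d) : Z.det = (B.det : ℂ) ^ 2 * ∏ j, d j := by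
  rw [h.eq, det_mul, det_mul, det_transpose, det_toComplex, det_diagonal]
  ring

theorem posDef (h : IsDiagonalization Z B d) : (imPart Z).PosDef := by
  rw [h.imPart_eq]
  have h1 : (1 : Matrix (Fin n) (Fin n) ℝ).PosDef := PosDef.one
  have := h1.mul_mul_conjTranspose_same (B := B) (by
    have hB : IsUnit B := (Matrix.isUnit_iff_isUnit_det B).2 h.det_ne_zero.isUnit
    exact Matrix.vecMul_injective_of_isUnit hB)
  rwa [Matrix.mul_one, conjTranspose_eq_transpose_of_trivial] at this

theorem mem_upperHalfSpace (h : IsDiagonalization Z B d) : Z ∈ upperHalfSpace n := by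
  refine ⟨?_, h.posDef⟩
  rw [Matrix.IsSymm, h.eq, transpose_mul, transpose_mul, transpose_transpose, diagonal_transpose,
    Matrix.mul_assoc]

/-- The diagonalization of `-Z⁻¹` that belongs to one of `Z`. -/
theorem neg_inv (h : IsDiagonalization Z B d) :
    IsDiagonalization (-Z⁻¹) (B⁻¹.transpose * diagonal fun j => ‖d j‖⁻¹)
      fun j => -(starRingEnd ℂ) (d j) := by
  have hd : ∀ j, ‖d j‖ ≠ 0 := fun j => norm_ne_zero_iff.2 (h.ne_zero j)
  refine ⟨?_, fun j => by simp [h.im_eq_one j], ?_⟩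
  · rw [det_mul, det_transpose, det_diagonal, det_nonsing_inv, Ring.inverse_eq_inv']
    exact mul_ne_zero (inv_ne_zero h.det_ne_zero)
      (Finset.prod_ne_zero_iff.2 fun j _ => inv_ne_zero (hd j))
  · have hdiag : (toComplex (diagonal fun j => ‖d j‖⁻¹)) *
        (diagonal fun j => -(starRingEnd ℂ) (d j)) * toComplex (diagonal fun j => ‖d j‖⁻¹) =
        -diagonal fun j => (d j)⁻¹ := by
      rw [toComplex_diagonal, diagonal_mul_diagonal, diagonal_mul_diagonal, diagonal_neg]
      congr 1
      funext j
      have h1 : ((‖d j‖ : ℝ) : ℂ) ≠ 0 := Complex.ofReal_ne_zero.2 (hd j)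
      have h2 := Complex.mul_conj' (d j)
      have h3 := h.ne_zero j
      simp only [Complex.ofReal_inv]
      field_simp
      rw [← h2]
      ring
    rw [toComplex_mul, transpose_mul, ← toComplex_transpose, ← toComplex_transpose,
      diagonal_transpose]
    rw [show ∀ P D E : Matrix (Fin n) (Fin n) ℂ, ∀ P' : Matrix (Fin n) (Fin n) ℂ,
      P * D * E * (D * P') = P * (D * E * D) * P' from fun P D E P' => by
        simp only [Matrix.mul_assoc], hdiag, Matrix.mul_neg, Matrix.neg_mul, transpose_transpose]
    congr 1
    refine inv_eq_right_inv ?_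
    have hB1 : (toComplex B).transpose * toComplex B⁻¹.transpose = 1 := by
      rw [← toComplex_transpose, ← toComplex_mul, ← transpose_mul,
        nonsing_inv_mul _ h.det_ne_zero.isUnit, transpose_one, toComplex_one]
    have hD : diagonal d * diagonal (fun j => (d j)⁻¹) = 1 := by
      rw [diagonal_mul_diagonal, ← diagonal_one]
      congr 1
      funext j
      exact mul_inv_cancel₀ (h.ne_zero j)
    calc Z * (toComplex B⁻¹.transpose * diagonal (fun j => (d j)⁻¹) * toComplex B⁻¹)
        = toComplex B * (diagonal d * ((toComplex B).transpose * toComplex B⁻¹.transpose) *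
            diagonal (fun j => (d j)⁻¹)) * toComplex B⁻¹ := by
          rw [h.eq]; simp only [Matrix.mul_assoc]
      _ = 1 := by rw [hB1, Matrix.mul_one, hD, Matrix.mul_one, toComplex_mul_inv h.det_ne_zero]

end IsDiagonalization

/-! ### Eigenvalues and the Gaussian integral -/

/-- For an eigenvector `v` put `u = Bᵀ v`. As `B` is real, `ζ |v|² = v* Z v = ∑ d_j |u_j|²`, and the
imaginary part of the right-hand side is `|u|² > 0`. -/
theorem charpoly_root_im_pos {Z : Matrix (Fin n) (Fin n) ℂ} (hZ : Z ∈ upperHalfSpace n) {ζ : ℂ}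
    (hζ : ζ ∈ Z.charpoly.roots) : 0 < ζ.im := by
  obtain ⟨B, d, h⟩ := exists_isDiagonalization hZ
  have hroot : (scalar (Fin n) ζ - Z).det = 0 := by
    rw [← eval_charpoly]
    exact (Polynomial.mem_roots'.1 hζ).2
  obtain ⟨v, hv, hv0⟩ := exists_mulVec_eq_zero_iff.2 hroot
  have hev : Z.mulVec v = ζ • v := by
    rw [sub_mulVec, sub_eq_zero] at hv0
    rw [← hv0, scalar_apply, ← smul_one_eq_diagonal, smul_mulVec, one_mulVec]
  set u := (toComplex B).transpose.mulVec v with hu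
  have hu0 : u ≠ 0 := by
    intro h0
    refine hv ?_
    have hdet : (toComplex B).transpose.det ≠ 0 := by
      rw [det_transpose, det_toComplex]
      exact Complex.ofReal_ne_zero.2 h.det_ne_zero
    exact eq_zero_of_mulVec_eq_zero hdet h0
  have h1 : star v ⬝ᵥ Z.mulVec v = star u ⬝ᵥ (diagonal d).mulVec u := by
    have hstar : star u = vecMul (star v) (toComplex B) := by
      rw [hu, star_mulVec]
      congr 1
      ext a b
      simp [toComplex]
    rw [h.eq, ← mulVec_mulVec, ← mulVec_mulVec, dotProduct_mulVec, ← hu, hstar]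
  rw [hev, dotProduct_smul, smul_eq_mul] at h1
  have h2 : ∀ w : Fin n → ℂ, star w ⬝ᵥ w = ((∑ j, ‖w j‖ ^ 2 : ℝ) : ℂ) := by
    intro w
    rw [dotProduct]
    push_cast
    refine Finset.sum_congr rfl fun j _ => ?_
    rw [Pi.star_apply, RCLike.star_def, Complex.conj_mul']
  have h3 : star u ⬝ᵥ (diagonal d).mulVec u = ∑ j, d j * ((‖u j‖ ^ 2 : ℝ) : ℂ) := by
    rw [dotProduct]
    refine Finset.sum_congr rfl fun j _ => ?_
    rw [mulVec_diagonal, Pi.star_apply, RCLike.star_def, mul_left_comm, Complex.conj_mul']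
    push_cast
    ring
  rw [h2, h3] at h1
  have h4 := congrArg Complex.im h1
  rw [Complex.im_mul_ofReal, Complex.im_sum] at h4
  simp only [Complex.im_mul_ofReal, h.im_eq_one, one_mul] at h4
  have hpos : ∀ w : Fin n → ℂ, w ≠ 0 → 0 < ∑ j, ‖w j‖ ^ 2 := by
    intro w hw
    obtain ⟨j, hj⟩ := Function.ne_iff.1 hw
    exact Finset.sum_pos' (fun i _ => by positivity)
      ⟨j, Finset.mem_univ j, by have := norm_pos_iff.2 hj; positivity⟩
  have h5 := hpos u hu0
  rw [← h4] at h5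
  exact (mul_pos_iff_of_pos_right (hpos v hv)).1 h5

theorem exists_roots_charpoly (Z : Matrix (Fin n) (Fin n) ℂ) :
    ∃ ζ : Fin n → ℂ, Z.charpoly.roots = Finset.univ.val.map ζ := by
  have hcard : Z.charpoly.roots.card = n := by
    rw [Polynomial.splits_iff_card_roots.1 (IsAlgClosed.splits _), charpoly_natDegree_eq_dim,
      Fintype.card_fin]
  obtain ⟨l, hl⟩ := Quot.exists_rep Z.charpoly.roots
  change (l : Multiset ℂ) = _ at hl
  rw [← hl] at hcard ⊢
  rw [Multiset.coe_card] at hcard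
  subst hcard
  exact ⟨l.get, by rw [Fin.univ_val_map, List.ofFn_get]⟩

/-- For `b ≠ 0` this is the characteristic polynomial of `Z` at `-a/b`. It gives the determinants
along the segment from `i` to `Z` in terms of the eigenvalues of `Z` alone. -/
theorem det_smul_one_add_smul {Z : Matrix (Fin n) (Fin n) ℂ} {ζ : Fin n → ℂ}
    (hζ : Z.charpoly.roots = Finset.univ.val.map ζ) (a b : ℂ) :
    (a • (1 : Matrix (Fin n) (Fin n) ℂ) + b • Z).det = ∏ k, (a + b * ζ k) := by
  by_cases hb : b = 0
  · subst hb
    simp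
  · have h1 : a • (1 : Matrix (Fin n) (Fin n) ℂ) + b • Z = (-b) • (scalar (Fin n) (-a / b) - Z) := by
      rw [scalar_apply, ← smul_one_eq_diagonal, smul_sub, smul_smul]
      field_simp
      rw [neg_smul, sub_neg_eq_add]
    rw [h1, det_smul, ← eval_charpoly, (IsAlgClosed.splits Z.charpoly).eq_prod_roots,
      (charpoly_monic Z).leadingCoeff, hζ]
    simp only [map_one, one_mul, Multiset.map_map, Polynomial.eval_multiset_prod,
      Function.comp_def, Polynomial.eval_sub, Polynomial.eval_X, Polynomial.eval_C]
    change _ * ∏ k, (-a / b - ζ k) = _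
    rw [Fintype.card_fin, ← Fin.prod_const, ← Finset.prod_mul_distrib]
    refine Finset.prod_congr rfl fun k _ => ?_
    field_simp
    ring

end Diagonalization

/-! ### The Gaussian integral and the branch of the square root of the determinant -/

section GaussianIntegral

open Matrix MeasureTheory

variable {n : ℕ}

/-- The Gaussian integral of `exp(π i vᵀ Z v)`. -/
def gaussInt (Z : Matrix (Fin n) (Fin n) ℂ) : ℂ :=
  ∫ v : Fin n → ℝ, Complex.exp (Real.pi * Complex.I * ∑ a, ∑ b, Z a b * v a * v b)

variable {Z : Matrix (Fin n) (Fin n) ℂ} {B : Matrix (Fin n) (Fin n) ℝ} {d : Fin n → ℂ}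

theorem IsDiagonalization.exp_quadForm (h : IsDiagonalization Z B d) (v : Fin n → ℝ) :
    Complex.exp (Real.pi * Complex.I * ∑ a, ∑ b, Z a b * v a * v b) =
      heatGauss 0 d 1 (B.transpose.mulVec v + 0) := by
  rw [heatGauss, heat_one, one_mul]
  simp only [gauss, ← Complex.exp_sum]
  congr 1
  rw [Finset.mul_sum]
  have h1 : ∀ j, (((B.transpose.mulVec v + 0) j : ℝ) : ℂ) ^ 2 =
      ∑ a, ∑ b, (B a j : ℂ) * v a * (B b j * v b) := by
    intro j
    rw [add_zero, sq, mulVec, dotProduct]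
    push_cast
    rw [Finset.sum_mul_sum]
    rfl
  simp only [h1, h.apply_eq, Finset.mul_sum, Finset.sum_mul]
  rw [Finset.sum_comm (s := (Finset.univ : Finset (Fin n))) (t := Finset.univ)]
  conv_rhs => rw [Finset.sum_comm]
  rw [Finset.sum_comm]
  refine Finset.sum_congr rfl fun a _ => ?_
  rw [Finset.sum_comm]
  refine Finset.sum_congr rfl fun b _ => ?_
  refine Finset.sum_congr rfl fun j _ => ?_
  ring

theorem IsDiagonalization.im_pos (h : IsDiagonalization Z B d) (j : Fin n) : 0 < (d j).im := by
  rw [h.im_eq_one]; exact one_pos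

theorem IsDiagonalization.gaussInt_eq (h : IsDiagonalization Z B d) :
    gaussInt Z = (|B.det|⁻¹ : ℝ) * ∏ j, (-Complex.I * d j) ^ (-(1 / 2) : ℂ) := by
  rw [gaussInt]
  simp only [h.exp_quadForm]
  rw [integral_comp_affine (by rw [det_transpose]; exact h.det_ne_zero), det_transpose,
    ← integral_prod_gauss h.im_pos]
  simp only [heatGauss, heat_one, one_mul]

theorem IsDiagonalization.integrable (h : IsDiagonalization Z B d) :
    Integrable fun v : Fin n → ℝ =>
      Complex.exp (Real.pi * Complex.I * ∑ a, ∑ b, Z a b * v a * v b) := by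
  have hdet : B.transpose.det ≠ 0 := by rw [det_transpose]; exact h.det_ne_zero
  obtain ⟨c, hc⟩ := exists_one_add_norm_le_affine hdet 0
  have hd : HasRapidDecay fun v : Fin n → ℝ =>
      Complex.exp (Real.pi * Complex.I * ∑ a, ∑ b, Z a b * v a * v b) :=
    (hasRapidDecay_heatGauss 0 h.im_pos 1).comp_of_le hc 1 fun v => by
      rw [h.exp_quadForm, one_mul]
  exact hd.hasSqDecay.integrable (by fun_prop)

theorem cpow_neg_half_sq (x : ℂ) : (x ^ (-(1 / 2) : ℂ)) ^ 2 = x⁻¹ := by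
  rw [← Complex.cpow_nat_mul]
  norm_num [Complex.cpow_neg_one]

/-- Squaring removes the choice of square roots, so the diagonalization formula depends only on the
determinant of `Z`. -/
theorem gaussInt_sq (hZ : Z ∈ upperHalfSpace n) :
    gaussInt Z ^ 2 = (((-Complex.I) • Z).det)⁻¹ := by
  obtain ⟨B, d, h⟩ := exists_isDiagonalization hZ
  rw [h.gaussInt_eq, det_smul, h.det_eq, mul_pow, ← Finset.prod_pow]
  simp only [cpow_neg_half_sq]
  rw [Finset.prod_inv_distrib, Finset.prod_mul_distrib, Finset.prod_const, Finset.card_univ,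
    ← Complex.ofReal_pow, inv_pow, sq_abs]
  push_cast
  rw [← mul_inv]
  congr 1
  ring

theorem norm_exp_quadForm (Z : Matrix (Fin n) (Fin n) ℂ) (v : Fin n → ℝ) :
    ‖Complex.exp (Real.pi * Complex.I * ∑ a, ∑ b, Z a b * v a * v b)‖ =
      Real.exp (-(Real.pi * ∑ a, ∑ b, imPart Z a b * v a * v b)) := by
  rw [Complex.norm_exp, mul_assoc, Complex.re_ofReal_mul, Complex.I_mul_re, Complex.im_sum,
    mul_neg]
  congr 3
  refine Finset.sum_congr rfl fun a _ => ?_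
  rw [Complex.im_sum]
  refine Finset.sum_congr rfl fun b _ => ?_
  rw [mul_assoc, ← Complex.ofReal_mul, Complex.im_mul_ofReal, imPart, map_apply]
  ring

/-- The segment from `i` to `Z`. -/
def segmentFromI (Z : Matrix (Fin n) (Fin n) ℂ) (t : ℝ) : Matrix (Fin n) (Fin n) ℂ :=
  ((1 - t) * Complex.I) • (1 : Matrix (Fin n) (Fin n) ℂ) + (t : ℂ) • Z

theorem imPart_segmentFromI (Z : Matrix (Fin n) (Fin n) ℂ) (t : ℝ) :
    imPart (segmentFromI Z t) = (1 - t) • (1 : Matrix (Fin n) (Fin n) ℝ) + t • imPart Z := by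
  ext a b
  simp only [imPart, segmentFromI, map_apply, Matrix.add_apply, Matrix.smul_apply, smul_eq_mul,
    Complex.add_im, Complex.im_ofReal_mul, one_apply]
  split_ifs <;> simp

theorem segmentFromI_mem (hZ : Z ∈ upperHalfSpace n) {t : ℝ} (ht : t ∈ Set.Icc (0 : ℝ) 1) :
    segmentFromI Z t ∈ upperHalfSpace n := by
  refine ⟨?_, ?_⟩
  · have := hZ.1
    rw [Matrix.IsSymm] at this ⊢
    rw [segmentFromI, transpose_add, transpose_smul, transpose_smul, transpose_one, this]
  · rw [imPart_segmentFromI]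
    rcases ht.1.eq_or_lt with h0 | h0
    · subst h0
      simpa using PosDef.one
    · exact PosDef.posSemidef_add (PosSemidef.one.smul (sub_nonneg.2 ht.2)) (hZ.2.smul h0)

/-- The imaginary part of the form is affine in `t`, hence at least the smaller of its two endpoint
values. The resulting bound does not depend on `t` and serves dominated convergence. -/
theorem norm_exp_quadForm_segment_le (Z : Matrix (Fin n) (Fin n) ℂ) {t : ℝ}
    (ht : t ∈ Set.Icc (0 : ℝ) 1) (v : Fin n → ℝ) :
    ‖Complex.exp (Real.pi * Complex.I * ∑ a, ∑ b, segmentFromI Z t a b * v a * v b)‖ ≤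
      ‖Complex.exp (Real.pi * Complex.I * ∑ a, ∑ b, segmentFromI Z 0 a b * v a * v b)‖ +
      ‖Complex.exp (Real.pi * Complex.I * ∑ a, ∑ b, Z a b * v a * v b)‖ := by
  rw [norm_exp_quadForm, norm_exp_quadForm, norm_exp_quadForm]
  have hpq : ∑ a, ∑ b, imPart (segmentFromI Z t) a b * v a * v b =
      (1 - t) * (∑ a, ∑ b, imPart (segmentFromI Z 0) a b * v a * v b) +
        t * ∑ a, ∑ b, imPart Z a b * v a * v b := by
    simp only [imPart_segmentFromI, Finset.mul_sum, ← Finset.sum_add_distrib, Matrix.add_apply,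
      Matrix.smul_apply, smul_eq_mul]
    refine Finset.sum_congr rfl fun a _ => Finset.sum_congr rfl fun b _ => ?_
    ring
  rw [hpq]
  generalize (∑ a, ∑ b, imPart (segmentFromI Z 0) a b * v a * v b) = p
  generalize (∑ a, ∑ b, imPart Z a b * v a * v b) = q
  have hpi := Real.pi_pos
  rcases le_total p q with hle | hle
  · refine le_add_of_le_of_nonneg (Real.exp_le_exp.2 ?_) (Real.exp_pos _).le
    have : p ≤ (1 - t) * p + t * q := by nlinarith [ht.1]
    exact neg_le_neg (mul_le_mul_of_nonneg_left this hpi.le)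
  · refine le_add_of_nonneg_of_le (Real.exp_pos _).le (Real.exp_le_exp.2 ?_)
    have : q ≤ (1 - t) * p + t * q := by nlinarith [ht.2]
    exact neg_le_neg (mul_le_mul_of_nonneg_left this hpi.le)

theorem continuousOn_gaussInt_segment (hZ : Z ∈ upperHalfSpace n) :
    ContinuousOn (fun t => gaussInt (segmentFromI Z t)) (Set.Icc 0 1) := by
  obtain ⟨B, d, h⟩ := exists_isDiagonalization hZ
  obtain ⟨B', d', h'⟩ := exists_isDiagonalization
    (segmentFromI_mem hZ (t := 0) (Set.left_mem_Icc.2 zero_le_one))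
  have hint := h'.integrable.norm.add h.integrable.norm
  unfold gaussInt
  refine continuousOn_of_dominated (fun t _ => ?_)
    (fun t ht => Filter.Eventually.of_forall fun v => norm_exp_quadForm_segment_le Z ht v)
    hint (Filter.Eventually.of_forall fun v => Continuous.continuousOn ?_)
  · exact Continuous.aestronglyMeasurable (by fun_prop)
  · simp only [segmentFromI, Matrix.add_apply, Matrix.smul_apply, smul_eq_mul]
    fun_prop

/-- On the segment from `i` to `Z`, both sides are continuous square roots of `det(-i Z_t)⁻¹`, which
does not vanish. They agree at `t = 0`, hence everywhere. The principal powers are continuous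
because the eigenvalues `(1-t)i + tζ_k` stay in the upper half-plane. -/
theorem gaussInt_eq_prod_roots (hZ : Z ∈ upperHalfSpace n) {ζ : Fin n → ℂ}
    (hζ : Z.charpoly.roots = Finset.univ.val.map ζ) :
    gaussInt Z = ∏ k, (-Complex.I * ζ k) ^ (-(1 / 2) : ℂ) := by
  have him : ∀ k, 0 < (ζ k).im := fun k => charpoly_root_im_pos hZ (by
    rw [hζ]; exact Multiset.mem_map_of_mem ζ (Finset.mem_univ k))
  have hre : ∀ t ∈ Set.Icc (0 : ℝ) 1, ∀ k,
      0 < (-Complex.I * ((1 - t) * Complex.I + t * ζ k)).re := by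
    intro t ht k
    have h1 : (-Complex.I * ((1 - t) * Complex.I + t * ζ k)).re = (1 - t) + t * (ζ k).im := by
      simp
    rw [h1]
    rcases ht.1.eq_or_lt with h0 | h0
    · subst h0; simp
    · have := mul_pos h0 (him k)
      linarith [ht.2]
  have key : Set.EqOn (fun t => gaussInt (segmentFromI Z t))
      (fun t => ∏ k, (-Complex.I * ((1 - t) * Complex.I + t * ζ k)) ^ (-(1 / 2) : ℂ))
      (Set.Icc (0 : ℝ) 1) := by
    refine isPreconnected_Icc.eq_of_sq_eq (continuousOn_gaussInt_segment hZ) ?_ ?_ ?_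
      (y := 0) (Set.left_mem_Icc.2 zero_le_one) ?_
    · refine continuousOn_finsetProd _ fun k _ => ?_
      exact ContinuousOn.cpow (Continuous.continuousOn (by fun_prop)) continuousOn_const
        fun t ht => Or.inl (hre t ht k)
    · intro t ht
      simp only [Pi.pow_apply, ← Finset.prod_pow, cpow_neg_half_sq]
      rw [gaussInt_sq (segmentFromI_mem hZ ht), det_smul, segmentFromI,
        det_smul_one_add_smul hζ, Finset.prod_inv_distrib, Finset.prod_mul_distrib,
        Finset.prod_const, Finset.card_univ]
    · intro t ht
      refine Finset.prod_ne_zero_iff.2 fun k _ h0 => ?_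
      rw [Complex.cpow_eq_zero_iff] at h0
      have := hre t ht k
      rw [h0.1] at this
      simp at this
    -- At `t = 0` the matrix is `i` times the identity, and all factors on both sides are `1`.
    · have hI : IsDiagonalization (segmentFromI Z 0) 1 fun _ => Complex.I := by
        refine ⟨by simp, by simp, ?_⟩
        rw [segmentFromI, toComplex_one, transpose_one, Matrix.one_mul, Matrix.mul_one,
          ← smul_one_eq_diagonal]
        simp
      simp only [hI.gaussInt_eq]
      simp
  have h1 := key (Set.right_mem_Icc.2 zero_le_one)
  simpa [segmentFromI] using h1

end GaussianIntegral

/-! ### The summands of the theta series in diagonal coordinates -/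

section Eigenbasis

open Matrix

variable {m n r s : ℕ} {A : Matrix (Fin m) (Fin m) ℤ} {S : Matrix (Fin m) (Fin m) ℝ}

/-- The signs of the eigenvalues. -/
def eigenSign (m r : ℕ) (i : Fin m) : ℝ := if (i : ℕ) < r then 1 else -1

theorem posBlock_sub_negBlock (m r : ℕ) :
    posBlock m r - negBlock m r = diagonal (eigenSign m r) := by
  rw [posBlock, negBlock, diagonal_sub]
  congr 1
  funext i
  unfold eigenSign
  split_ifs <;> norm_num

theorem posBlock_add_negBlock (m r : ℕ) : posBlock m r + negBlock m r = 1 := by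
  rw [posBlock, negBlock, diagonal_add, ← diagonal_one]
  congr 1
  funext i
  split_ifs <;> norm_num

theorem eigenSign_mul_self (i : Fin m) : eigenSign m r i * eigenSign m r i = 1 := by
  unfold eigenSign
  split_ifs <;> norm_num

namespace IsNormalizedEigenbasis

theorem normalized' (hS : IsNormalizedEigenbasis A r s S) :
    S.transpose * toReal A * S = diagonal (eigenSign m r) := by
  rw [hS.normalized, posBlock_sub_negBlock]

theorem abs_det (hS : IsNormalizedEigenbasis A r s S) :
    S.det ^ 2 * |(toReal A).det| = 1 := by
  have h := congrArg (fun M => |Matrix.det M|) hS.normalized'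
  simp only [det_mul, det_transpose, det_diagonal, abs_mul, Finset.abs_prod] at h
  have h1 : ∀ i, |eigenSign m r i| = 1 := fun i => by
    unfold eigenSign; split_ifs <;> simp
  simp only [h1, Finset.prod_const_one] at h
  rw [← sq_abs, ← h]
  ring

theorem det_ne_zero (hS : IsNormalizedEigenbasis A r s S) : S.det ≠ 0 := by
  intro h
  have := hS.abs_det
  rw [h] at this
  norm_num at this

theorem det_ne_zero' (hS : IsNormalizedEigenbasis A r s S) : (toReal A).det ≠ 0 := by
  intro h
  have := hS.abs_det
  rw [h] at this
  norm_num at this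

theorem transpose_mul_eq (hS : IsNormalizedEigenbasis A r s S) :
    S.transpose * toReal A = diagonal (eigenSign m r) * S⁻¹ := by
  rw [← hS.normalized', mul_nonsing_inv_cancel_right _ _ hS.det_ne_zero.isUnit]

/-- The two blocks add up to the identity, so `M = (S⁻¹)ᵀ S⁻¹`. This is why coordinates with respect
to the eigenbasis turn `tr Δ_M` into the standard Laplacian. -/
theorem majorant_inv (hS : IsNormalizedEigenbasis A r s S) :
    (majorant r S)⁻¹ = S * S.transpose := by
  have h1 : majorant r S = S⁻¹.transpose * S⁻¹ := by
    rw [majorant, posPart, negPart, Matrix.mul_neg, Matrix.neg_mul, sub_neg_eq_add,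
      ← Matrix.add_mul, ← Matrix.mul_add, posBlock_add_negBlock, Matrix.mul_one]
  rw [h1, Matrix.mul_inv_rev, nonsing_inv_nonsing_inv _ hS.det_ne_zero.isUnit, ← transpose_nonsing_inv,
    nonsing_inv_nonsing_inv _ hS.det_ne_zero.isUnit]

end IsNormalizedEigenbasis

/-- A function of two indices as a matrix. -/
def matOf (x : Fin m × Fin n → ℂ) : Matrix (Fin m) (Fin n) ℂ := fun i j => x (i, j)

theorem evalAt_matOf (P : MatPoly m n) (x : Fin m × Fin n → ℂ) :
    evalAt P (matOf x) = MvPolynomial.eval x P := rfl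

/-- The matrix of the linear map `x ↦ S x O`. -/
def sandwich (S : Matrix (Fin m) (Fin m) ℝ) (O : Matrix (Fin n) (Fin n) ℝ) :
    Matrix (Fin m × Fin n) (Fin m × Fin n) ℝ :=
  fun p q => S p.1 q.1 * O q.2 p.2

theorem sandwich_eq_kronecker (S : Matrix (Fin m) (Fin m) ℝ) (O : Matrix (Fin n) (Fin n) ℝ) :
    sandwich S O = kroneckerMap (· * ·) S O.transpose := rfl

theorem det_sandwich (S : Matrix (Fin m) (Fin m) ℝ) (O : Matrix (Fin n) (Fin n) ℝ) :
    (sandwich S O).det = S.det ^ n * O.det ^ m := by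
  rw [sandwich_eq_kronecker, det_kronecker, det_transpose, Fintype.card_fin, Fintype.card_fin]

theorem sandwich_mulVec (S : Matrix (Fin m) (Fin m) ℝ) (O : Matrix (Fin n) (Fin n) ℝ)
    (V : Matrix (Fin m) (Fin n) ℝ) :
    (sandwich S O).mulVec (fun p => V p.1 p.2) = fun p => (S * V * O) p.1 p.2 := by
  funext p
  simp only [mulVec, dotProduct, sandwich, Fintype.sum_prod_type, Matrix.mul_apply, Finset.sum_mul]
  rw [Finset.sum_comm]
  refine Finset.sum_congr rfl fun l _ => Finset.sum_congr rfl fun k _ => ?_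
  ring

theorem sandwich_mul_sandwich (S S' : Matrix (Fin m) (Fin m) ℝ) (O O' : Matrix (Fin n) (Fin n) ℝ) :
    sandwich S O * sandwich S' O' = sandwich (S * S') (O' * O) := by
  rw [sandwich_eq_kronecker, sandwich_eq_kronecker, sandwich_eq_kronecker, transpose_mul]
  exact (mul_kronecker_mul S S' O.transpose O'.transpose).symm

theorem sandwich_transpose (S : Matrix (Fin m) (Fin m) ℝ) (O : Matrix (Fin n) (Fin n) ℝ) :
    (sandwich S O).transpose = sandwich S.transpose O.transpose := rfl

theorem sandwich_map_mulVec (S : Matrix (Fin m) (Fin m) ℝ) (O : Matrix (Fin n) (Fin n) ℝ)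
    (x : Fin m × Fin n → ℂ) :
    matOf (((sandwich S O).map Complex.ofReal).mulVec x) =
      toComplex S * matOf x * toComplex O := by
  ext i j
  simp only [matOf, mulVec, dotProduct, sandwich, Fintype.sum_prod_type, Matrix.mul_apply,
    Finset.sum_mul, map_apply, toComplex]
  rw [Finset.sum_comm]
  refine Finset.sum_congr rfl fun l _ => Finset.sum_congr rfl fun k _ => ?_
  push_cast
  ring

/-- The polynomial `P_α(U⁺) P_β(U⁻)` in coordinates with respect to the eigenbasis. -/
def eigenPoly (r : ℕ) (S : Matrix (Fin m) (Fin m) ℝ) (Pα Pβ : MatPoly m n) : MatPoly m n :=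
  compLeft (S * posBlock m r) Pα * compLeft (S * negBlock m r) Pβ

theorem evalAt_mul (P Q : MatPoly m n) (U : Matrix (Fin m) (Fin n) ℂ) :
    evalAt (P * Q) U = evalAt P U * evalAt Q U := map_mul _ P Q

theorem evalAt_eigenPoly (r : ℕ) (S : Matrix (Fin m) (Fin m) ℝ) (Pα Pβ : MatPoly m n)
    (U : Matrix (Fin m) (Fin n) ℂ) :
    evalAt (eigenPoly r S Pα Pβ) U =
      evalAt Pα (toComplex (S * posBlock m r) * U) *
        evalAt Pβ (toComplex (S * negBlock m r) * U) := by
  rw [eigenPoly, evalAt_mul, evalAt_compLeft, evalAt_compLeft]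

variable {α β : ℕ} {Pα Pβ : MatPoly m n}

/-- The projections act from the left and `O` from the right, so `O` only contributes its
determinant, to the power `α` from one factor and `β` from the other. -/
theorem linSubst_sandwich (hS : S.det ≠ 0) (hPα : IsDetHomogeneous α Pα)
    (hPβ : IsDetHomogeneous β Pβ) (O : Matrix (Fin n) (Fin n) ℝ) :
    linSubst ((sandwich S O).map Complex.ofReal)
        (compLeft (posProj r S) Pα * compLeft (negProj r S) Pβ) =
      MvPolynomial.C ((O.det : ℂ) ^ (α + β)) * eigenPoly r S Pα Pβ := by
  refine MvPolynomial.funext fun x => ?_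
  rw [eval_linSubst, ← evalAt_matOf, sandwich_map_mulVec, map_mul, MvPolynomial.eval_C,
    ← evalAt_matOf, evalAt_eigenPoly, evalAt_mul, evalAt_compLeft, evalAt_compLeft]
  have h : ∀ D : Matrix (Fin m) (Fin m) ℝ, toComplex (S * D * S⁻¹) *
      (toComplex S * matOf x * toComplex O) = toComplex (S * D) * matOf x * toComplex O := by
    intro D
    rw [← Matrix.mul_assoc, ← Matrix.mul_assoc, ← toComplex_mul,
      nonsing_inv_mul_cancel_right _ _ hS.isUnit]
  rw [posProj, negProj, h, h, hPα, hPβ, det_toComplex]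
  ring

/-- The heat flow of the polynomial of the theta series in diagonal coordinates. -/
theorem evalAt_expLaplacian_sandwich (hS : IsNormalizedEigenbasis A r s S)
    (hPα : IsDetHomogeneous α Pα) (hPβ : IsDetHomogeneous β Pβ)
    {O : Matrix (Fin n) (Fin n) ℝ} (hO : O.transpose * O = 1) (c : ℂ)
    (V : Matrix (Fin m) (Fin n) ℝ) :
    evalAt (expLaplacian c (majorant r S)
        (compLeft (posProj r S) Pα * compLeft (negProj r S) Pβ)) (toComplex (S * V * O)) =
      (O.det : ℂ) ^ (α + β) *
        heat (fun _ => c) (fun p => (V p.1 p.2 : ℂ)) (eigenPoly r S Pα Pβ) := by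
  have hT : ∀ p q : Fin m × Fin n, ((sandwich S O).map Complex.ofReal *
      ((sandwich S O).map Complex.ofReal).transpose) p q =
        if p.2 = q.2 then (((majorant r S)⁻¹ p.1 q.1 : ℝ) : ℂ) else 0 := by
    intro p q
    have h1 : (sandwich S O).map Complex.ofReal * ((sandwich S O).map Complex.ofReal).transpose =
        (sandwich S O * (sandwich S O).transpose).map Complex.ofReal := by
      rw [← transpose_map]
      exact (Matrix.map_mul (f := Complex.ofRealHom)).symm
    rw [h1, sandwich_transpose, sandwich_mul_sandwich, hO, hS.majorant_inv, map_apply, sandwich,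
      one_apply]
    by_cases h : p.2 = q.2
    · rw [if_pos h, if_pos h.symm, mul_one]
    · rw [if_neg h, if_neg (Ne.symm h), mul_zero, Complex.ofReal_zero]
  have h2 : toComplex (S * V * O) =
      matOf (((sandwich S O).map Complex.ofReal).mulVec fun p => (V p.1 p.2 : ℂ)) := by
    rw [sandwich_map_mulVec, toComplex_mul, toComplex_mul]
    rfl
  rw [h2, evalAt_matOf, eval_expLaplacian hT, linSubst_sandwich hS.det_ne_zero hPα hPβ,
    ← MvPolynomial.smul_eq_C_mul, map_smul, smul_eq_mul]

/-- The parameters of the Gaussian in diagonal coordinates. -/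
def signedDiag (m r : ℕ) (d : Fin n → ℂ) (p : Fin m × Fin n) : ℂ :=
  if (p.1 : ℕ) < r then d p.2 else -(starRingEnd ℂ) (d p.2)

theorem signedDiag_im_pos {d : Fin n → ℂ} (hd : ∀ j, (d j).im = 1) (p : Fin m × Fin n) :
    0 < (signedDiag m r d p).im := by
  unfold signedDiag
  split_ifs <;> simp [hd]

theorem trace_transpose_diagonal_mul {R : Type*} [CommRing R] (V : Matrix (Fin m) (Fin n) R)
    (u : Fin m → R) (d : Fin n → R) : (V.transpose * diagonal u * V * diagonal d).trace =
      ∑ p : Fin m × Fin n, u p.1 * d p.2 * V p.1 p.2 ^ 2 := by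
  rw [Fintype.sum_prod_type, Finset.sum_comm]
  simp only [trace, diag_apply, mul_diagonal]
  refine Finset.sum_congr rfl fun j _ => ?_
  rw [Matrix.mul_apply, Finset.sum_mul]
  refine Finset.sum_congr rfl fun i _ => ?_
  rw [mul_diagonal, transpose_apply]
  ring

variable {Z : Matrix (Fin n) (Fin n) ℂ} {B : Matrix (Fin n) (Fin n) ℝ} {d : Fin n → ℂ}

/-- The orthogonal matrix `B⁻¹ Y^{1/2}`. -/
theorem IsDiagonalization.orthogonal (h : IsDiagonalization Z B d) :
    (B⁻¹ * CFC.sqrt (imPart Z)) * (B⁻¹ * CFC.sqrt (imPart Z)).transpose = 1 := by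
  have hB : IsUnit B.transpose.det := by rw [det_transpose]; exact h.det_ne_zero.isUnit
  rw [transpose_mul, transpose_sqrt, Matrix.mul_assoc, ← Matrix.mul_assoc (CFC.sqrt _),
    sqrt_mul_sqrt h.posDef, h.imPart_eq, ← Matrix.mul_assoc, ← Matrix.mul_assoc,
    nonsing_inv_mul _ h.det_ne_zero.isUnit, Matrix.one_mul, transpose_nonsing_inv,
    mul_nonsing_inv _ hB]

/-- From `B Bᵀ = Y` one has `det Y^{1/2} = |det B|`; the result is the sign of `det B`. -/
theorem IsDiagonalization.det_orthogonal (h : IsDiagonalization Z B d) :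
    (B⁻¹ * CFC.sqrt (imPart Z)).det = |B.det| / B.det := by
  have h1 : (CFC.sqrt (imPart Z)).det = |B.det| := by
    have h2 := congrArg Matrix.det (sqrt_mul_sqrt h.posDef)
    rw [h.imPart_eq, det_mul, det_mul, det_transpose, ← h.imPart_eq] at h2
    rw [← abs_of_nonneg (det_sqrt_nonneg (imPart Z))]
    exact abs_eq_abs.2 (mul_self_eq_mul_self_iff.1 h2)
  rw [det_mul, h1, det_nonsing_inv, Ring.inverse_eq_inv']
  ring

/-- With `V = S⁻¹ U B` and `O = B⁻¹ Y^{1/2}` orthogonal, `U Y^{1/2} = S V O`. The traces of both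
quadratic forms become diagonal in `V`, and `O` disappears except for the sign of its determinant.
-/
theorem thetaTerm_eq (hS : IsNormalizedEigenbasis A r s S)
    (hPα : IsDetHomogeneous α Pα) (hPβ : IsDetHomogeneous β Pβ)
    (h : IsDiagonalization Z B d) (K U : Matrix (Fin m) (Fin n) ℝ) :
    thetaTerm A (coeffFun r S Pα Pβ) K Z U =
      ((|B.det| / B.det : ℝ) : ℂ) ^ (α + β) *
        heatGauss (fun _ => -1 / (8 * Real.pi)) (signedDiag m r d) (eigenPoly r S Pα Pβ)
          (fun p => (S⁻¹ * U * B) p.1 p.2) *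
        e ((K.transpose * toReal A * U).trace : ℂ) := by
  set V := S⁻¹ * U * B with hV
  set O := B⁻¹ * CFC.sqrt (imPart Z) with hO
  have hOO : O * O.transpose = 1 := h.orthogonal
  have hOO' : O.transpose * O = 1 := mul_eq_one_comm.1 hOO
  have hU : U = S * V * B⁻¹ := by
    rw [hV, ← Matrix.mul_assoc, ← Matrix.mul_assoc, mul_nonsing_inv _ hS.det_ne_zero.isUnit,
      Matrix.one_mul, mul_nonsing_inv_cancel_right _ _ h.det_ne_zero.isUnit]
  have hUR : U * CFC.sqrt (imPart Z) = S * V * O := by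
    rw [hO, ← Matrix.mul_assoc, ← hU]
  have hOdet : O.det = |B.det| / B.det := h.det_orthogonal
  clear_value O
  have htr1 : ((U * CFC.sqrt (imPart Z)).transpose * negPart r S * (U * CFC.sqrt (imPart Z))).trace
      = -∑ p : Fin m × Fin n, if (p.1 : ℕ) < r then 0 else V p.1 p.2 ^ 2 := by
    have h1 : (S * V * O).transpose * negPart r S * (S * V * O) =
        -(O.transpose * (V.transpose * negBlock m r * V) * O) := by
      rw [negPart, transpose_mul, transpose_mul, Matrix.mul_neg, Matrix.neg_mul, Matrix.mul_neg,
        Matrix.neg_mul]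
      congr 1
      have h2 : S.transpose * S⁻¹.transpose = 1 := by
        rw [← transpose_mul, nonsing_inv_mul _ hS.det_ne_zero.isUnit, transpose_one]
      have h3 : S⁻¹ * S = 1 := nonsing_inv_mul _ hS.det_ne_zero.isUnit
      calc O.transpose * (V.transpose * S.transpose) *
            (S⁻¹.transpose * negBlock m r * S⁻¹) * (S * V * O)
          = O.transpose * V.transpose * (S.transpose * S⁻¹.transpose) * negBlock m r *
              (S⁻¹ * S) * V * O := by simp only [Matrix.mul_assoc]
        _ = _ := by rw [h2, h3]; simp only [Matrix.mul_assoc, Matrix.mul_one]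
    rw [hUR, h1, trace_neg, trace_mul_comm, ← Matrix.mul_assoc, hOO, Matrix.one_mul]
    congr 1
    rw [← Matrix.mul_one (V.transpose * negBlock m r * V), ← diagonal_one, negBlock,
      trace_transpose_diagonal_mul]
    refine Finset.sum_congr rfl fun p _ => ?_
    split_ifs <;> ring
  have htr2 : (toComplex (U.transpose * toReal A * U) * Z).trace =
      ∑ p : Fin m × Fin n, (eigenSign m r p.1 : ℂ) * d p.2 * (V p.1 p.2 : ℂ) ^ 2 := by
    have h1 : U.transpose * toReal A * U =
        B⁻¹.transpose * (V.transpose * diagonal (eigenSign m r) * V) * B⁻¹ := by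
      rw [← hS.normalized', hU, transpose_mul, transpose_mul]
      simp only [Matrix.mul_assoc]
    have h2 : toComplex B⁻¹ * toComplex B = 1 := toComplex_inv_mul h.det_ne_zero
    have h3 : (toComplex B).transpose * toComplex B⁻¹.transpose = 1 := by
      rw [← toComplex_transpose, ← toComplex_mul, ← transpose_mul,
        nonsing_inv_mul _ h.det_ne_zero.isUnit, transpose_one, toComplex_one]
    rw [h1, h.eq, toComplex_mul, toComplex_mul]
    set W := toComplex (V.transpose * diagonal (eigenSign m r) * V) with hW
    have h4 : toComplex B⁻¹.transpose * W * toComplex B⁻¹ *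
        (toComplex B * diagonal d * (toComplex B).transpose) =
        toComplex B⁻¹.transpose * (W * diagonal d * (toComplex B).transpose) := by
      calc _ = toComplex B⁻¹.transpose * W * (toComplex B⁻¹ * toComplex B) * diagonal d *
            (toComplex B).transpose := by simp only [Matrix.mul_assoc]
        _ = _ := by rw [h2]; simp only [Matrix.mul_assoc, Matrix.one_mul]
    rw [h4, trace_mul_comm, Matrix.mul_assoc, h3, Matrix.mul_one, hW, toComplex_mul,
      toComplex_mul, toComplex_transpose, toComplex_diagonal, trace_transpose_diagonal_mul]
    rfl
  rw [thetaTerm, coeffFun, htr1, htr2, hUR, evalAt_expLaplacian_sandwich hS hPα hPβ hOO',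
    hOdet, e_add, heatGauss]
  have hexp : ((Real.exp (2 * Real.pi * -∑ p : Fin m × Fin n,
        if (p.1 : ℕ) < r then 0 else V p.1 p.2 ^ 2) : ℝ) : ℂ) *
      e ((∑ p : Fin m × Fin n, (eigenSign m r p.1 : ℂ) * d p.2 * (V p.1 p.2 : ℂ) ^ 2) / 2) =
      ∏ p : Fin m × Fin n, gauss (signedDiag m r d p) (V p.1 p.2) := by
    simp only [gauss, ← Complex.exp_sum]
    rw [Complex.ofReal_exp, e, ← Complex.exp_add]
    congr 1
    push_cast
    rw [← Finset.sum_neg_distrib, Finset.mul_sum, Finset.sum_div, Finset.mul_sum,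
      ← Finset.sum_add_distrib]
    refine Finset.sum_congr rfl fun p _ => ?_
    unfold signedDiag eigenSign
    split_ifs with hp
    · push_cast
      ring
    -- In a negative row the two exponents add up to `πi(-d + 2i)v²`. As `Im d = 1`, the parameter
    -- is `-conj d`.
    · have hconj : (starRingEnd ℂ) (d p.2) = d p.2 - 2 * Complex.I := by
        apply Complex.ext <;> simp [h.im_eq_one]
        norm_num
      rw [hconj]
      push_cast
      linear_combination (-2 * Real.pi * (V p.1 p.2 : ℂ) ^ 2) * Complex.I_sq
  rw [← hexp]
  ring

end Eigenbasis

/-! ### The Fourier transform of the summands -/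

section Transform

open Matrix

variable {m n r s : ℕ} {A : Matrix (Fin m) (Fin m) ℤ} {S : Matrix (Fin m) (Fin m) ℝ}
variable {α β : ℕ} {Pα Pβ : MatPoly m n}

/-- The factor of `x` by which the center of the transformed Gaussian is scaled. -/
def centerScale (m r : ℕ) (d : Fin n → ℂ) (p : Fin m × Fin n) : ℂ :=
  if (p.1 : ℕ) < r then ‖d p.2‖ / d p.2 else ‖d p.2‖ / (starRingEnd ℂ) (d p.2)

/-- Each block annihilates the rows of the other sign. On the surviving rows the scaling depends on
the column only, so it is right multiplication by a diagonal matrix, to which determinant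
homogeneity applies. -/
theorem bind₁_centerScale (hPα : IsDetHomogeneous α Pα) (hPβ : IsDetHomogeneous β Pβ)
    (d : Fin n → ℂ) :
    MvPolynomial.bind₁ (fun p => MvPolynomial.C (centerScale m r d p) * MvPolynomial.X p)
        (eigenPoly r S Pα Pβ) =
      MvPolynomial.C ((∏ j, ‖d j‖ / d j) ^ α * (∏ j, ‖d j‖ / (starRingEnd ℂ) (d j)) ^ β) *
        eigenPoly r S Pα Pβ := by
  refine MvPolynomial.funext fun x => ?_
  have h1 : MvPolynomial.eval x (MvPolynomial.bind₁
      (fun p => MvPolynomial.C (centerScale m r d p) * MvPolynomial.X p)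
        (eigenPoly r S Pα Pβ)) =
      evalAt (eigenPoly r S Pα Pβ) (matOf fun p => centerScale m r d p * x p) := by
    rw [evalAt_matOf, ← MvPolynomial.coe_aeval_eq_eval, ← MvPolynomial.coe_aeval_eq_eval,
      RingHom.coe_coe, RingHom.coe_coe, MvPolynomial.aeval_bind₁]
    congr 2
    funext p
    simp
  have hpos : toComplex (posBlock m r) * matOf (fun p => centerScale m r d p * x p) =
      toComplex (posBlock m r) * matOf x * diagonal fun j => (‖d j‖ : ℂ) / d j := by
    rw [posBlock, toComplex_diagonal]
    ext i j
    rw [mul_diagonal, diagonal_mul, diagonal_mul]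
    simp only [matOf, centerScale]
    split_ifs <;> push_cast <;> ring
  have hneg : toComplex (negBlock m r) * matOf (fun p => centerScale m r d p * x p) =
      toComplex (negBlock m r) * matOf x *
        diagonal fun j => (‖d j‖ : ℂ) / (starRingEnd ℂ) (d j) := by
    rw [negBlock, toComplex_diagonal]
    ext i j
    rw [mul_diagonal, diagonal_mul, diagonal_mul]
    simp only [matOf, centerScale]
    split_ifs <;> push_cast <;> ring
  rw [h1, map_mul, MvPolynomial.eval_C, ← evalAt_matOf, evalAt_eigenPoly, evalAt_eigenPoly,
    toComplex_mul, toComplex_mul, Matrix.mul_assoc, Matrix.mul_assoc, hpos, hneg,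
    ← Matrix.mul_assoc, ← Matrix.mul_assoc (toComplex S) (_ * _), hPα, hPβ, det_diagonal,
    det_diagonal, Matrix.mul_assoc, Matrix.mul_assoc]
  ring

/-- The constant in the Fourier transform of the summands. -/
def fourierConst (m r α β : ℕ) (d : Fin n → ℂ) : ℂ :=
  (∏ p : Fin m × Fin n, (-Complex.I * signedDiag m r d p) ^ (-(1 / 2) : ℂ)) *
    ((∏ j, ‖d j‖ / d j) ^ α * (∏ j, ‖d j‖ / (starRingEnd ℂ) (d j)) ^ β)

/-- The frequency is scaled by `|d|` to undo the change of heat time, and carries the sign of the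
row so that the quotient by `signedDiag` has the same form in all rows. -/
theorem fourierPi_heatGauss_eigenPoly (hPα : IsDetHomogeneous α Pα)
    (hPβ : IsDetHomogeneous β Pβ) {d : Fin n → ℂ} (hd : ∀ j, (d j).im = 1)
    (x : Fin m × Fin n → ℝ) :
    fourierPi (heatGauss (fun _ => -1 / (8 * Real.pi)) (signedDiag m r d) (eigenPoly r S Pα Pβ))
        (fun p => eigenSign m r p.1 * ‖d p.2‖ * x p) =
      fourierConst m r α β d *
        heatGauss (fun _ => -1 / (8 * Real.pi)) (signedDiag m r fun j => -(starRingEnd ℂ) (d j))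
          (eigenPoly r S Pα Pβ) x := by
  have hd0 : ∀ j, d j ≠ 0 := fun j h0 => by
    have := hd j
    simp [h0] at this
  have hc0 : ∀ j, (starRingEnd ℂ) (d j) ≠ 0 := fun j => (map_ne_zero _).2 (hd0 j)
  have hconj : ∀ j, (starRingEnd ℂ) (d j) = d j - 2 * Complex.I := fun j => by
    apply Complex.ext <;> simp [hd]
    norm_num
  have hnorm : ∀ j, (‖d j‖ : ℂ) ^ 2 = d j * (starRingEnd ℂ) (d j) := fun j =>
    (Complex.mul_conj' (d j)).symm
  have hpi : (Real.pi : ℂ) ≠ 0 := Complex.ofReal_ne_zero.2 Real.pi_ne_zero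
  rw [fourierPi_heatGauss _ (signedDiag_im_pos hd)]
  -- Here `-1/(8π)` and `Im d = 1` are decisive: `-1/(8π) + i/(4πd) = -conj d/(8πd)`, which is
  -- `-1/(8π)` times `(|d|/d)²`. The negative rows are the same with `d` and `conj d` exchanged.
  have hcoef : (fun p : Fin m × Fin n =>
      (-1 / (8 * Real.pi) : ℂ) + Complex.I / (4 * Real.pi * signedDiag m r d p)) =
      fun p => centerScale m r d p ^ 2 * (-1 / (8 * Real.pi) : ℂ) := by
    funext p
    unfold signedDiag centerScale
    have h1 := hd0 p.2
    have h2 := hc0 p.2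
    split_ifs
    · rw [div_pow, hnorm]
      field_simp
      rw [hconj]
      ring
    · rw [div_pow, hnorm]
      field_simp
      rw [hconj]
      ring
  have hpt : (fun p : Fin m × Fin n =>
      ((eigenSign m r p.1 * ‖d p.2‖ * x p : ℝ) : ℂ) / signedDiag m r d p) =
      fun p => centerScale m r d p * (x p : ℂ) := by
    funext p
    unfold signedDiag centerScale eigenSign
    have h1 := hd0 p.2
    have h2 := hc0 p.2
    split_ifs
    · push_cast
      field_simp
    · push_cast
      field_simp
  have hgauss : ∀ p : Fin m × Fin n,
      gauss (-(signedDiag m r d p)⁻¹) (eigenSign m r p.1 * ‖d p.2‖ * x p) =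
        gauss (signedDiag m r (fun j => -(starRingEnd ℂ) (d j)) p) (x p) := by
    intro p
    unfold gauss
    congr 1
    have h1 := hd0 p.2
    have h2 := hc0 p.2
    have h3 := hnorm p.2
    unfold signedDiag eigenSign
    split_ifs
    · push_cast
      field_simp
      rw [h3]
      ring
    · push_cast
      rw [map_neg, Complex.conj_conj]
      field_simp
      rw [h3]
      ring
  rw [hcoef, hpt, heat_scale, bind₁_centerScale hPα hPβ, ← MvPolynomial.smul_eq_C_mul, map_smul,
    smul_eq_mul, fourierConst, heatGauss]
  simp only [hgauss]
  ring

theorem hasRapidDecay_fourierPi_eigenPoly (hPα : IsDetHomogeneous α Pα)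
    (hPβ : IsDetHomogeneous β Pβ) {d : Fin n → ℂ} (hd : ∀ j, (d j).im = 1) :
    HasRapidDecay (fourierPi (heatGauss (fun _ => -1 / (8 * Real.pi)) (signedDiag m r d)
      (eigenPoly r S Pα Pβ))) := by
  have hd0 : ∀ j, ‖d j‖ ≠ 0 := fun j h0 => by
    have := hd j
    simp [norm_eq_zero.1 h0] at this
  have he0 : ∀ i, eigenSign m r i ≠ 0 := fun i h => by
    have := eigenSign_mul_self (r := r) i
    simp [h] at this
  set D : Matrix (Fin m × Fin n) (Fin m × Fin n) ℝ :=
    diagonal fun p => (eigenSign m r p.1 * ‖d p.2‖)⁻¹ with hD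
  have hdet : D.det ≠ 0 := by
    rw [hD, det_diagonal]
    exact Finset.prod_ne_zero_iff.2 fun p _ => inv_ne_zero (mul_ne_zero (he0 _) (hd0 _))
  obtain ⟨c, hc⟩ := exists_one_add_norm_le_affine hdet 0
  refine (hasRapidDecay_heatGauss (fun _ => -1 / (8 * Real.pi))
    (z := signedDiag m r fun j => -(starRingEnd ℂ) (d j))
    (signedDiag_im_pos fun j => by simp [hd]) (eigenPoly r S Pα Pβ)).comp_of_le hc
    ‖fourierConst m r α β d‖ fun w => ?_
  rw [← norm_mul, ← fourierPi_heatGauss_eigenPoly hPα hPβ hd]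
  refine le_of_eq (congrArg (fun w => ‖fourierPi _ w‖) (funext fun p => ?_))
  rw [add_zero, hD, mulVec_diagonal, mul_inv_cancel_left₀ (mul_ne_zero (he0 _) (hd0 _))]

variable {Z : Matrix (Fin n) (Fin n) ℂ} {B : Matrix (Fin n) (Fin n) ℝ} {d : Fin n → ℂ}

/-- Integer matrices as functions of two indices. -/
def matEquiv (m n : ℕ) : (Fin m × Fin n → ℤ) ≃ Matrix (Fin m) (Fin n) ℤ :=
  Equiv.curry (Fin m) (Fin n) ℤ

theorem toReal_matEquiv (R : Fin m × Fin n → ℤ) (p : Fin m × Fin n) :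
    toReal (matEquiv m n R) p.1 p.2 = R p := rfl

/-- The matrix `L` allows for both lattices that occur: `L = 1` for the theta series itself and `L =
A⁻¹` for the dual lattice. -/
theorem summable_thetaTerm (hS : IsNormalizedEigenbasis A r s S)
    (hPα : IsDetHomogeneous α Pα) (hPβ : IsDetHomogeneous β Pβ)
    (hZ : Z ∈ upperHalfSpace n) {L : Matrix (Fin m) (Fin m) ℝ} (hL : L.det ≠ 0)
    (H K : Matrix (Fin m) (Fin n) ℝ) :
    Summable fun R : Matrix (Fin m) (Fin n) ℤ =>
      thetaTerm A (coeffFun r S Pα Pβ) K Z (H + L * toReal R) := by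
  obtain ⟨B, d, h⟩ := exists_isDiagonalization hZ
  have hdet : (sandwich (S⁻¹ * L) B).det ≠ 0 := by
    rw [det_sandwich, det_mul, det_nonsing_inv, Ring.inverse_eq_inv']
    exact mul_ne_zero (pow_ne_zero _ (mul_ne_zero (inv_ne_zero hS.det_ne_zero) hL))
      (pow_ne_zero _ h.det_ne_zero)
  obtain ⟨c, hc⟩ := exists_one_add_norm_le_affine hdet fun p => (S⁻¹ * H * B) p.1 p.2
  have hdecay : HasRapidDecay fun x : Fin m × Fin n → ℝ =>
      heatGauss (fun _ => -1 / (8 * Real.pi)) (signedDiag m r d) (eigenPoly r S Pα Pβ)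
        ((sandwich (S⁻¹ * L) B).mulVec x + fun p => (S⁻¹ * H * B) p.1 p.2) :=
    (hasRapidDecay_heatGauss _ (signedDiag_im_pos h.im_eq_one) _).comp_of_le hc 1
      fun x => (one_mul _).ge
  have hs := hdecay.hasSqDecay.summable_translate 0
  rw [← (matEquiv m n).summable_iff]
  refine Summable.of_norm_bounded (hs.norm.mul_left ‖((|B.det| / B.det : ℝ) : ℂ) ^ (α + β)‖)
    fun R => ?_
  rw [Function.comp_apply, thetaTerm_eq hS hPα hPβ h, norm_mul, norm_mul, norm_e_ofReal, mul_one]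
  refine le_of_eq (congrArg (fun x => _ * ‖heatGauss _ _ _ x‖) ?_)
  have h1 : (fun i => (0 : Fin m × Fin n → ℝ) i + (R i : ℝ)) =
      fun p : Fin m × Fin n => toReal (matEquiv m n R) p.1 p.2 := by
    funext p
    rw [toReal_matEquiv, Pi.zero_apply, zero_add]
  rw [h1, sandwich_mulVec]
  funext p
  rw [Matrix.mul_add, Matrix.add_mul, Matrix.add_apply, add_comm, Pi.add_apply, Matrix.mul_assoc S⁻¹ L]

theorem sum_mul_eq_trace (V W : Matrix (Fin m) (Fin n) ℝ) :
    ∑ p : Fin m × Fin n, V p.1 p.2 * W p.1 p.2 = (V.transpose * W).trace := by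
  rw [Fintype.sum_prod_type, Finset.sum_comm]
  simp only [trace, diag_apply, Matrix.mul_apply, transpose_apply]

/-- The chosen matrices for `Z` and `-Z⁻¹` have determinants of the same sign, so the factors `(|det
B|/det B)^(α+β)` on the two sides of the transformation cancel. -/
theorem abs_det_div_det_neg_inv (h : IsDiagonalization Z B d) :
    |(B⁻¹.transpose * diagonal fun j => ‖d j‖⁻¹).det| /
      (B⁻¹.transpose * diagonal fun j => ‖d j‖⁻¹).det = |B.det| / B.det := by
  have h1 : 0 < ∏ j, ‖d j‖⁻¹ :=
    Finset.prod_pos fun j _ => inv_pos.2 (norm_pos_iff.2 (h.ne_zero j))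
  rw [det_mul, det_transpose, det_diagonal, det_nonsing_inv, Ring.inverse_eq_inv', abs_mul,
    abs_of_pos h1, mul_div_mul_right _ _ h1.ne', abs_inv]
  rcases abs_cases B.det with ⟨h2, -⟩ | ⟨h2, -⟩ <;> rw [h2]
  · rw [div_self (inv_ne_zero h.det_ne_zero), div_self h.det_ne_zero]
  · rw [inv_neg, neg_div, neg_div, div_self (inv_ne_zero h.det_ne_zero), div_self h.det_ne_zero]

/-- The transformation of the sum over a translate of the dual lattice. -/
theorem tsum_thetaTerm_dual (hA : A.IsSymm) (hS : IsNormalizedEigenbasis A r s S)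
    (hPα : IsDetHomogeneous α Pα) (hPβ : IsDetHomogeneous β Pβ)
    (h : IsDiagonalization Z B d) (H K : Matrix (Fin m) (Fin n) ℝ) :
    ∑' R : Matrix (Fin m) (Fin n) ℤ,
        thetaTerm A (coeffFun r S Pα Pβ) (-H) Z (K + (toReal A)⁻¹ * toReal R) =
      (|(sandwich (S⁻¹ * (toReal A)⁻¹) B).det|⁻¹ : ℝ) * fourierConst m r α β d *
        e (-((H.transpose * toReal A * K).trace : ℂ)) *
        ∑' R : Matrix (Fin m) (Fin n) ℤ,
          thetaTerm A (coeffFun r S Pα Pβ) K (-Z⁻¹) (H + toReal R) := by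
  have hAt : (toReal A).transpose = toReal A := by
    rw [toReal, ← transpose_map, hA.eq]
  have hA0 := hS.det_ne_zero'
  have hS0 := hS.det_ne_zero
  have hB0 := h.det_ne_zero
  set T := sandwich (S⁻¹ * (toReal A)⁻¹) B with hT
  have hdet : T.det ≠ 0 := by
    rw [hT, det_sandwich, det_mul, det_nonsing_inv, det_nonsing_inv, Ring.inverse_eq_inv']
    exact mul_ne_zero (pow_ne_zero _ (mul_ne_zero (inv_ne_zero hS0) (inv_ne_zero hA0)))
      (pow_ne_zero _ hB0)
  -- The inverse transpose replaces `S⁻¹A⁻¹` by `SᵀA`: the lattice dual to `A⁻¹ℤ^{m×n}` is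
  -- `ℤ^{m×n}`, up to the coordinates.
  have hTinv : (T⁻¹).transpose = sandwich (S.transpose * toReal A) B⁻¹.transpose := by
    have h1 : T⁻¹ = sandwich (toReal A * S) B⁻¹ := by
      refine inv_eq_right_inv ?_
      have h2 : S⁻¹ * (toReal A)⁻¹ * (toReal A * S) = 1 := by
        rw [Matrix.mul_assoc, ← Matrix.mul_assoc (toReal A)⁻¹, nonsing_inv_mul _ hA0.isUnit,
          Matrix.one_mul, nonsing_inv_mul _ hS0.isUnit]
      rw [hT, sandwich_mul_sandwich, h2, nonsing_inv_mul _ hB0.isUnit,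
        sandwich_eq_kronecker, transpose_one]
      exact one_kronecker_one
    rw [h1, sandwich_transpose, transpose_mul, hAt]
  set B' := B⁻¹.transpose * diagonal fun j => ‖d j‖⁻¹ with hB'
  have h' : IsDiagonalization (-Z⁻¹) B' fun j => -(starRingEnd ℂ) (d j) := h.neg_inv
  have hsign : |B'.det| / B'.det = |B.det| / B.det := abs_det_div_det_neg_inv h
  have hpoisson := tsum_affine_eq_tsum_fourierPi
    (continuous_heatGauss (fun _ => -1 / (8 * Real.pi)) (signedDiag m r d)
      (eigenPoly r S Pα Pβ))
    (hasRapidDecay_heatGauss _ (signedDiag_im_pos h.im_eq_one) _)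
    (hasRapidDecay_fourierPi_eigenPoly hPα hPβ h.im_eq_one) hdet
    (fun p => (S⁻¹ * K * B) p.1 p.2) fun p => H p.1 p.2
  rw [← (matEquiv m n).tsum_eq, ← (matEquiv m n).tsum_eq fun R : Matrix (Fin m) (Fin n) ℤ =>
    thetaTerm A (coeffFun r S Pα Pβ) K (-Z⁻¹) (H + toReal R)]
  set σ : ℂ := ((|B.det| / B.det : ℝ) : ℂ) ^ (α + β) with hσ
  have hleft : ∀ R : Fin m × Fin n → ℤ, thetaTerm A (coeffFun r S Pα Pβ) (-H) Z
      (K + (toReal A)⁻¹ * toReal (matEquiv m n R)) =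
      σ * e (-((H.transpose * toReal A * K).trace : ℂ)) *
        (heatGauss (fun _ => -1 / (8 * Real.pi)) (signedDiag m r d) (eigenPoly r S Pα Pβ)
          (T.mulVec (fun i => R i) + fun p => (S⁻¹ * K * B) p.1 p.2) *
            e (-((∑ i, R i * H i.1 i.2 : ℝ) : ℂ))) := by
    intro R
    have h1 : (fun p : Fin m × Fin n =>
        (S⁻¹ * (K + (toReal A)⁻¹ * toReal (matEquiv m n R)) * B) p.1 p.2) =
        T.mulVec (fun i => (R i : ℝ)) + fun p => (S⁻¹ * K * B) p.1 p.2 := by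
      have h2 : (fun i => (R i : ℝ)) =
          fun p : Fin m × Fin n => toReal (matEquiv m n R) p.1 p.2 := rfl
      rw [h2, hT, sandwich_mulVec]
      funext p
      rw [Matrix.mul_add, Matrix.add_mul, Matrix.add_apply, add_comm, Pi.add_apply,
        Matrix.mul_assoc S⁻¹ (toReal A)⁻¹]
    have h3 : ((-H).transpose * toReal A * (K + (toReal A)⁻¹ * toReal (matEquiv m n R))).trace =
        -(H.transpose * toReal A * K).trace + -∑ i, (R i : ℝ) * H i.1 i.2 := by
      have h4 : ∑ i : Fin m × Fin n, (R i : ℝ) * H i.1 i.2 =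
          (H.transpose * toReal (matEquiv m n R)).trace := by
        rw [← sum_mul_eq_trace]
        exact Finset.sum_congr rfl fun p _ => mul_comm _ _
      rw [h4, transpose_neg, Matrix.neg_mul, Matrix.neg_mul, Matrix.mul_add, trace_neg, trace_add,
        Matrix.mul_assoc H.transpose (toReal A) (_ * _), mul_nonsing_inv_cancel_left _ _ hA0.isUnit, neg_add]
    rw [thetaTerm_eq hS hPα hPβ h, h1, h3, Complex.ofReal_add, e_add, Complex.ofReal_neg,
      Complex.ofReal_neg, hσ]
    ring
  have hright : ∀ R : Fin m × Fin n → ℤ, σ *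
      (fourierPi (heatGauss (fun _ => -1 / (8 * Real.pi)) (signedDiag m r d)
          (eigenPoly r S Pα Pβ)) ((T⁻¹).transpose.mulVec fun i => R i + H i.1 i.2) *
        e ((∑ i : Fin m × Fin n, (S⁻¹ * K * B) i.1 i.2 *
          (T⁻¹).transpose.mulVec (fun i => R i + H i.1 i.2) i : ℝ) : ℂ)) =
      fourierConst m r α β d *
        thetaTerm A (coeffFun r S Pα Pβ) K (-Z⁻¹) (H + toReal (matEquiv m n R)) := by
    intro R
    set U := H + toReal (matEquiv m n R) with hU
    have h1 : (fun i : Fin m × Fin n => (R i : ℝ) + H i.1 i.2) = fun p => U p.1 p.2 := by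
      funext p
      rw [hU, Matrix.add_apply, toReal_matEquiv, add_comm]
    have h2 : (T⁻¹).transpose.mulVec (fun i => (R i : ℝ) + H i.1 i.2) =
        fun p => (S.transpose * toReal A * U * B⁻¹.transpose) p.1 p.2 := by
      rw [h1, hTinv, sandwich_mulVec]
    -- As `SᵀA = diag(±1) S⁻¹`, the frequency is the sign and `|d|` times the coordinates of `U` for
    -- the diagonalization of `-Z⁻¹`, as `fourierPi_heatGauss_eigenPoly` requires.
    have h3 : (fun p : Fin m × Fin n => (S.transpose * toReal A * U * B⁻¹.transpose) p.1 p.2) =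
        fun p => eigenSign m r p.1 * ‖d p.2‖ * (S⁻¹ * U * B') p.1 p.2 := by
      funext p
      have hd : ‖d p.2‖ ≠ 0 := norm_ne_zero_iff.2 (h.ne_zero p.2)
      rw [hS.transpose_mul_eq, hB', ← Matrix.mul_assoc (S⁻¹ * U), mul_diagonal,
        Matrix.mul_assoc (diagonal _), Matrix.mul_assoc (diagonal _), diagonal_mul]
      field_simp
    have h4 : ∑ i : Fin m × Fin n, (S⁻¹ * K * B) i.1 i.2 *
        (S.transpose * toReal A * U * B⁻¹.transpose) i.1 i.2 =
        (K.transpose * toReal A * U).trace := by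
      rw [sum_mul_eq_trace, transpose_mul, transpose_mul, trace_mul_comm]
      have h5 : B⁻¹.transpose * B.transpose = 1 := by
        rw [← transpose_mul, mul_nonsing_inv _ hB0.isUnit, transpose_one]
      have h6 : S⁻¹.transpose * S.transpose = 1 := by
        rw [← transpose_mul, mul_nonsing_inv _ hS0.isUnit, transpose_one]
      rw [trace_mul_comm]
      rw [show B.transpose * (K.transpose * S⁻¹.transpose) *
        (S.transpose * toReal A * U * B⁻¹.transpose) =
        B.transpose * (K.transpose * (S⁻¹.transpose * S.transpose) * toReal A * U *
          B⁻¹.transpose) by simp only [Matrix.mul_assoc], h6, Matrix.mul_one, trace_mul_comm,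
        Matrix.mul_assoc, h5, Matrix.mul_one]
    rw [h2, h4, h3, fourierPi_heatGauss_eigenPoly hPα hPβ h.im_eq_one,
      thetaTerm_eq hS hPα hPβ h', hsign]
    ring
  simp only [hleft]
  rw [tsum_mul_left, hpoisson, mul_comm σ, mul_assoc, mul_left_comm σ, ← tsum_mul_left (a := σ)]
  simp only [hright]
  rw [tsum_mul_left]
  ring

end Transform

/-! ### The discriminant group -/

section Discriminant

open Matrix

variable {m n : ℕ} {A : Matrix (Fin m) (Fin m) ℤ}

theorem toReal_mul {a b c : ℕ} (P : Matrix (Fin a) (Fin b) ℤ) (Q : Matrix (Fin b) (Fin c) ℤ) :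
    toReal (P * Q) = toReal P * toReal Q :=
  Matrix.map_mul (f := Int.castRingHom ℝ)

theorem det_toReal {a : ℕ} (P : Matrix (Fin a) (Fin a) ℤ) : (toReal P).det = (P.det : ℝ) :=
  (RingHom.map_det (Int.castRingHom ℝ) P).symm

theorem toReal_injective {a b : ℕ} :
    Function.Injective (toReal : Matrix (Fin a) (Fin b) ℤ → Matrix (Fin a) (Fin b) ℝ) :=
  Matrix.map_injective Int.cast_injective

theorem isUnit_det_toReal (hdet : A.det ≠ 0) : IsUnit (toReal A).det := by
  rw [det_toReal]
  exact (Int.cast_ne_zero.2 hdet).isUnit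

/-- The class of `A⁻¹R` depends only on `R` modulo `det A`, because `det A = A · adj A` puts every
multiple of `det A` into the image of `A`. -/
theorem finite_discriminantGroup (hdet : A.det ≠ 0) (n : ℕ) : Finite (DiscriminantGroup A n) := by
  have hu := isUnit_det_toReal hdet
  have hrep : ∀ J : DiscriminantGroup A n, ∃ R : Matrix (Fin m) (Fin n) ℤ,
      (toReal A)⁻¹ * toReal R = J.rep := fun J => (Quotient.out J).2
  choose R hR using hrep
  have : NeZero A.det.natAbs := ⟨Int.natAbs_ne_zero.2 hdet⟩
  refine Finite.of_injective (β := Fin m → Fin n → ZMod A.det.natAbs)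
    (fun J i j => (R J i j : ZMod A.det.natAbs)) fun J J' hJ => ?_
  have hdvd : ∀ i j, ∃ q : ℤ, R J' i j - R J i j = A.det * q := fun i j => by
    have h1 := congrFun (congrFun hJ i) j
    rw [ZMod.intCast_eq_intCast_iff_dvd_sub] at h1
    exact Int.natAbs_dvd.1 h1
  choose q hq using hdvd
  have hsub : R J' - R J = A * (A.adjugate * Matrix.of q) := by
    rw [← Matrix.mul_assoc, mul_adjugate, Matrix.smul_mul, Matrix.one_mul]
    ext i j
    exact hq i j
  rw [← Quotient.out_eq J, ← Quotient.out_eq J']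
  refine QuotientAddGroup.eq.2 ?_
  rw [AddSubgroup.mem_addSubgroupOf]
  refine ⟨A.adjugate * Matrix.of q, ?_⟩
  have h2 : ((-Quotient.out J + Quotient.out J' : dualLattice A n) : Matrix (Fin m) (Fin n) ℝ) =
      -J.rep + J'.rep := rfl
  rw [h2, ← hR J, ← hR J', ← Matrix.mul_neg, ← Matrix.mul_add]
  have h3 : -toReal (R J) + toReal (R J') = toReal A * toReal (A.adjugate * Matrix.of q) := by
    rw [← toReal_mul, ← hsub]
    ext i j
    simp [toReal]
    ring
  rw [h3, nonsing_inv_mul_cancel_left _ _ hu]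

theorem toReal_mem_dualLattice (hdet : A.det ≠ 0) (R : Matrix (Fin m) (Fin n) ℤ) :
    toReal R ∈ dualLattice A n :=
  ⟨A * R, by
    change (toReal A)⁻¹ * toReal (A * R) = toReal R
    rw [toReal_mul, nonsing_inv_mul_cancel_left _ _ (isUnit_det_toReal hdet)]⟩

/-- Unique decomposition of a dual lattice element into the chosen representative of its class and
an integral matrix; the sum over the dual lattice is regrouped along it. -/
theorem bijective_rep_add (hdet : A.det ≠ 0) :
    Function.Bijective fun x : DiscriminantGroup A n × Matrix (Fin m) (Fin n) ℤ =>
      (Quotient.out x.1 + ⟨toReal x.2, toReal_mem_dualLattice hdet x.2⟩ : dualLattice A n) := by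
  have hmk : ∀ (J : DiscriminantGroup A n) (R : Matrix (Fin m) (Fin n) ℤ),
      ((Quotient.out J + ⟨toReal R, toReal_mem_dualLattice hdet R⟩ : dualLattice A n) :
        DiscriminantGroup A n) = J := by
    intro J R
    conv_rhs => rw [← Quotient.out_eq J]
    refine (QuotientAddGroup.eq.2 ?_).symm
    rw [AddSubgroup.mem_addSubgroupOf, neg_add_cancel_left]
    exact ⟨R, rfl⟩
  constructor
  · rintro ⟨J, R⟩ ⟨J', R'⟩ hJ
    have h1 : J = J' := by
      rw [← hmk J R, ← hmk J' R']
      exact congrArg _ hJ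
    subst h1
    have h2 := congrArg Subtype.val (add_left_cancel hJ)
    exact Prod.ext rfl (toReal_injective h2)
  · intro x
    have h1 : -Quotient.out (x : DiscriminantGroup A n) + x ∈
        (intLattice m n).addSubgroupOf (dualLattice A n) :=
      QuotientAddGroup.eq.1 (Quotient.out_eq (x : DiscriminantGroup A n))
    obtain ⟨R, hR⟩ := AddSubgroup.mem_addSubgroupOf.1 h1
    refine ⟨(x, R), ?_⟩
    have h2 : (⟨toReal R, toReal_mem_dualLattice hdet R⟩ : dualLattice A n) =
        -Quotient.out (x : DiscriminantGroup A n) + x := Subtype.ext hR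
    change Quotient.out (x : DiscriminantGroup A n) + (⟨toReal R, _⟩ : dualLattice A n) = x
    rw [h2, add_neg_cancel_left]

/-- Summation over the dual lattice by classes. -/
theorem finsum_tsum_rep_add (hdet : A.det ≠ 0) {g : Matrix (Fin m) (Fin n) ℝ → ℂ}
    (hg : Summable fun R : Matrix (Fin m) (Fin n) ℤ => g ((toReal A)⁻¹ * toReal R)) :
    ∑ᶠ J : DiscriminantGroup A n, ∑' R : Matrix (Fin m) (Fin n) ℤ, g (J.rep + toReal R) =
      ∑' R : Matrix (Fin m) (Fin n) ℤ, g ((toReal A)⁻¹ * toReal R) := by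
  have := finite_discriminantGroup hdet n
  have hbij : Function.Bijective fun R : Matrix (Fin m) (Fin n) ℤ =>
      (⟨(toReal A)⁻¹ * toReal R, R, rfl⟩ : dualLattice A n) := by
    constructor
    · intro R R' h
      have h1 := congrArg (fun x : dualLattice A n => toReal A * x.1) h
      simp only [mul_nonsing_inv_cancel_left _ _ (isUnit_det_toReal hdet)] at h1
      exact toReal_injective h1
    · rintro ⟨_, R, rfl⟩
      exact ⟨R, rfl⟩
  have h1 := (Equiv.ofBijective _ hbij).tsum_eq fun x : dualLattice A n => g x
  have h2 := (Equiv.ofBijective _ (bijective_rep_add (n := n) hdet)).tsum_eq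
    fun x : dualLattice A n => g x
  have hs : Summable fun x : dualLattice A n => g x :=
    (Equiv.ofBijective _ hbij).summable_iff.1 hg
  have hs' := (Equiv.ofBijective _ (bijective_rep_add (n := n) hdet)).summable_iff.2 hs
  refine Eq.trans ?_ (h2.trans h1.symm)
  refine Eq.trans ?_ hs'.tsum_prod.symm
  rw [tsum_eq_finsum (Set.toFinite _)]
  rfl

end Discriminant

/-! ### The multiplier -/

section Multiplier

open Matrix

/-- Write `ζ = i · (-iζ)` with `Re(-iζ) > 0`; the arguments add up to less than `π`, so the
principal logarithm is additive here. -/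
theorem cpow_eq_I_cpow_mul {ζ : ℂ} (hζ : 0 < ζ.im) (κ : ℂ) :
    ζ ^ κ = Complex.exp (Real.pi * Complex.I / 2 * κ) * (-Complex.I * ζ) ^ κ := by
  have hre : 0 < (-Complex.I * ζ).re := by simpa using hζ
  have hw0 : -Complex.I * ζ ≠ 0 := by
    intro h
    rw [h] at hre
    simp at hre
  have harg := abs_lt.1 (Complex.abs_arg_lt_pi_div_two_iff.2 (Or.inl hre))
  have hlog : Complex.log ζ = Real.pi * Complex.I / 2 + Complex.log (-Complex.I * ζ) := by
    have h1 : ζ = Complex.I * (-Complex.I * ζ) := by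
      rw [← mul_assoc, mul_neg, Complex.I_mul_I, neg_neg, one_mul]
    conv_lhs => rw [h1]
    rw [Complex.log_mul Complex.I_ne_zero hw0, Complex.log_I]
    · ring
    · rw [Complex.arg_I]
      constructor <;> linarith [Real.pi_pos]
  have hz0 : ζ ≠ 0 := by
    rintro rfl
    simp at hζ
  rw [Complex.cpow_def_of_ne_zero hz0, Complex.cpow_def_of_ne_zero hw0, hlog, ← Complex.exp_add]
  ring_nf

variable {n : ℕ} {Z : Matrix (Fin n) (Fin n) ℂ}

/-- Half-integral powers are the only ambiguous ones. By `gaussInt_eq_prod_roots` they are integral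
powers of the Gaussian integral, after which the eigenvalues no longer appear. -/
theorem detPow_eq (hZ : Z ∈ upperHalfSpace n) (q k : ℤ) :
    detPow Z ((q : ℂ) / 2 + k) =
      Complex.exp (Real.pi * Complex.I / 4 * (n * q)) * gaussInt Z ^ (-q) * Z.det ^ k := by
  obtain ⟨ζ, hζ⟩ := exists_roots_charpoly Z
  have him : ∀ j, 0 < (ζ j).im := fun j => charpoly_root_im_pos hZ (by
    rw [hζ]; exact Multiset.mem_map_of_mem ζ (Finset.mem_univ j))
  have hdet : Z.det = ∏ j, ζ j := by
    rw [det_eq_prod_roots_charpoly, hζ]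
    rfl
  rw [gaussInt_eq_prod_roots hZ hζ, hdet, detPow, hζ, Multiset.map_map]
  change ∏ j, ζ j ^ ((q : ℂ) / 2 + k) = _
  have hterm : ∀ j, ζ j ^ ((q : ℂ) / 2 + k) = Complex.exp (Real.pi * Complex.I / 4 * q) *
      ((-Complex.I * ζ j) ^ (-(1 / 2) : ℂ)) ^ (-q) * ζ j ^ k := by
    intro j
    have h0 : ζ j ≠ 0 := by
      intro h
      have := him j
      simp [h] at this
    rw [Complex.cpow_add _ _ h0, Complex.cpow_intCast, cpow_eq_I_cpow_mul (him j),
      ← Complex.cpow_int_mul]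
    congr 2
    · congr 1
      ring
    · congr 1
      push_cast
      ring
  simp only [hterm, Finset.prod_mul_distrib, Finset.prod_zpow, Finset.prod_const, Finset.card_univ,
    Fintype.card_fin, ← Complex.exp_nat_mul]
  congr 3
  ring

theorem conj_cpow_neg_half {d : ℂ} (hd : d.im = 1) :
    (-Complex.I * -(starRingEnd ℂ) d) ^ (-(1 / 2) : ℂ) =
      (starRingEnd ℂ) ((-Complex.I * d) ^ (-(1 / 2) : ℂ)) := by
  have hre : 0 < (-Complex.I * d).re := by simp [hd]
  have harg : (-Complex.I * d).arg ≠ Real.pi := by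
    have := abs_lt.1 (Complex.abs_arg_lt_pi_div_two_iff.2 (Or.inl hre))
    intro h
    rw [h] at this
    linarith [this.2, Real.pi_pos]
  have h1 : -Complex.I * -(starRingEnd ℂ) d = (starRingEnd ℂ) (-Complex.I * d) := by
    simp
  have h2 : (starRingEnd ℂ) (-(1 / 2) : ℂ) = (-(1 / 2) : ℂ) := by
    rw [map_neg, map_div₀, map_one, Complex.conj_ofNat]
  rw [h1, Complex.conj_cpow _ _ harg, h2]

theorem prod_signedDiag (r s : ℕ) {d : Fin n → ℂ} (hd : ∀ j, (d j).im = 1) :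
    ∏ p : Fin (r + s) × Fin n, (-Complex.I * signedDiag (r + s) r d p) ^ (-(1 / 2) : ℂ) =
      (∏ j, (-Complex.I * d j) ^ (-(1 / 2) : ℂ)) ^ r *
        (starRingEnd ℂ) (∏ j, (-Complex.I * d j) ^ (-(1 / 2) : ℂ)) ^ s := by
  rw [Fintype.prod_prod_type, Fin.prod_univ_add, map_prod]
  simp only [signedDiag, Fin.val_castAdd, Fin.is_lt, if_true, Fin.val_natAdd,
    (Nat.le_add_right r _).not_gt, if_false, conj_cpow_neg_half (hd _), Finset.prod_const,
    Finset.card_univ, Fintype.card_fin]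

theorem normSq_prod_cpow_neg_half (d : Fin n → ℂ) :
    (∏ j, (-Complex.I * d j) ^ (-(1 / 2) : ℂ)) *
      (starRingEnd ℂ) (∏ j, (-Complex.I * d j) ^ (-(1 / 2) : ℂ)) =
        ((∏ j, ‖d j‖ : ℝ) : ℂ)⁻¹ := by
  rw [Complex.mul_conj', ← Complex.ofReal_pow, ← norm_pow, ← Finset.prod_pow]
  simp only [cpow_neg_half_sq]
  rw [norm_prod, ← Complex.ofReal_inv, ← Finset.prod_inv_distrib]
  simp

/-- The contributions `-(r+s)/4`, `s/2` and `(r-s)/4` of `πi n` cancel. What is left is `2πi β n`,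
the two terms `βn` in the exponent of `-1` making it a whole number of turns. -/
theorem phase_eq_one (r s n β : ℕ) :
    Complex.I ^ (-(((r + s : ℕ) : ℂ) * n) / 2) *
      (-1 : ℂ) ^ (((s : ℂ) / 2 + β) * n + (β : ℂ) * n) *
        Complex.exp (Real.pi * Complex.I / 4 * (n * ((r : ℤ) - s : ℤ))) = 1 := by
  rw [Complex.cpow_def_of_ne_zero Complex.I_ne_zero,
    Complex.cpow_def_of_ne_zero (neg_ne_zero.2 one_ne_zero), Complex.log_I, Complex.log_neg_one,
    ← Complex.exp_add, ← Complex.exp_add, Complex.exp_eq_one_iff]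
  refine ⟨β * n, ?_⟩
  push_cast
  ring

end Multiplier

/-! ### Assembly of the constants and the transformation formula -/

section Transformation

open Matrix

variable {m n r s : ℕ} {A : Matrix (Fin m) (Fin m) ℤ} {S : Matrix (Fin m) (Fin m) ℝ}
  {Pα Pβ : MatPoly m n} {α β : ℕ} {Z : Matrix (Fin n) (Fin n) ℂ}
  {B : Matrix (Fin n) (Fin n) ℝ} {d : Fin n → ℂ}

theorem IsDiagonalization.det_imPart_rpow (h : IsDiagonalization Z B d) (l : ℤ) :
    (imPart Z).det ^ (-(l : ℝ) / 2) = |B.det| ^ (-l) := by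
  rw [h.imPart_eq, det_mul, det_transpose, ← sq, ← sq_abs, ← Real.rpow_natCast,
    ← Real.rpow_mul (abs_nonneg _), ← Real.rpow_intCast]
  congr 1
  push_cast
  ring

/-- From `|det S|² |det A| = 1` follow both `|det (S⁻¹A⁻¹)| = |det S|` and `|det A|^{-n/2} = |det
S|^n`. -/
theorem IsNormalizedEigenbasis.abs_det_sandwich_inv (hS : IsNormalizedEigenbasis A r s S)
    (hdet : A.det ≠ 0) (B : Matrix (Fin n) (Fin n) ℝ) :
    |(sandwich (S⁻¹ * (toReal A)⁻¹) B).det|⁻¹ =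
      (|(A.det : ℝ)| ^ (-(n : ℝ) / 2))⁻¹ * (|B.det| ^ m)⁻¹ := by
  have h1 := hS.abs_det
  rw [det_toReal] at h1
  have ha : 0 < |(A.det : ℝ)| := abs_pos.2 (Int.cast_ne_zero.2 hdet)
  have hσ : 0 < |S.det| := abs_pos.2 hS.det_ne_zero
  have hroot : |(A.det : ℝ)| ^ (-(n : ℝ) / 2) = |S.det| ^ n := by
    have h2 : |(A.det : ℝ)| = (|S.det| ^ 2)⁻¹ := by
      rw [sq_abs]
      exact eq_inv_of_mul_eq_one_right h1
    rw [h2, ← Real.rpow_natCast |S.det| n, ← Real.rpow_natCast |S.det| 2,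
      ← Real.rpow_neg hσ.le, ← Real.rpow_mul hσ.le]
    congr 1
    push_cast
    ring
  have h3 : |S.det|⁻¹ * |(A.det : ℝ)|⁻¹ = |S.det| := by
    rw [← sq_abs] at h1
    field_simp
    linarith
  rw [det_sandwich, det_mul, det_nonsing_inv, det_nonsing_inv, Ring.inverse_eq_inv',
    det_toReal, abs_mul, abs_pow, abs_pow, abs_mul, abs_inv, abs_inv, h3,
    hroot, mul_inv]

theorem fourierConst_eq (r s α β : ℕ) (hd : ∀ j, (d j).im = 1) :
    fourierConst (r + s) r α β d =
      (∏ j, (-Complex.I * d j) ^ (-(1 / 2) : ℂ)) ^ ((r : ℤ) - s) *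
        ((∏ j, ‖d j‖ : ℝ) : ℂ) ^ (-(s : ℤ)) *
          (((∏ j, ‖d j‖ : ℝ) : ℂ) / ∏ j, d j) ^ ((α : ℤ) - β) := by
  have hd0 : ∀ j, d j ≠ 0 := fun j h0 => by
    have := hd j
    simp [h0] at this
  have hρ : ((∏ j, ‖d j‖ : ℝ) : ℂ) ≠ 0 :=
    Complex.ofReal_ne_zero.2 (Finset.prod_ne_zero_iff.2 fun j _ => norm_ne_zero_iff.2 (hd0 j))
  have hΔ : ∏ j, d j ≠ 0 := Finset.prod_ne_zero_iff.2 fun j _ => hd0 j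
  have h1 := normSq_prod_cpow_neg_half d
  have h2 : ∏ j, (‖d j‖ / (starRingEnd ℂ) (d j) : ℂ) =
      (∏ j, d j) / ((∏ j, ‖d j‖ : ℝ) : ℂ) := by
    rw [Complex.ofReal_prod, ← Finset.prod_div_distrib]
    refine Finset.prod_congr rfl fun j _ => ?_
    have hn : (‖d j‖ : ℂ) ≠ 0 := Complex.ofReal_ne_zero.2 (norm_ne_zero_iff.2 (hd0 j))
    rw [div_eq_div_iff ((map_ne_zero _).2 (hd0 j)) hn, Complex.mul_conj', sq]
  have h3 : ∏ j, (‖d j‖ / d j : ℂ) = ((∏ j, ‖d j‖ : ℝ) : ℂ) / ∏ j, d j := by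
    rw [Complex.ofReal_prod, ← Finset.prod_div_distrib]
  rw [fourierConst, prod_signedDiag r s hd, h2, h3]
  generalize ((∏ j, ‖d j‖ : ℝ) : ℂ) = ρ at *
  generalize ∏ j, d j = Δ at *
  generalize ∏ j, (-Complex.I * d j) ^ (-(1 / 2) : ℂ) = G at *
  have hG : G ≠ 0 := by
    rintro rfl
    rw [zero_mul] at h1
    exact inv_ne_zero hρ h1.symm
  -- As `|G|² = ρ⁻¹`, the conjugate factors from the negative rows become inverse powers of `G`;
  -- this is where the exponent `r - s` comes from.
  have h4 : (starRingEnd ℂ) G = ρ⁻¹ * G⁻¹ := by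
    rw [← h1]
    field_simp
  rw [h4, zpow_sub₀ hG, zpow_sub₀ (div_ne_zero hρ hΔ), _root_.zpow_neg]
  simp only [_root_.zpow_natCast, mul_pow, div_pow, inv_pow]
  field_simp

theorem zpow_identity {b ρ Δ G : ℂ} (hb : b ≠ 0) (hρ : ρ ≠ 0) (hΔ : Δ ≠ 0) (hG : G ≠ 0)
    (r s : ℕ) (k : ℤ) :
    (b⁻¹ * G) ^ (-((r : ℤ) - s)) * (b ^ 2 * Δ) ^ k * b ^ (-(k - s)) * (b ^ (r + s))⁻¹ *
      (G ^ ((r : ℤ) - s) * ρ ^ (-(s : ℤ)) * (ρ / Δ) ^ k) = (b * ρ) ^ (k - s) := by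
  have h2 : (b ^ 2) ^ k = b ^ k * b ^ k := by rw [← _root_.mul_zpow, sq]
  simp only [_root_.mul_zpow, div_zpow, _root_.inv_zpow, h2, _root_.zpow_neg, zpow_sub₀ hb, zpow_sub₀ hρ, zpow_sub₀ hG,
    _root_.zpow_natCast, pow_add]
  have := zpow_ne_zero k hb
  have := zpow_ne_zero k hΔ
  field_simp

/-- Everything is expressed by `|det B|`, `∏ |d_j|`, `∏ d_j` and `G = ∏ (-i d_j)^{-1/2}`. The matrix
belonging to `-Z⁻¹` has absolute determinant `(|det B| ∏ |d_j|)⁻¹`, and `zpow_identity` with `k = α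
- β` and `λ = k - s` compares the powers; the roots of unity cancel by `phase_eq_one`. -/
theorem multiplier_identity (hS : IsNormalizedEigenbasis A r s S) (hdet : A.det ≠ 0)
    (h : IsDiagonalization Z B d) {l : ℤ} (hl : l = (α : ℤ) - β - s) :
    Complex.I ^ (-((m : ℂ) * n) / 2) *
        (-1 : ℂ) ^ (((s : ℂ) / 2 + β) * n + (β : ℂ) * n) *
        ((|((A.det : ℤ) : ℝ)| ^ (-(n : ℝ) / 2) : ℝ) : ℂ) *
        detPow Z (((r : ℂ) - s) / 2 + α - β) *
        (((imPart Z).det ^ (-(l : ℝ) / 2) : ℝ) : ℂ) *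
        ((|(sandwich (S⁻¹ * (toReal A)⁻¹) B).det|⁻¹ : ℝ) * fourierConst m r α β d) =
      (((imPart (-Z⁻¹)).det ^ (-(l : ℝ) / 2) : ℝ) : ℂ) := by
  have hm := hS.card
  subst hm
  have hκ : ((r : ℂ) - s) / 2 + α - β =
      (((r : ℤ) - s : ℤ) : ℂ) / 2 + (((α : ℤ) - β : ℤ) : ℂ) := by
    push_cast
    ring
  have hb : ((|B.det| : ℝ) : ℂ) ≠ 0 := Complex.ofReal_ne_zero.2 (abs_ne_zero.2 h.det_ne_zero)
  have hρ : ((∏ j, ‖d j‖ : ℝ) : ℂ) ≠ 0 :=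
    Complex.ofReal_ne_zero.2 (Finset.prod_ne_zero_iff.2 fun j _ => norm_ne_zero_iff.2 (h.ne_zero j))
  have hΔ : ∏ j, d j ≠ 0 := Finset.prod_ne_zero_iff.2 fun j _ => h.ne_zero j
  have hG : ∏ j, (-Complex.I * d j) ^ (-(1 / 2) : ℂ) ≠ 0 :=
    Finset.prod_ne_zero_iff.2 fun j _ => by
      rw [Complex.cpow_ne_zero_iff]
      exact Or.inl (mul_ne_zero (neg_ne_zero.2 Complex.I_ne_zero) (h.ne_zero j))
  have ha : ((|((A.det : ℤ) : ℝ)| ^ (-(n : ℝ) / 2) : ℝ) : ℂ) ≠ 0 :=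
    Complex.ofReal_ne_zero.2
      (Real.rpow_pos_of_pos (abs_pos.2 (Int.cast_ne_zero.2 hdet)) _).ne'
  have hB' : |(B⁻¹.transpose * diagonal fun j => ‖d j‖⁻¹).det| = (|B.det| * ∏ j, ‖d j‖)⁻¹ := by
    rw [det_mul, det_transpose, det_nonsing_inv, Ring.inverse_eq_inv', det_diagonal, abs_mul,
      abs_inv, Finset.prod_inv_distrib, abs_inv, Finset.abs_prod, mul_inv]
    simp only [abs_norm]
  have hdetZ : Z.det = ((|B.det| : ℝ) : ℂ) ^ 2 * ∏ j, d j := by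
    rw [h.det_eq, ← Complex.ofReal_pow, ← Complex.ofReal_pow, sq_abs]
  have hphase := phase_eq_one r s n β
  have hz := zpow_identity hb hρ hΔ hG r s ((α : ℤ) - β)
  rw [hκ, detPow_eq h.mem_upperHalfSpace, h.gaussInt_eq, hdetZ, h.det_imPart_rpow,
    h.neg_inv.det_imPart_rpow, hB', hS.abs_det_sandwich_inv hdet, fourierConst_eq r s α β h.im_eq_one,
    hl, inv_zpow' (|B.det| * _), neg_neg]
  simp only [Complex.ofReal_mul, Complex.ofReal_zpow, Complex.ofReal_inv,
    Complex.ofReal_pow] at hz ha ⊢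
  rw [← hz]
  generalize Complex.I ^ (-(((r + s : ℕ) : ℂ) * n) / 2) = p₁ at *
  generalize (-1 : ℂ) ^ (((s : ℂ) / 2 + β) * n + (β : ℂ) * n) = p₂ at *
  generalize Complex.exp (Real.pi * Complex.I / 4 * (n * ((r : ℤ) - s : ℤ))) = p₃ at *
  generalize ((|((A.det : ℤ) : ℝ)| ^ (-(n : ℝ) / 2) : ℝ) : ℂ) = a at *
  generalize ∏ j, (-Complex.I * d j) ^ (-(1 / 2) : ℂ) = G at *
  have haa := mul_inv_cancel₀ ha
  conv_rhs => rw [← one_mul (_ * _), ← hphase, ← mul_one (p₁ * p₂ * p₃), ← haa]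
  ring

theorem theta_neg_inv (hA : A.IsSymm) (hdet : A.det ≠ 0) (hS : IsNormalizedEigenbasis A r s S)
    (hPα : IsDetHomogeneous α Pα) (hPβ : IsDetHomogeneous β Pβ) {l : ℤ}
    (hl : l = (α : ℤ) - β - s) (H K : Matrix (Fin m) (Fin n) ℝ) (hZ : Z ∈ upperHalfSpace n) :
    theta A l (coeffFun r S Pα Pβ) H K (-Z⁻¹) =
      Complex.I ^ (-((m : ℂ) * n) / 2) *
        (-1 : ℂ) ^ (((s : ℂ) / 2 + β) * n + (β : ℂ) * n) *
        ((|((A.det : ℤ) : ℝ)| ^ (-(n : ℝ) / 2) : ℝ) : ℂ) *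
        detPow Z (((r : ℂ) - s) / 2 + α - β) *
        e ((H.transpose * toReal A * K).trace : ℂ) *
        ∑ᶠ J : DiscriminantGroup A n, theta A l (coeffFun r S Pα Pβ) (J.rep + K) (-H) Z := by
  obtain ⟨B, d, h⟩ := exists_isDiagonalization hZ
  have hfin := finite_discriminantGroup hdet n
  have hL : ((toReal A)⁻¹).det ≠ 0 := by
    rw [det_nonsing_inv, Ring.inverse_eq_inv']
    exact inv_ne_zero (isUnit_det_toReal hdet).ne_zero
  -- The representatives together with `ℤ^{m×n}` exhaust `A⁻¹ℤ^{m×n}`, so the theta series of all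
  -- classes merge into one sum over the translated dual lattice.
  have hsum : ∑ᶠ J : DiscriminantGroup A n, theta A l (coeffFun r S Pα Pβ) (J.rep + K) (-H) Z =
      (((imPart Z).det ^ (-(l : ℝ) / 2) : ℝ) : ℂ) * ∑' R : Matrix (Fin m) (Fin n) ℤ,
        thetaTerm A (coeffFun r S Pα Pβ) (-H) Z (K + (toReal A)⁻¹ * toReal R) := by
    rw [← finsum_tsum_rep_add hdet (g := fun x => thetaTerm A (coeffFun r S Pα Pβ) (-H) Z (K + x))
      (summable_thetaTerm hS hPα hPβ hZ hL K (-H)), mul_finsum]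
    refine finsum_congr fun J => ?_
    rw [theta]
    congr 1
    refine tsum_congr fun R => ?_
    rw [← add_assoc, add_comm K]
  have he : e ((H.transpose * toReal A * K).trace : ℂ) *
      e (-((H.transpose * toReal A * K).trace : ℂ)) = 1 := by
    rw [← e_add, add_neg_cancel]
    simp [e]
  rw [hsum, tsum_thetaTerm_dual hA hS hPα hPβ h, theta, ← multiplier_identity hS hdet h hl]
  linear_combination (-(Complex.I ^ (-((m : ℂ) * n) / 2) *
        (-1 : ℂ) ^ (((s : ℂ) / 2 + β) * n + (β : ℂ) * n) *
        ((|((A.det : ℤ) : ℝ)| ^ (-(n : ℝ) / 2) : ℝ) : ℂ) *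
        detPow Z (((r : ℂ) - s) / 2 + α - β) *
        (((imPart Z).det ^ (-(l : ℝ) / 2) : ℝ) : ℂ) *
        ((|(sandwich (S⁻¹ * (toReal A)⁻¹) B).det|⁻¹ : ℝ) * fourierConst m r α β d) *
        ∑' R : Matrix (Fin m) (Fin n) ℤ,
          thetaTerm A (coeffFun r S Pα Pβ) K (-Z⁻¹) (H + toReal R))) * he

end Transformation

end SiegelTheta
end

open SiegelTheta in
theorem mainTheorem2 (m n r s : ℕ)
    (A : Matrix (Fin m) (Fin m) ℤ) (hA : A.IsSymm) (hdet : A.det ≠ 0)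
    (S : Matrix (Fin m) (Fin m) ℝ) (hS : IsNormalizedEigenbasis A r s S)
    (α β : ℕ) (Pα Pβ : MatPoly m n)
    (hPα : IsDetHomogeneous α Pα) (hPβ : IsDetHomogeneous β Pβ)
    (l : ℤ) (hl : l = (α : ℤ) - β - s) :
    (∀ (H K : Matrix (Fin m) (Fin n) ℝ), ∀ Z ∈ upperHalfSpace n,
      Summable fun R : Matrix (Fin m) (Fin n) ℤ =>
        thetaTerm A (coeffFun r S Pα Pβ) K Z (H + toReal R)) ∧
    Finite (DiscriminantGroup A n) ∧
    ∀ (H K : Matrix (Fin m) (Fin n) ℝ), ∀ Z ∈ upperHalfSpace n,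
      theta A l (coeffFun r S Pα Pβ) H K (-Z⁻¹) =
        Complex.I ^ (-((m : ℂ) * n) / 2) *
          (-1 : ℂ) ^ (((s : ℂ) / 2 + β) * n + (β : ℂ) * n) *
          ((|((A.det : ℤ) : ℝ)| ^ (-(n : ℝ) / 2) : ℝ) : ℂ) *
          detPow Z (((r : ℂ) - s) / 2 + α - β) *
          e ((H.transpose * toReal A * K).trace : ℂ) *
          ∑ᶠ J : DiscriminantGroup A n, theta A l (coeffFun r S Pα Pβ) (J.rep + K) (-H) Z := by
  refine ⟨fun H K Z hZ => ?_, finite_discriminantGroup hdet n, fun H K Z hZ =>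
    theta_neg_inv hA hdet hS hPα hPβ hl H K hZ⟩
  have h := summable_thetaTerm hS hPα hPβ hZ (L := 1) (by rw [Matrix.det_one]; exact one_ne_zero)
    H K
  simpa only [Matrix.one_mul] using h
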